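/- **Setting.** A hypergraph $\Sigma$ has a set of wires and a set of boxes, each box with a finite list of input wires and a finite list of output wires (in $\Sigma$, repetitions allowed). A *string diagram* $\varphi$ over $\Sigma$ is a finite hypergraph $G$ with a hypergraph morphism $\mathsf{type}:G\to\Sigma$, a list $p(1),\dots,p(n)$ of global input wires and a list $q(1),\dots,q(m)$ of global output wires of $G$, such that $G$ has no directed cycle and every wire of $G$ is a global input or an output of a box in precisely one way. A box is *eliminable* if none of its outputs is a global output or an input of a box; $\varphi$ is *normalized* if it has no eliminable box, and $\mathsf{norm}(\varphi)$ is obtained by iteratively removing eliminable boxes together with their outputs. $\mathsf{FreeMarkov}_\Sigma$ is the strict Markov category whose objects are finite sequences of wires of $\Sigma$ and whose morphisms are isomorphism classes of normalized string diagrams; composition is gluing of diagrams followed by normalization. $\varphi$ is a *pure bloom causal model* if it is normalized and $q$ is a bijection onto the wires of $G$. Write $\mathsf{in}(\varphi)$, $\mathsf{out}(\varphi)$ for the sets of global input and output wires, $\mathsf{in}(b)$, $\mathsf{out}(b)$ for the sets of input and output wires of a box $b$, and $A\to B$ for wires if some box has $A$ among its inputs and $B$ among its outputs; $\mathsf{Dec}(\mathcal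 X)$ is the set of wires reachable from $\mathcal X$ by directed paths of length $\ge 0$. Let $\mathbf C$ be a strict Markov category with conditionals, i.e. every $f:A\to X\otimes Y$ arises by generating $X$ from $A$ by the marginal of $f$ and then $Y$ from $X$ and $A$ by some morphism $X\otimes A\to Y$. Let $\varphi$ be a pure bloom causal model over $\Sigma$ whose boxes have pairwise distinct types in $\Sigma$. Let $T$ assign an object of $\mathbf C$ to each wire of $\Sigma$, put $W'_i=T(\mathsf{type}(p(i)))$, $V'_j=T(\mathsf{type}(q(j)))$, and let $f:\bigotimes_{i=1}^n W'_i\to\bigotimes_{j=1}^m V'_j$ be a morphism in $\mathbf C$. Assume that for every box of $\Sigma$ that is not the type of a box of $\varphi$, with inputs $A_1,\dots,A_k$ and outputs $B_1,\dots,B_l$, there is at least one morphism $\bigotimes_i T(A_i)\to\bigotimes_j T(B_j)$ in $\mathbf C$ (this is void if every box of $\Sigma$ occurs in $\varphi$). For disjoint sets of outputs $\mathcal X,\mathcal Y,\mathcal Z$: * $\mathcal X\perp\mathcal Y\mid\mathcal Z$ *in $f$* means that the marginal of $f$ on $\mathcal X,\mathcal Z,\mathcal Y$ is obtained by generating $\mathcal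 Z'\otimes\mathcal Y'$ from the input of $f$ by some morphism, copying $\mathcal Z'$, and applying some morphism $\mathcal Z'\to\mathcal X'$ to one of the copies, where $\mathcal X',\mathcal Y',\mathcal Z'$ are the corresponding tensor products of factors $V'_j$. * $\mathcal Z$ *$d$-separates* $\mathcal X$ and $\mathcal Y$ *in $\varphi$* if, after discarding all outputs of $\varphi$ outside $\mathcal X\cup\mathcal Y\cup\mathcal Z$, normalizing, and deleting the wires in $\mathcal Z$ (but no boxes), there is no undirected path from a wire in $\mathcal X$ to a wire in $\mathcal Y$. An undirected path is a sequence of wires in which any two successive ones are both incident (as input or output) to a common box. Consider the following properties of $f$. * $f$ is *compatible* with $\varphi$: there is a strict Markov functor $F:\mathsf{FreeMarkov}_\Sigma\to\mathbf C$ with $F(\mathsf{type}(p(i)))=W'_i$ and $F(\mathsf{type}(q(j)))=V'_j$ for all $i,j$, and $F(\varphi)=f$. * $f$ *passes its inputs through*: the marginal of $f$ on those outputs that are also global inputs of $\varphi$, taken in the order of the inputs, is the identity of $\bigotimes_i W'_i$. (This is void if $\varphi$ has no global inputs.) * *Global Markov property*: for all disjoint $\mathcal X,\mathcal Y,\mathcal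 Z\subseteq\mathsf{out}(\varphi)$ with $\mathsf{in}(\varphi)\subseteq\mathcal Y\cup\mathcal Z$, if $\mathcal Z$ $d$-separates $\mathcal X$ and $\mathcal Y$ in $\varphi$, then $\mathcal X\perp\mathcal Y\mid\mathcal Z$ in $f$. * *Local Markov property*: for every box $b$ of $\varphi$, $\ \mathsf{out}(b)\perp \mathsf{Dec}(\mathsf{out}(b))^{c}\setminus\mathsf{in}(b)\mid\mathsf{in}(b)$ in $f$. **Theorem.** The following are equivalent: 1. $f$ is compatible with $\varphi$; 2. $f$ passes its inputs through and satisfies the global Markov property; 3. $f$ passes its inputs through and satisfies the local Markov property. Moreover, the global Markov property implies the local Markov property even without the assumption that $f$ passes its inputs through. -/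

import Mathlib

open CategoryTheory MonoidalCategory ComonObj

universe w v u

noncomputable section

/-! ### Strict Markov categories, conditionals -/

/-- A monoidal category is strict if tensoring of objects is associative and unital on the nose and
the associators and unitors are the resulting identities. -/
structure IsStrictMonoidal (C : Type u) [Category.{v} C] [MonoidalCategory C] : Prop where
  tensor_assoc : ∀ X Y Z : C, (X ⊗ Y) ⊗ Z = X ⊗ (Y ⊗ Z)
  unit_tensor : ∀ X : C, 𝟙_ C ⊗ X = X
  tensor_unit : ∀ X : C, X ⊗ 𝟙_ C = X
  associator_eq : ∀ X Y Z : C, (α_ X Y Z).hom = eqToHom (tensor_assoc X Y Z)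
  leftUnitor_eq : ∀ X : C, (λ_ X).hom = eqToHom (unit_tensor X)
  rightUnitor_eq : ∀ X : C, (ρ_ X).hom = eqToHom (tensor_unit X)

section Markov

variable {C : Type u} [Category.{v} C] [MonoidalCategory C] [MarkovCategory C]

/-- Copy the input and apply `f` to one copy and `g` to the other. -/
def copyPair {A X Y : C} (f : A ⟶ X) (g : A ⟶ Y) : A ⟶ X ⊗ Y :=
  Δ[A] ≫ (f ⊗ₘ g)

/-- `C` has conditionals: every `f : A ⟶ X ⊗ Y` can be generated by first generating `X` from `A`
(by the marginal of `f`), and then `Y` from `X` and `A` by some morphism `c`. -/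
def HasConditionals (C : Type u) [Category.{v} C] [MonoidalCategory C] [MarkovCategory C] : Prop :=
  ∀ (A X Y : C) (f : A ⟶ X ⊗ Y), ∃ c : X ⊗ A ⟶ Y,
    f = copyPair (f ≫ (X ◁ ε[Y]) ≫ (ρ_ X).hom) (𝟙 A) ≫
      (Δ[X] ▷ A) ≫ (α_ X X A).hom ≫ (X ◁ c)

/-- The tensor product `V 0 ⊗ (V 1 ⊗ (⋯ ⊗ 𝟙_ C))` of a finite family of objects. -/
def tensorFin : {n : ℕ} → (Fin n → C) → C
  | 0, _ => 𝟙_ C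
  | _ + 1, V => V 0 ⊗ tensorFin (fun i => V i.succ)

/-- The projection to the `k`th tensor factor, discarding all the others. -/
def projFin : {n : ℕ} → (V : Fin n → C) → (k : Fin n) → (tensorFin V ⟶ V k)
  | _ + 1, V, ⟨0, _⟩ => (V 0 ◁ ε[tensorFin fun i => V i.succ]) ≫ (ρ_ (V 0)).hom
  | _ + 1, V, ⟨k + 1, hk⟩ =>
      (ε[V 0] ▷ tensorFin fun i => V i.succ) ≫ (λ_ _).hom ≫
        projFin (fun i => V i.succ) ⟨k, Nat.lt_of_succ_lt_succ hk⟩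

/-- The wiring `V 0 ⊗ ⋯ ⊗ V (n-1) ⟶ V (s 0) ⊗ ⋯ ⊗ V (s (k-1))` built from copying and discarding.
If `s` is injective, then this permutes the factors in the image of `s` and discards the others. -/
def selectFin {n : ℕ} (V : Fin n → C) :
    {k : ℕ} → (s : Fin k → Fin n) → (tensorFin V ⟶ tensorFin (fun i => V (s i)))
  | 0, _ => ε[tensorFin V]
  | _ + 1, s => copyPair (projFin V (s 0)) (selectFin V (fun i => s i.succ))

/-- The tensor product of the factors with positions in `X` (in increasing order). -/
def subTensor {n : ℕ} (V : Fin n → C) (X : Finset (Fin n)) : C :=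
  tensorFin (fun i => V (X.orderEmbOfFin rfl i))

/-- Marginalization to the factors with positions in `X`. -/
def marg {n : ℕ} (V : Fin n → C) (X : Finset (Fin n)) : tensorFin V ⟶ subTensor V X :=
  selectFin V (X.orderEmbOfFin rfl)

/-- The conditional independence `X ⊥ Y | Z` (for disjoint sets of positions): the marginal of `f`
on `X`, `Z`, `Y` is obtained by generating `Z` and `Y` from the input by some morphism `g`,
copying `Z`, and generating `X` from one copy of `Z` alone by some morphism `h`. -/
def CondIndep {A : C} {n : ℕ} (V : Fin n → C) (f : A ⟶ tensorFin V)
    (X Y Z : Finset (Fin n)) : Prop :=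
  ∃ (g : A ⟶ subTensor V Z ⊗ subTensor V Y) (h : subTensor V Z ⟶ subTensor V X),
    f ≫ copyPair (marg V X) (copyPair (marg V Z) (marg V Y)) =
      g ≫ (copyPair h (𝟙 (subTensor V Z)) ▷ subTensor V Y) ≫ (α_ _ _ _).hom

end Markov

/-! ### Hypergraphs -/

/-- A (directed) hypergraph: every box has a finite list of input wires and a finite list of output
wires. (A box in `B_{k,l}` is a box with `k` inputs and `l` outputs.) -/
structure DiHypergraph where
  Wire : Type w
  Box : Type w
  src : Box → List Wire
  tgt : Box → List Wire

namespace DiHypergraph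

/-- Morphisms of hypergraphs. -/
structure Hom (G : DiHypergraph.{w}) (H : DiHypergraph.{v}) where
  wire : G.Wire → H.Wire
  box : G.Box → H.Box
  src_box : ∀ b, H.src (box b) = (G.src b).map wire
  tgt_box : ∀ b, H.tgt (box b) = (G.tgt b).map wire

variable (G : DiHypergraph.{w})

/-- `A → B`: some box has `A` among its inputs and `B` among its outputs. -/
def Edge (A B : G.Wire) : Prop := ∃ b, A ∈ G.src b ∧ B ∈ G.tgt b

/-- There is no directed cycle of wires (and boxes). -/
def Acyclic : Prop := ∀ A : G.Wire, ¬ Relation.TransGen G.Edge A A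

/-- The descendants of a set of wires (including the wires in the set). -/
def Dec (X : Set G.Wire) : Set G.Wire := {B | ∃ A ∈ X, Relation.ReflTransGen G.Edge A B}

/-- Two wires that are both incident to a common box. -/
def Adjacent (A B : G.Wire) : Prop :=
  ∃ b, (A ∈ G.src b ∨ A ∈ G.tgt b) ∧ (B ∈ G.src b ∨ B ∈ G.tgt b)

/-- There is an undirected path between two wires. -/
def UndirectedPath (A B : G.Wire) : Prop := Relation.ReflTransGen G.Adjacent A B

open Classical in
/-- Remove the wires in `Z`, also from the inputs and outputs of all boxes; the boxes are kept. -/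
def cut (Z : Set G.Wire) : DiHypergraph.{w} where
  Wire := {A : G.Wire // A ∉ Z}
  Box := G.Box
  src b := (G.src b).filterMap fun A => if h : A ∈ Z then none else some ⟨A, h⟩
  tgt b := (G.tgt b).filterMap fun A => if h : A ∈ Z then none else some ⟨A, h⟩

end DiHypergraph

/-! ### Multiplicities in lists -/

section Occ

variable {α β : Type}

open Classical in
/-- The number of occurrences of `x` in the list `l`. -/
def occ (l : List α) (x : α) : ℕ := l.count x

open Classical in
theorem occ_append (l l' : List α) (x : α) : occ (l ++ l') x = occ l x + occ l' x :=
  List.count_append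

open Classical in
theorem occ_pos {l : List α} {x : α} : 0 < occ l x ↔ x ∈ l := List.count_pos_iff

open Classical in
theorem occ_eq_zero {l : List α} {x : α} : occ l x = 0 ↔ x ∉ l := List.count_eq_zero

open Classical in
theorem occ_map {f : α → β} (hf : Function.Injective f) (l : List α) (x : α) :
    occ (l.map f) (f x) = occ l x :=
  List.count_map_of_injective _ _ hf _

theorem occ_map_of_ne {f : α → β} (l : List α) {y : β} (h : ∀ x, f x ≠ y) :
    occ (l.map f) y = 0 := by
  rw [occ_eq_zero, List.mem_map]
  rintro ⟨x, _, hx⟩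
  exact h x hx

open Classical in
theorem occ_map_of_iff {f : α → β} (l : List α) {x : α} {y : β} (h : ∀ z, f z = y ↔ z = x) :
    occ (l.map f) y = occ l x := by
  refine List.countP_map.trans (List.countP_congr fun z _ => ?_)
  rw [Function.comp_apply]
  exact beq_iff_eq.trans ((h z).trans beq_iff_eq.symm)

open Classical in
theorem occ_eq_one {l : List α} (h : l.Nodup) {x : α} (hx : x ∈ l) : occ l x = 1 :=
  List.count_eq_one_of_mem h hx

open Classical in
theorem nodup_of_occ_le {l : List α} (h : ∀ x, occ l x ≤ 1) : l.Nodup :=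
  List.nodup_iff_count_le_one.2 h

theorem occ_attachWith (P : α → Prop) (l : List α) (h : ∀ x ∈ l, P x) (y : {x // P x}) :
    occ (l.attachWith P h) y = occ l y.1 := by
  conv_rhs => rw [← List.attachWith_map_subtype_val (p := P) (l := l) h]
  exact (occ_map Subtype.val_injective _ _).symm

theorem sum_subtype_eq {P : α → Prop} [Fintype α] [Fintype {x // P x}] (f : α → ℕ)
    (h : ∀ x, ¬ P x → f x = 0) : ∑ x : {x // P x}, f x.1 = ∑ x, f x := by
  classical
  rw [← Finset.sum_subtype (Finset.univ.filter P) (by simp) f]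
  refine Finset.sum_subset (Finset.subset_univ _) fun x _ hx => h x fun hP => ?_
  exact hx (Finset.mem_filter.2 ⟨Finset.mem_univ _, hP⟩)

theorem transGen_inl {α β : Type} {r : α → α → Prop} {R : α ⊕ β → α ⊕ β → Prop}
    (h : ∀ u y, R u (Sum.inl y) → ∃ x, u = Sum.inl x ∧ r x y) {u : α ⊕ β} {y : α}
    (H : Relation.TransGen R u (Sum.inl y)) : ∃ x, u = Sum.inl x ∧ Relation.TransGen r x y := by
  induction H using Relation.TransGen.head_induction_on with
  | single H =>
    obtain ⟨x, hx, hr⟩ := h _ _ H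
    exact ⟨x, hx, .single hr⟩
  | head H _ ih =>
    obtain ⟨x, rfl, hr⟩ := ih
    obtain ⟨x', hx', hr'⟩ := h _ _ H
    exact ⟨x', hx', .head hr' hr⟩

theorem transGen_inr {α β : Type} {r : β → β → Prop} {R : α ⊕ β → α ⊕ β → Prop}
    (h : ∀ x u, R (Sum.inr x) u → ∃ y, u = Sum.inr y ∧ r x y) {x : β} {u : α ⊕ β}
    (H : Relation.TransGen R (Sum.inr x) u) : ∃ y, u = Sum.inr y ∧ Relation.TransGen r x y := by
  induction H with
  | single H =>
    obtain ⟨y, hy, hr⟩ := h _ _ H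
    exact ⟨y, hy, .single hr⟩
  | tail _ H ih =>
    obtain ⟨y, rfl, hr⟩ := ih
    obtain ⟨y', hy', hr'⟩ := h _ _ H
    exact ⟨y', hy', .tail hr hr'⟩

theorem map_get_finRange {α : Type*} (a : List α) : (List.finRange a.length).map a.get = a := by
  rw [← List.ofFn_eq_map, List.ofFn_get]

end Occ

/-! ### gs-monoidal string diagrams -/

/-- A gs-monoidal string diagram over `S`, with domain and codomain the finite sequences `a` and `b`
of wires of `S`: a finite, acyclic, left monogamous hypergraph over `S` with a list of global inputs
and a list of global outputs (the two legs of the cospan). -/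
structure StringDiagram (S : DiHypergraph.{w}) (a b : List S.Wire) where
  G : DiHypergraph.{0}
  finWire : Finite G.Wire
  fintypeBox : Fintype G.Box
  type : G.Hom S
  inputs : List G.Wire
  outputs : List G.Wire
  inputs_type : inputs.map type.wire = a
  outputs_type : outputs.map type.wire = b
  acyclic : G.Acyclic
  /-- Every wire is a global input or an output of a box in precisely one way. -/
  leftMonogamous : ∀ A : G.Wire, occ inputs A + ∑ x : G.Box, occ (G.tgt x) A = 1

attribute [instance] StringDiagram.finWire StringDiagram.fintypeBox

namespace StringDiagram

variable {S : DiHypergraph.{w}} {a b c d : List S.Wire}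

/-- Isomorphism of string diagrams (of cospans over `S`). -/
def Iso (φ ψ : StringDiagram S a b) : Prop :=
  ∃ (e : φ.G.Wire ≃ ψ.G.Wire) (e' : φ.G.Box ≃ ψ.G.Box),
    (∀ x, ψ.G.src (e' x) = (φ.G.src x).map e) ∧
    (∀ x, ψ.G.tgt (e' x) = (φ.G.tgt x).map e) ∧
    (∀ A, ψ.type.wire (e A) = φ.type.wire A) ∧
    (∀ x, ψ.type.box (e' x) = φ.type.box x) ∧
    ψ.inputs = φ.inputs.map e ∧ ψ.outputs = φ.outputs.map e

theorem length_inputs (φ : StringDiagram S a b) : φ.inputs.length = a.length := by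
  rw [← List.length_map (f := φ.type.wire), φ.inputs_type]

theorem length_outputs (φ : StringDiagram S a b) : φ.outputs.length = b.length := by
  rw [← List.length_map (f := φ.type.wire), φ.outputs_type]

/-- The `i`th global input wire. -/
def inWire (φ : StringDiagram S a b) (i : Fin a.length) : φ.G.Wire :=
  φ.inputs.get (i.cast φ.length_inputs.symm)

/-- The `j`th global output wire. -/
def outWire (φ : StringDiagram S a b) (j : Fin b.length) : φ.G.Wire :=
  φ.outputs.get (j.cast φ.length_outputs.symm)

theorem type_inWire (φ : StringDiagram S a b) (i : Fin a.length) :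
    φ.type.wire (φ.inWire i) = a.get i := by
  have h : i.1 < (φ.inputs.map φ.type.wire).length := by rw [φ.inputs_type]; exact i.2
  exact (List.getElem_map φ.type.wire (h := h)).symm.trans (List.getElem_of_eq φ.inputs_type h)

theorem type_outWire (φ : StringDiagram S a b) (j : Fin b.length) :
    φ.type.wire (φ.outWire j) = b.get j := by
  have h : j.1 < (φ.outputs.map φ.type.wire).length := by rw [φ.outputs_type]; exact j.2
  exact (List.getElem_map φ.type.wire (h := h)).symm.trans (List.getElem_of_eq φ.outputs_type h)

theorem tgt_unique (φ : StringDiagram S a b) {A : φ.G.Wire} {x y : φ.G.Box}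
    (hx : A ∈ φ.G.tgt x) (hy : A ∈ φ.G.tgt y) : x = y := by
  classical
  by_contra hne
  have h := φ.leftMonogamous A
  have h1 : ∑ z ∈ ({x, y} : Finset φ.G.Box), occ (φ.G.tgt z) A ≤
      ∑ z : φ.G.Box, occ (φ.G.tgt z) A :=
    Finset.sum_le_sum_of_subset (Finset.subset_univ _)
  rw [Finset.sum_pair hne] at h1
  have h2 := occ_pos.2 hx
  have h3 := occ_pos.2 hy
  omega

theorem not_mem_tgt_of_mem_inputs (φ : StringDiagram S a b) {A : φ.G.Wire}
    (hA : A ∈ φ.inputs) (x : φ.G.Box) : A ∉ φ.G.tgt x := by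
  intro hx
  have h := φ.leftMonogamous A
  have h1 := Finset.single_le_sum (f := fun z : φ.G.Box => occ (φ.G.tgt z) A)
    (fun _ _ => Nat.zero_le _) (Finset.mem_univ x)
  have h2 := occ_pos.2 hx
  have h3 := occ_pos.2 hA
  omega

theorem inputs_nodup (φ : StringDiagram S a b) : φ.inputs.Nodup :=
  nodup_of_occ_le fun A => (Nat.le_add_right _ _).trans (φ.leftMonogamous A).le

/-! #### Eliminable boxes and normalization -/

/-- A box all of whose outputs are discarded right away. -/
def Eliminable (φ : StringDiagram S a b) (x : φ.G.Box) : Prop :=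
  ∀ A ∈ φ.G.tgt x, A ∉ φ.outputs ∧ ∀ y, A ∉ φ.G.src y

def Normalized (φ : StringDiagram S a b) : Prop := ∀ x, ¬ φ.Eliminable x

/-- The boxes that are removed when eliminable boxes are iteratively eliminated: those whose outputs
are not global outputs and are inputs only of boxes that have themselves been removed before. -/
inductive Discarded (φ : StringDiagram S a b) : φ.G.Box → Prop
  | intro (x : φ.G.Box) (h : ∀ A ∈ φ.G.tgt x, A ∉ φ.outputs)
      (h' : ∀ A ∈ φ.G.tgt x, ∀ y, A ∈ φ.G.src y → Discarded φ y) : Discarded φ x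

/-- The wires that remain after normalization: all but the outputs of the discarded boxes. -/
def Remains (φ : StringDiagram S a b) (A : φ.G.Wire) : Prop :=
  ∀ x, A ∈ φ.G.tgt x → ¬ φ.Discarded x

theorem remains_inputs (φ : StringDiagram S a b) (A : φ.G.Wire) (h : A ∈ φ.inputs) :
    φ.Remains A :=
  fun x hx => absurd hx (φ.not_mem_tgt_of_mem_inputs h x)

theorem remains_outputs (φ : StringDiagram S a b) (A : φ.G.Wire) (h : A ∈ φ.outputs) :
    φ.Remains A := by
  rintro x hx ⟨_, h1, _⟩
  exact h1 A hx h

theorem remains_src (φ : StringDiagram S a b) {x : φ.G.Box} (hx : ¬ φ.Discarded x)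
    (A : φ.G.Wire) (h : A ∈ φ.G.src x) : φ.Remains A := by
  rintro y hy ⟨_, _, h2⟩
  exact hx (h2 A hy x h)

theorem remains_tgt (φ : StringDiagram S a b) {x : φ.G.Box} (hx : ¬ φ.Discarded x)
    (A : φ.G.Wire) (h : A ∈ φ.G.tgt x) : φ.Remains A := by
  intro y hy
  rwa [φ.tgt_unique hy h]

/-- The hypergraph of the normalization. -/
def normGraph (φ : StringDiagram S a b) : DiHypergraph.{0} where
  Wire := {A : φ.G.Wire // φ.Remains A}
  Box := {x : φ.G.Box // ¬ φ.Discarded x}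
  src x := (φ.G.src x.1).attachWith φ.Remains (φ.remains_src x.2)
  tgt x := (φ.G.tgt x.1).attachWith φ.Remains (φ.remains_tgt x.2)

open Classical in
/-- The normalization of a string diagram, in which all eliminable boxes have been eliminated. -/
def norm (φ : StringDiagram S a b) : StringDiagram S a b where
  G := φ.normGraph
  finWire := inferInstanceAs (Finite {A : φ.G.Wire // φ.Remains A})
  fintypeBox := inferInstanceAs (Fintype {x : φ.G.Box // ¬ φ.Discarded x})
  type :=
    { wire := fun A => φ.type.wire A.1
      box := fun x => φ.type.box x.1
      src_box := fun x => by
        rw [φ.type.src_box]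
        conv_lhs => rw [← List.attachWith_map_subtype_val (φ.remains_src x.2)]
        rw [List.map_map]; rfl
      tgt_box := fun x => by
        rw [φ.type.tgt_box]
        conv_lhs => rw [← List.attachWith_map_subtype_val (φ.remains_tgt x.2)]
        rw [List.map_map]; rfl }
  inputs := φ.inputs.attachWith φ.Remains φ.remains_inputs
  outputs := φ.outputs.attachWith φ.Remains φ.remains_outputs
  inputs_type := by
    conv_rhs => rw [← φ.inputs_type, ← List.attachWith_map_subtype_val φ.remains_inputs]
    rw [List.map_map]; rfl
  outputs_type := by
    conv_rhs => rw [← φ.outputs_type, ← List.attachWith_map_subtype_val φ.remains_outputs]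
    rw [List.map_map]; rfl
  acyclic := by
    intro A hA
    refine φ.acyclic A.1 (hA.lift (p := φ.G.Edge) Subtype.val ?_)
    rintro B B' ⟨x, h1, h2⟩
    exact ⟨x.1, (List.mem_attachWith _ _).1 h1, (List.mem_attachWith _ _).1 h2⟩
  leftMonogamous := by
    intro A
    rw [← φ.leftMonogamous A.1]
    refine congrArg₂ (· + ·) (occ_attachWith φ.Remains _ φ.remains_inputs A) ?_
    have h1 : ∀ x : {x : φ.G.Box // ¬ φ.Discarded x},
        occ (φ.normGraph.tgt x) A = occ (φ.G.tgt x.1) A.1 :=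
      fun x => occ_attachWith φ.Remains _ (φ.remains_tgt x.2) A
    refine (Finset.sum_congr rfl fun x _ => h1 x).trans
      (sum_subtype_eq (P := fun x => ¬ φ.Discarded x) (fun x => occ (φ.G.tgt x) A.1)
        fun x hx => occ_eq_zero.2 fun hA => hx fun hd => A.2 x hA hd)

theorem norm_normalized (φ : StringDiagram S a b) : φ.norm.Normalized := by
  intro x hx
  refine x.2 ⟨x.1, fun A hA hout => ?_, fun A hA y hy => ?_⟩
  · exact (hx ⟨A, φ.remains_tgt x.2 A hA⟩ ((List.mem_attachWith _ _).2 hA)).1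
      ((List.mem_attachWith _ _).2 hout)
  · by_contra hd
    exact (hx ⟨A, φ.remains_tgt x.2 A hA⟩ ((List.mem_attachWith _ _).2 hA)).2 ⟨y, hd⟩
      ((List.mem_attachWith _ _).2 hy)

/-! #### Composition, tensor product and structure morphisms -/

/-- The diagram without boxes whose wires are the elements of `V`, each a global input in precisely
one way; the list of outputs is arbitrary. -/
def discrete {V : Type} [Finite V] (t : V → S.Wire) (i o : List V)
    (hi : ∀ x, occ i x = 1) (ha : i.map t = a) (hb : o.map t = b) : StringDiagram S a b where
  G := { Wire := V, Box := Empty, src := Empty.elim, tgt := Empty.elim }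
  finWire := inferInstanceAs (Finite V)
  fintypeBox := inferInstanceAs (Fintype Empty)
  type := { wire := t, box := Empty.elim, src_box := fun x => x.elim, tgt_box := fun x => x.elim }
  inputs := i
  outputs := o
  inputs_type := ha
  outputs_type := hb
  acyclic := by
    intro A hA
    obtain ⟨B, ⟨x, _⟩, _⟩ := Relation.TransGen.head'_iff.1 hA
    exact x.elim
  leftMonogamous := by
    intro x
    exact congrArg₂ (· + ·) (hi x) (rfl : ∑ y : Empty, occ (Empty.elim y : List V) x = 0)

/-- The identity diagram. -/
def ident (a : List S.Wire) : StringDiagram S a a :=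
  discrete a.get (List.finRange a.length) (List.finRange a.length) (fun x => occ_eq_one (List.nodup_finRange _) (List.mem_finRange x))
    (map_get_finRange a) (map_get_finRange a)

/-- The diagram copying all its inputs. -/
def copy (a : List S.Wire) : StringDiagram S a (a ++ a) :=
  discrete a.get (List.finRange a.length) (List.finRange a.length ++ List.finRange a.length)
    (fun x => occ_eq_one (List.nodup_finRange _) (List.mem_finRange x)) (map_get_finRange a) (by
      rw [List.map_append, map_get_finRange])

/-- The diagram discarding all its inputs. -/
def del (a : List S.Wire) : StringDiagram S a [] :=
  discrete a.get (List.finRange a.length) [] (fun x => occ_eq_one (List.nodup_finRange _) (List.mem_finRange x))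
    (map_get_finRange a) rfl

/-- The diagram swapping `a` and `b`. -/
def swap (a b : List S.Wire) : StringDiagram S (a ++ b) (b ++ a) :=
  discrete (V := Fin a.length ⊕ Fin b.length) (Sum.elim a.get b.get)
    ((List.finRange a.length).map Sum.inl ++ (List.finRange b.length).map Sum.inr)
    ((List.finRange b.length).map Sum.inr ++ (List.finRange a.length).map Sum.inl)
    (by
      rintro (x | x)
      · rw [occ_append, occ_map Sum.inl_injective, occ_map_of_ne _ (fun _ => Sum.inr_ne_inl),
          occ_eq_one (List.nodup_finRange _) (List.mem_finRange x)]
      · rw [occ_append, occ_map Sum.inr_injective, occ_map_of_ne _ (fun _ => Sum.inl_ne_inr),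
          occ_eq_one (List.nodup_finRange _) (List.mem_finRange x)])
    (by
      rw [List.map_append, List.map_map, List.map_map, Sum.elim_comp_inl, Sum.elim_comp_inr,
        map_get_finRange, map_get_finRange])
    (by
      rw [List.map_append, List.map_map, List.map_map, Sum.elim_comp_inl, Sum.elim_comp_inr,
        map_get_finRange, map_get_finRange])

/-- Juxtaposition of string diagrams. -/
def tensor (φ : StringDiagram S a b) (ψ : StringDiagram S c d) :
    StringDiagram S (a ++ c) (b ++ d) where
  G :=
    { Wire := φ.G.Wire ⊕ ψ.G.Wire
      Box := φ.G.Box ⊕ ψ.G.Box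
      src := Sum.elim (fun x => (φ.G.src x).map Sum.inl) (fun x => (ψ.G.src x).map Sum.inr)
      tgt := Sum.elim (fun x => (φ.G.tgt x).map Sum.inl) (fun x => (ψ.G.tgt x).map Sum.inr) }
  finWire := inferInstanceAs (Finite (φ.G.Wire ⊕ ψ.G.Wire))
  fintypeBox := inferInstanceAs (Fintype (φ.G.Box ⊕ ψ.G.Box))
  type :=
    { wire := Sum.elim φ.type.wire ψ.type.wire
      box := Sum.elim φ.type.box ψ.type.box
      src_box := by
        rintro (x | x)
        · simpa using φ.type.src_box x
        · simpa using ψ.type.src_box x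
      tgt_box := by
        rintro (x | x)
        · simpa using φ.type.tgt_box x
        · simpa using ψ.type.tgt_box x }
  inputs := φ.inputs.map Sum.inl ++ ψ.inputs.map Sum.inr
  outputs := φ.outputs.map Sum.inl ++ ψ.outputs.map Sum.inr
  inputs_type := by
    rw [List.map_append, List.map_map, List.map_map, Sum.elim_comp_inl, Sum.elim_comp_inr,
      φ.inputs_type, ψ.inputs_type]
  outputs_type := by
    rw [List.map_append, List.map_map, List.map_map, Sum.elim_comp_inl, Sum.elim_comp_inr,
      φ.outputs_type, ψ.outputs_type]
  acyclic := by
    rintro (A | A) hA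
    · obtain ⟨B, hB, hAB⟩ := transGen_inl (r := φ.G.Edge) (by
        rintro u B ⟨x | x, h1, h2⟩
        · obtain ⟨A, hA, rfl⟩ := List.mem_map.1 h1
          obtain ⟨B', hB, h⟩ := List.mem_map.1 h2
          exact ⟨A, rfl, x, hA, Sum.inl_injective h ▸ hB⟩
        · obtain ⟨B', hB, h⟩ := List.mem_map.1 h2
          exact absurd h Sum.inr_ne_inl) hA
      exact φ.acyclic A (Sum.inl_injective hB ▸ hAB)
    · obtain ⟨B, hB, hAB⟩ := transGen_inr (r := ψ.G.Edge) (by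
        rintro A u ⟨x | x, h1, h2⟩
        · obtain ⟨B', hB, h⟩ := List.mem_map.1 h1
          exact absurd h Sum.inl_ne_inr
        · obtain ⟨A', hA, h⟩ := List.mem_map.1 h1
          obtain ⟨B, hB, rfl⟩ := List.mem_map.1 h2
          exact ⟨B, rfl, x, Sum.inr_injective h ▸ hA, hB⟩) hA
      exact ψ.acyclic A (Sum.inr_injective hB ▸ hAB)
  leftMonogamous := by
    rintro (A | A)
    · rw [← φ.leftMonogamous A, occ_append, occ_map Sum.inl_injective,
        occ_map_of_ne _ (fun _ => Sum.inr_ne_inl), add_zero]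
      refine congrArg _ ((Fintype.sum_sum_type _).trans ?_)
      refine (congrArg₂ (· + ·)
        (Finset.sum_congr rfl fun x _ => occ_map Sum.inl_injective (φ.G.tgt x) A)
        (Finset.sum_eq_zero fun x _ => occ_map_of_ne (ψ.G.tgt x)
          (fun _ => Sum.inr_ne_inl))).trans (add_zero _)
    · rw [← ψ.leftMonogamous A, occ_append, occ_map Sum.inr_injective,
        occ_map_of_ne _ (fun _ => Sum.inl_ne_inr), zero_add]
      refine congrArg _ ((Fintype.sum_sum_type _).trans ?_)
      refine (congrArg₂ (· + ·)
        (Finset.sum_eq_zero fun x _ => occ_map_of_ne (φ.G.tgt x)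
          (fun _ => Sum.inl_ne_inr))
        (Finset.sum_congr rfl fun x _ => occ_map Sum.inr_injective (ψ.G.tgt x) A)).trans
          (zero_add _)

open Classical in
/-- The identification of the wires of `ψ` when `ψ` is glued to `φ`: the `i`th global input of `ψ`
becomes the `i`th global output of `φ`; the other wires of `ψ` are kept. (This is the pushout of
sets along the two cospan legs, since the leg of global inputs is injective.) -/
def glue (φ : StringDiagram S a b) (ψ : StringDiagram S b c) (A : ψ.G.Wire) :
    φ.G.Wire ⊕ {A : ψ.G.Wire // A ∉ ψ.inputs} :=
  if h : A ∈ ψ.inputs then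
    Sum.inl (φ.outputs.get ⟨ψ.inputs.idxOf A, by
      rw [φ.length_outputs, ← ψ.length_inputs]; exact List.idxOf_lt_length_iff.2 h⟩)
  else Sum.inr ⟨A, h⟩

theorem glue_inputs (φ : StringDiagram S a b) (ψ : StringDiagram S b c) (i : Fin b.length) :
    glue φ ψ (ψ.inWire i) = Sum.inl (φ.outWire i) := by
  classical
  have h : ψ.inWire i ∈ ψ.inputs := List.get_mem _ _
  rw [glue, dif_pos h]
  congr 2
  ext
  simpa [inWire] using ψ.inputs_nodup.idxOf_getElem _ _

theorem glue_not_mem (φ : StringDiagram S a b) (ψ : StringDiagram S b c) {A : ψ.G.Wire}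
    (h : A ∉ ψ.inputs) : glue φ ψ A = Sum.inr ⟨A, h⟩ := dif_neg h

theorem glue_tgt (φ : StringDiagram S a b) (ψ : StringDiagram S b c) {A : ψ.G.Wire} {x : ψ.G.Box}
    (h : A ∈ ψ.G.tgt x) :
    glue φ ψ A = Sum.inr ⟨A, fun h' => ψ.not_mem_tgt_of_mem_inputs h' x h⟩ :=
  glue_not_mem φ ψ _

theorem glue_eq_inr (φ : StringDiagram S a b) (ψ : StringDiagram S b c) {A : ψ.G.Wire}
    {B : {A : ψ.G.Wire // A ∉ ψ.inputs}} (h : glue φ ψ A = Sum.inr B) : A = B.1 := by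
  unfold glue at h
  split at h
  · exact absurd h Sum.inl_ne_inr
  · exact congrArg Subtype.val (Sum.inr_injective h)

theorem occ_map_glue (φ : StringDiagram S a b) (ψ : StringDiagram S b c) (l : List ψ.G.Wire)
    (A : {A : ψ.G.Wire // A ∉ ψ.inputs}) : occ (l.map (glue φ ψ)) (Sum.inr A) = occ l A.1 :=
  occ_map_of_iff l fun _ => ⟨glue_eq_inr φ ψ, fun h => by rw [h, glue_not_mem φ ψ A.2]⟩

theorem glue_type (φ : StringDiagram S a b) (ψ : StringDiagram S b c) (A : ψ.G.Wire) :
    Sum.elim φ.type.wire (fun B : {A : ψ.G.Wire // A ∉ ψ.inputs} => ψ.type.wire B.1)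
      (glue φ ψ A) = ψ.type.wire A := by
  by_cases h : A ∈ ψ.inputs
  · obtain ⟨k, hk⟩ := List.get_of_mem h
    have hA : A = ψ.inWire (k.cast ψ.length_inputs) := by rw [← hk]; rfl
    rw [hA, glue_inputs, Sum.elim_inl, type_outWire, type_inWire]
  · rw [glue_not_mem φ ψ h, Sum.elim_inr]

/-- Composition of string diagrams: connect the global outputs of `φ` to the global inputs of `ψ`
(pushout of cospans). -/
def comp (φ : StringDiagram S a b) (ψ : StringDiagram S b c) : StringDiagram S a c where
  G :=
    { Wire := φ.G.Wire ⊕ {A : ψ.G.Wire // A ∉ ψ.inputs}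
      Box := φ.G.Box ⊕ ψ.G.Box
      src := Sum.elim (fun x => (φ.G.src x).map Sum.inl) (fun x => (ψ.G.src x).map (glue φ ψ))
      tgt := Sum.elim (fun x => (φ.G.tgt x).map Sum.inl) (fun x => (ψ.G.tgt x).map (glue φ ψ)) }
  finWire := inferInstanceAs (Finite (φ.G.Wire ⊕ {A : ψ.G.Wire // A ∉ ψ.inputs}))
  fintypeBox := inferInstanceAs (Fintype (φ.G.Box ⊕ ψ.G.Box))
  type :=
    { wire := Sum.elim φ.type.wire (fun A => ψ.type.wire A.1)
      box := Sum.elim φ.type.box ψ.type.box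
      src_box := by
        rintro (x | x)
        · simpa using φ.type.src_box x
        · simpa [Function.comp_def, glue_type] using ψ.type.src_box x
      tgt_box := by
        rintro (x | x)
        · simpa using φ.type.tgt_box x
        · simpa [Function.comp_def, glue_type] using ψ.type.tgt_box x }
  inputs := φ.inputs.map Sum.inl
  outputs := ψ.outputs.map (glue φ ψ)
  inputs_type := by
    rw [List.map_map, Sum.elim_comp_inl, φ.inputs_type]
  outputs_type := by
    simpa [Function.comp_def, glue_type] using ψ.outputs_type
  acyclic := by
    rintro (A | A) hA
    · obtain ⟨B, hB, hAB⟩ := transGen_inl (r := φ.G.Edge) (by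
        rintro u B ⟨x | x, h1, h2⟩
        · obtain ⟨A, hA, rfl⟩ := List.mem_map.1 h1
          obtain ⟨B', hB, h⟩ := List.mem_map.1 h2
          exact ⟨A, rfl, x, hA, Sum.inl_injective h ▸ hB⟩
        · obtain ⟨B', hB, h⟩ := List.mem_map.1 h2
          rw [glue_tgt φ ψ hB] at h
          exact absurd h Sum.inr_ne_inl) hA
      exact φ.acyclic A (Sum.inl_injective hB ▸ hAB)
    · obtain ⟨B, hB, hAB⟩ := transGen_inr (r := fun A B => ψ.G.Edge A.1 B.1) (by
        rintro A u ⟨x | x, h1, h2⟩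
        · obtain ⟨B', hB, h⟩ := List.mem_map.1 h1
          exact absurd h Sum.inl_ne_inr
        · obtain ⟨A', hA, h⟩ := List.mem_map.1 h1
          obtain ⟨B, hB, rfl⟩ := List.mem_map.1 h2
          refine ⟨_, glue_tgt φ ψ hB, x, ?_, hB⟩
          rwa [← glue_eq_inr φ ψ h]) hA
      rw [← Sum.inr_injective hB] at hAB
      exact ψ.acyclic A.1 (hAB.lift (p := ψ.G.Edge) Subtype.val fun _ _ h => h)
  leftMonogamous := by
    rintro (A | A)
    · rw [← φ.leftMonogamous A, occ_map Sum.inl_injective]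
      refine congrArg _ ((Fintype.sum_sum_type _).trans ?_)
      refine (congrArg₂ (· + ·)
        (Finset.sum_congr rfl fun x _ => occ_map Sum.inl_injective (φ.G.tgt x) A)
        (Finset.sum_eq_zero fun x _ => ?_)).trans (add_zero _)
      refine occ_eq_zero.2 fun h => ?_
      obtain ⟨B, hB, h⟩ := List.mem_map.1 h
      rw [glue_tgt φ ψ hB] at h
      exact Sum.inr_ne_inl h
    · rw [← ψ.leftMonogamous A.1, occ_map_of_ne _ (fun _ => Sum.inl_ne_inr),
        occ_eq_zero.2 A.2]
      refine congrArg _ ((Fintype.sum_sum_type _).trans ?_)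
      refine (congrArg₂ (· + ·)
        (Finset.sum_eq_zero fun x _ => occ_map_of_ne (φ.G.tgt x)
          (fun _ => Sum.inl_ne_inr))
        (Finset.sum_congr rfl fun x _ => ?_)).trans (zero_add _)
      exact occ_map_glue φ ψ (ψ.G.tgt x) A

theorem tensor_normalized {φ : StringDiagram S a b} {ψ : StringDiagram S c d}
    (hφ : φ.Normalized) (hψ : ψ.Normalized) : (φ.tensor ψ).Normalized := by
  rintro (x | x) hx
  · refine hφ x fun A hA => ?_
    obtain ⟨h1, h2⟩ := hx (Sum.inl A) (List.mem_map.2 ⟨A, hA, rfl⟩)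
    refine ⟨fun h => h1 (List.mem_append_left _ (List.mem_map.2 ⟨A, h, rfl⟩)), fun y h => ?_⟩
    exact h2 (Sum.inl y) (List.mem_map.2 ⟨A, h, rfl⟩)
  · refine hψ x fun A hA => ?_
    obtain ⟨h1, h2⟩ := hx (Sum.inr A) (List.mem_map.2 ⟨A, hA, rfl⟩)
    refine ⟨fun h => h1 (List.mem_append_right _ (List.mem_map.2 ⟨A, h, rfl⟩)), fun y h => ?_⟩
    exact h2 (Sum.inr y) (List.mem_map.2 ⟨A, h, rfl⟩)

end StringDiagram

/-! ### The free Markov category and strict Markov functors out of it -/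

/-- The normalized string diagrams; up to isomorphism of string diagrams, these are the morphisms
`a ⟶ b` of the free Markov category on `S`, whose objects are the finite sequences of wires
of `S`. -/
def FreeMarkovHom (S : DiHypergraph.{w}) (a b : List S.Wire) :=
  {φ : StringDiagram S a b // φ.Normalized}

namespace FreeMarkovHom

variable {S : DiHypergraph.{w}} {a b c d : List S.Wire}

def ident (a : List S.Wire) : FreeMarkovHom S a a :=
  ⟨StringDiagram.ident a, fun x => Empty.elim x⟩

/-- Composition in the free Markov category: composition of string diagrams, then normalization. -/
def comp (φ : FreeMarkovHom S a b) (ψ : FreeMarkovHom S b c) : FreeMarkovHom S a c :=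
  ⟨(φ.1.comp ψ.1).norm, StringDiagram.norm_normalized _⟩

def tensor (φ : FreeMarkovHom S a b) (ψ : FreeMarkovHom S c d) :
    FreeMarkovHom S (a ++ c) (b ++ d) :=
  ⟨φ.1.tensor ψ.1, StringDiagram.tensor_normalized φ.2 ψ.2⟩

def swap (a b : List S.Wire) : FreeMarkovHom S (a ++ b) (b ++ a) :=
  ⟨StringDiagram.swap a b, fun x => Empty.elim x⟩

def copy (a : List S.Wire) : FreeMarkovHom S a (a ++ a) :=
  ⟨StringDiagram.copy a, fun x => Empty.elim x⟩

def del (a : List S.Wire) : FreeMarkovHom S a [] :=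
  ⟨StringDiagram.del a, fun x => Empty.elim x⟩

end FreeMarkovHom

/-- A strict Markov functor from the free Markov category on `S` to `C`: a strict symmetric monoidal
functor which preserves the comonoid structures. -/
structure FreeMarkovFunctor (S : DiHypergraph.{w}) (C : Type u) [Category.{v} C]
    [MonoidalCategory C] [MarkovCategory C] where
  obj : List S.Wire → C
  map : ∀ {a b : List S.Wire}, FreeMarkovHom S a b → (obj a ⟶ obj b)
  /-- `map` is well defined on isomorphism classes of string diagrams. -/
  map_iso : ∀ {a b : List S.Wire} (φ ψ : FreeMarkovHom S a b), φ.1.Iso ψ.1 → map φ = map ψ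
  map_ident : ∀ a, map (FreeMarkovHom.ident a) = 𝟙 (obj a)
  map_comp : ∀ {a b c : List S.Wire} (φ : FreeMarkovHom S a b) (ψ : FreeMarkovHom S b c),
    map (φ.comp ψ) = map φ ≫ map ψ
  obj_nil : obj [] = 𝟙_ C
  obj_append : ∀ a b, obj (a ++ b) = obj a ⊗ obj b
  map_tensor : ∀ {a b c d : List S.Wire} (φ : FreeMarkovHom S a b) (ψ : FreeMarkovHom S c d),
    map (φ.tensor ψ) =
      eqToHom (obj_append a c) ≫ (map φ ⊗ₘ map ψ) ≫ eqToHom (obj_append b d).symm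
  map_swap : ∀ a b, map (FreeMarkovHom.swap a b) =
    eqToHom (obj_append a b) ≫ (β_ (obj a) (obj b)).hom ≫ eqToHom (obj_append b a).symm
  map_copy : ∀ a, map (FreeMarkovHom.copy a) = Δ[obj a] ≫ eqToHom (obj_append a a).symm
  map_del : ∀ a, map (FreeMarkovHom.del a) = ε[obj a] ≫ eqToHom obj_nil.symm

section Main

variable {C : Type u} [Category.{v} C] [MonoidalCategory C] [MarkovCategory C]
  {S : DiHypergraph.{w}} {a b : List S.Wire}

theorem FreeMarkovFunctor.obj_eq (F : FreeMarkovFunctor S C) : ∀ a : List S.Wire,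
    F.obj a = tensorFin (fun i => F.obj [a.get i])
  | [] => F.obj_nil
  | x :: l => (F.obj_append [x] l).trans (congrArg (F.obj [x] ⊗ ·) (F.obj_eq l))

theorem tensorFin_eq (F : FreeMarkovFunctor S C) {a : List S.Wire} {W : Fin a.length → C}
    (h : ∀ i, W i = F.obj [a.get i]) : tensorFin W = F.obj a := by
  rw [F.obj_eq, funext h]

namespace StringDiagram

/-! ### Causal models, compatibility and the Markov properties -/

/-- A generalized causal model: a normalized string diagram in which every wire is a global output
in at most one way. -/
def IsCausalModel (φ : StringDiagram S a b) : Prop :=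
  φ.Normalized ∧ Function.Injective φ.outWire

/-- A pure bloom causal model: every wire is a global output in precisely one way. -/
def IsPureBloom (φ : StringDiagram S a b) : Prop :=
  φ.Normalized ∧ Function.Bijective φ.outWire

/-- `f` is compatible with the (normalized) string diagram `φ`: there is a strict Markov functor `F`
that maps the types of the global inputs and outputs to the given tensor factors of the domain and
the codomain of `f`, and `φ` to `f`. -/
def Compatible (φ : StringDiagram S a b) (hφ : φ.Normalized) (W : Fin a.length → C)
    (V : Fin b.length → C) (f : tensorFin W ⟶ tensorFin V) : Prop :=
  ∃ (F : FreeMarkovFunctor S C)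
    (hW : ∀ i, W i = F.obj [a.get i]) (hV : ∀ j, V j = F.obj [b.get j]),
    f = eqToHom (tensorFin_eq F hW) ≫ F.map ⟨φ, hφ⟩ ≫ eqToHom (tensorFin_eq F hV).symm

open Classical in
/-- The marginal `φ_X` before normalization: the global outputs that are not in `X` are
discarded. -/
def discardOutside (φ : StringDiagram S a b) (X : Set φ.G.Wire) :
    StringDiagram S a ((φ.outputs.filter (· ∈ X)).map φ.type.wire) where
  G := φ.G
  finWire := φ.finWire
  fintypeBox := φ.fintypeBox
  type := φ.type
  inputs := φ.inputs
  outputs := φ.outputs.filter (· ∈ X)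
  inputs_type := φ.inputs_type
  outputs_type := rfl
  acyclic := φ.acyclic
  leftMonogamous := φ.leftMonogamous

/-- Categorical d-separation of `X` and `Y` by `Z`: in the normalized marginal of `φ` on
`X ∪ Y ∪ Z`, there is no undirected path from a wire in `X` to a wire in `Y` after the wires in `Z`
have been cut. -/
def DSeparated (φ : StringDiagram S a b) (X Y Z : Set φ.G.Wire) : Prop :=
  let ψ : DiHypergraph := (φ.discardOutside (X ∪ Y ∪ Z)).norm.G
  ∀ A B : (ψ.cut {A | A.1 ∈ Z}).Wire, A.1.1 ∈ X → B.1.1 ∈ Y →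
    ¬ (ψ.cut {A | A.1 ∈ Z}).UndirectedPath A B

open Classical in
/-- The positions of the global outputs that belong to a set of wires. -/
def positions (φ : StringDiagram S a b) (X : Set φ.G.Wire) : Finset (Fin b.length) :=
  Finset.univ.filter fun j => φ.outWire j ∈ X

/-- The global Markov property of `f` with respect to `φ`. -/
def GlobalMarkov (φ : StringDiagram S a b) {A : C} (V : Fin b.length → C)
    (f : A ⟶ tensorFin V) : Prop :=
  ∀ X Y Z : Set φ.G.Wire,
    X ⊆ Set.range φ.outWire → Y ⊆ Set.range φ.outWire → Z ⊆ Set.range φ.outWire →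
    Disjoint X Y → Disjoint X Z → Disjoint Y Z → Set.range φ.inWire ⊆ Y ∪ Z →
    φ.DSeparated X Y Z → CondIndep V f (φ.positions X) (φ.positions Y) (φ.positions Z)

/-- The local Markov property of `f` with respect to `φ`: the outputs of every box are independent
of the other non-descendants of these outputs given the inputs of the box. -/
def LocalMarkov (φ : StringDiagram S a b) {A : C} (V : Fin b.length → C)
    (f : A ⟶ tensorFin V) : Prop :=
  ∀ x : φ.G.Box, CondIndep V f (φ.positions {A | A ∈ φ.G.tgt x})
    (φ.positions ((φ.G.Dec {A | A ∈ φ.G.tgt x})ᶜ \ {A | A ∈ φ.G.src x}))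
    (φ.positions {A | A ∈ φ.G.src x})

/-- `f` passes its inputs through: the marginal of `f` on the global outputs of `φ` which are also
global inputs is the identity (`s i` is the position among the outputs of the `i`th input). -/
def PassesInputs (φ : StringDiagram S a b) (W : Fin a.length → C) (V : Fin b.length → C)
    (f : tensorFin W ⟶ tensorFin V) : Prop :=
  ∀ s : Fin a.length → Fin b.length, (∀ i, φ.outWire (s i) = φ.inWire i) →
    ∃ h : W = fun i => V (s i), f ≫ selectFin V s = eqToHom (congrArg tensorFin h)

end StringDiagram

end Main

end

noncomputable section

set_option linter.unusedSectionVars false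

/-! ### Calculus in Markov categories -/

namespace Markov

section

variable {C : Type u} [Category.{v} C] [MonoidalCategory C] [MarkovCategory C]

/-! All three conditions are compared with a fourth one, `GeneratedBy`: there are morphisms, one per
box, such that the outputs of each box arise by applying its morphism to its inputs, jointly with
any collection of wires that do not descend from these outputs. The language for this is `Gen` ("`y`
is generated from `r` by `k`"), a kernel-level form of conditional independence whose rules
`Gen.restrict`, `Gen.chain`, `Gen.exchange` and `Gen.cond` play the part of the graphoid axioms. Of
these only `Gen.cond` needs conditionals.

Strict Markov functors amount to choices of objects for wires and morphisms for boxes. Given such a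
choice, a diagram is evaluated by generating its wires box by box in a topological order (`run`) and
keeping the global outputs (`evalMap`). The result is `GeneratedBy` (`run_generatedBy`), and
conversely a `GeneratedBy` morphism is determined by its marginal on the global inputs
(`run_embedding`, `GeneratedBy.wir`). This uniqueness makes evaluation invariant under isomorphism
and normalization and compatible with composition and tensor products, hence a functor
(`evalFunctor`). Since normalized diagrams are built from single boxes and boxless wirings
(`gen_induction`), every strict Markov functor is of this form (`exists_map_eq_evalMap`).

Compatible implies global Markov: if `Z` d-separates `X` and `Y`, let `U` be the wires connected to
`X` once `Z` is cut. Each remaining box either has all its wires in `U ∪ Z` or has none in `U`.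
Adding the boxes one at a time preserves the independence of `U` from its complement given `Z`
(`GeneratedBy.indep`).

Global implies local: discarding the strict descendants of the outputs of a box makes every box that
reads these outputs disappear in the normalization (`discarded_of_mem_dec`). Cutting the inputs of
the box then isolates its outputs.

Local implies compatible: the local Markov property provides one morphism per box. In a pure bloom
model `f` carries all wires, so `f` itself is `GeneratedBy`; passing the inputs through fixes its
marginal on the inputs, and by uniqueness `f` is the evaluation of `φ`. Distinctness of the box
types turns the morphisms for boxes of `φ` into morphisms for boxes of `S` (`exists_kernels_eq`). -/

/-! ### Projections and pairings -/

/-- Discard the second factor. -/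
def fst (X Y : C) : X ⊗ Y ⟶ X := (X ◁ ε[Y]) ≫ (ρ_ X).hom

/-- Discard the first factor. -/
def snd (X Y : C) : X ⊗ Y ⟶ Y := (ε[X] ▷ Y) ≫ (λ_ Y).hom

/-- This is naturality of discarding, the axiom that separates Markov categories from copy-discard
categories: whatever happens on the discarded factor is lost. -/
theorem tensorHom_fst {X Y X' Y' : C} (f : X ⟶ X') (g : Y ⟶ Y') :
    (f ⊗ₘ g) ≫ fst X' Y' = fst X Y ≫ f := by
  rw [fst, fst, ← id_tensorHom, ← id_tensorHom, tensorHom_comp_tensorHom_assoc,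
    MarkovCategory.discard_natural, Category.comp_id, Category.assoc, ← rightUnitor_naturality,
    ← tensorHom_id, tensorHom_comp_tensorHom_assoc, Category.id_comp, Category.comp_id]

theorem tensorHom_snd {X Y X' Y' : C} (f : X ⟶ X') (g : Y ⟶ Y') :
    (f ⊗ₘ g) ≫ snd X' Y' = snd X Y ≫ g := by
  rw [snd, snd, ← tensorHom_id, ← tensorHom_id, tensorHom_comp_tensorHom_assoc,
    MarkovCategory.discard_natural, Category.comp_id, Category.assoc, ← leftUnitor_naturality,
    ← id_tensorHom, tensorHom_comp_tensorHom_assoc, Category.id_comp, Category.comp_id]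

@[simp]
theorem copyPair_fst {A X Y : C} (f : A ⟶ X) (g : A ⟶ Y) : copyPair f g ≫ fst X Y = f := by
  rw [copyPair, Category.assoc, tensorHom_fst]; simp [fst]

@[simp]
theorem copyPair_snd {A X Y : C} (f : A ⟶ X) (g : A ⟶ Y) : copyPair f g ≫ snd X Y = g := by
  rw [copyPair, Category.assoc, tensorHom_snd]; simp [snd]

@[simp]
theorem copyPair_fst_assoc {A X Y Z : C} (f : A ⟶ X) (g : A ⟶ Y) (h : X ⟶ Z) :
    copyPair f g ≫ fst X Y ≫ h = f ≫ h := by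
  rw [← Category.assoc, copyPair_fst]

@[simp]
theorem copyPair_snd_assoc {A X Y Z : C} (f : A ⟶ X) (g : A ⟶ Y) (h : Y ⟶ Z) :
    copyPair f g ≫ snd X Y ≫ h = g ≫ h := by
  rw [← Category.assoc, copyPair_snd]

@[simp]
theorem copyPair_tensorHom {A X Y X' Y' : C} (f : A ⟶ X) (g : A ⟶ Y) (f' : X ⟶ X') (g' : Y ⟶ Y') :
    copyPair f g ≫ (f' ⊗ₘ g') = copyPair (f ≫ f') (g ≫ g') := by
  simp [copyPair]

@[simp]
theorem copyPair_whiskerLeft {A X Y Y' : C} (f : A ⟶ X) (g : A ⟶ Y) (g' : Y ⟶ Y') :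
    copyPair f g ≫ X ◁ g' = copyPair f (g ≫ g') := by
  rw [← id_tensorHom, copyPair_tensorHom, Category.comp_id]

@[simp]
theorem copyPair_whiskerRight {A X Y X' : C} (f : A ⟶ X) (g : A ⟶ Y) (f' : X ⟶ X') :
    copyPair f g ≫ f' ▷ Y = copyPair (f ≫ f') g := by
  rw [← tensorHom_id, copyPair_tensorHom, Category.comp_id]

theorem copyPair_braiding {A X Y : C} (f : A ⟶ X) (g : A ⟶ Y) :
    copyPair f g ≫ (β_ X Y).hom = copyPair g f := by
  simp [copyPair]

theorem copyPair_assoc {A X Y Z : C} (f : A ⟶ X) (g : A ⟶ Y) (h : A ⟶ Z) :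
    copyPair (copyPair f g) h ≫ (α_ X Y Z).hom = copyPair f (copyPair g h) := by
  have h1 : (Δ[A] ≫ (f ⊗ₘ g)) ⊗ₘ h = Δ[A] ▷ A ≫ ((f ⊗ₘ g) ⊗ₘ h) := by
    rw [← tensorHom_id, tensorHom_comp_tensorHom, Category.id_comp]
  have h2 : f ⊗ₘ (Δ[A] ≫ (g ⊗ₘ h)) = A ◁ Δ[A] ≫ (f ⊗ₘ (g ⊗ₘ h)) := by
    rw [← id_tensorHom, tensorHom_comp_tensorHom, Category.id_comp]
  rw [copyPair, copyPair, copyPair, copyPair, h1, h2, ComonObj.comul_assoc_assoc]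
  simp

/-! ### Deterministic morphisms -/

/-- A morphism is deterministic if it commutes with copying. -/
class Det {X Y : C} (f : X ⟶ Y) : Prop where
  copy : f ≫ Δ[Y] = Δ[X] ≫ (f ⊗ₘ f)

instance (X : C) : Det (𝟙 X) := ⟨by simp⟩

instance {X Y Z : C} (f : X ⟶ Y) (g : Y ⟶ Z) [Det f] [Det g] : Det (f ≫ g) :=
  ⟨by rw [Category.assoc, Det.copy, ← Category.assoc, Det.copy]; simp⟩

instance {X Y : C} (h : X = Y) : Det (eqToHom h) := by
  subst h; exact inferInstanceAs (Det (𝟙 X))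

instance {X Y X' Y' : C} (f : X ⟶ X') (g : Y ⟶ Y') [Det f] [Det g] : Det (f ⊗ₘ g) := ⟨by
  rw [CopyDiscardCategory.copy_tensor, CopyDiscardCategory.copy_tensor, Category.assoc,
    ← tensorμ_natural, tensorHom_comp_tensorHom_assoc, tensorHom_comp_tensorHom_assoc,
    Det.copy, Det.copy]⟩

instance {X : C} : Det ε[X] := ⟨by
  rw [CopyDiscardCategory.copy_unit, ComonObj.counit_comul_hom]⟩

instance {X Y : C} (f : X ⟶ Y) (Z : C) [Det f] : Det (f ▷ Z) := by
  rw [← tensorHom_id]; infer_instance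

instance {X Y : C} (f : X ⟶ Y) (Z : C) [Det f] : Det (Z ◁ f) := by
  rw [← id_tensorHom]; infer_instance

instance (X : C) : Det (λ_ X).hom := ⟨by
  have h : (λ_ (𝟙_ C)).inv ⊗ₘ Δ[X] = (𝟙_ C ◁ Δ[X]) ≫ (λ_ (𝟙_ C)).inv ▷ (X ⊗ X) := by
    rw [MonoidalCategory.tensorHom_def']
  rw [CopyDiscardCategory.copy_tensor, CopyDiscardCategory.copy_unit, Category.assoc, h,
    Category.assoc, ← tensor_left_unitality, leftUnitor_naturality]⟩

instance (X : C) : Det (ρ_ X).hom := ⟨by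
  have h : Δ[X] ⊗ₘ (λ_ (𝟙_ C)).inv = (Δ[X] ▷ 𝟙_ C) ≫ (X ⊗ X) ◁ (λ_ (𝟙_ C)).inv := by
    rw [MonoidalCategory.tensorHom_def]
  rw [CopyDiscardCategory.copy_tensor, CopyDiscardCategory.copy_unit, Category.assoc, h,
    Category.assoc, ← tensor_right_unitality, rightUnitor_naturality]⟩

instance (X Y : C) : Det (fst X Y) := by unfold fst; infer_instance

instance (X Y : C) : Det (snd X Y) := by unfold snd; infer_instance

/-- Running `d` once and copying its result agrees with running it twice because `d` is
deterministic. All wirings qualify; morphisms assigned to boxes need not, which is why later lemmas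
track what is copied. -/
theorem comp_copyPair {A B X Y : C} (d : A ⟶ B) [Det d] (f : B ⟶ X) (g : B ⟶ Y) :
    d ≫ copyPair f g = copyPair (d ≫ f) (d ≫ g) := by
  rw [copyPair, ← Category.assoc, Det.copy]; simp [copyPair]

-- A tensor product is copied by copying both factors and interchanging the two middle ones;
-- dropping one copy of each factor leaves the identity by counitality.
@[simp]
theorem copyPair_fst_snd_id (X Y : C) : copyPair (fst X Y) (snd X Y) = 𝟙 (X ⊗ Y) := by
  have h : (X ◁ ε[Y]) ⊗ₘ (ε[X] ▷ Y) = (𝟙 X ⊗ₘ ε[Y]) ⊗ₘ (ε[X] ⊗ₘ 𝟙 Y) := by simp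
  rw [copyPair, CopyDiscardCategory.copy_tensor, fst, snd, ← tensorHom_comp_tensorHom, h,
    Category.assoc, ← tensorμ_natural_assoc, tensorHom_comp_tensorHom_assoc,
    ← id_tensorHom_id]
  simp only [ComonObj.comul_counit_hom, ComonObj.counit_comul_hom, Category.id_comp]
  simp only [tensorμ, id_tensorHom_id, braiding_tensorUnit_left]
  monoidal

theorem copyPair_assoc_inv {A X Y Z : C} (f : A ⟶ X) (g : A ⟶ Y) (h : A ⟶ Z) :
    copyPair f (copyPair g h) ≫ (α_ X Y Z).inv = copyPair (copyPair f g) h := by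
  rw [← copyPair_assoc, Category.assoc, Iso.hom_inv_id, Category.comp_id]

theorem copyPair_tensorμ {A X Y Z W : C} (f : A ⟶ X) (g : A ⟶ Y) (h : A ⟶ Z) (k : A ⟶ W) :
    copyPair (copyPair f g) (copyPair h k) ≫ tensorμ X Y Z W =
      copyPair (copyPair f h) (copyPair g k) := by
  rw [tensorμ, ← Category.assoc, copyPair_assoc, ← Category.assoc, copyPair_whiskerLeft,
    copyPair_assoc_inv, ← Category.assoc, copyPair_whiskerLeft, copyPair_whiskerRight,
    copyPair_braiding, ← Category.assoc, copyPair_whiskerLeft, copyPair_assoc, copyPair_assoc_inv]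

theorem copyPair_id_id (X : C) : copyPair (𝟙 X) (𝟙 X) = Δ[X] := by simp [copyPair]

/-- Of four copies of the same thing, `tensorμ` exchanges the middle two, which has no effect since
copying is associative and commutative. -/
instance (X : C) : Det Δ[X] := ⟨by
  have h : Δ[X] ≫ (Δ[X] ⊗ₘ Δ[X]) = copyPair Δ[X] Δ[X] := rfl
  rw [CopyDiscardCategory.copy_tensor, ← Category.assoc, h, ← copyPair_id_id, copyPair_tensorμ]⟩

instance {A X Y : C} (f : A ⟶ X) (g : A ⟶ Y) [Det f] [Det g] : Det (copyPair f g) := by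
  unfold copyPair; infer_instance

/-! ### Copying around morphisms that are not deterministic -/

theorem copy_whiskerRight_associator (X A : C) :
    Δ[X] ▷ A ≫ (α_ X X A).hom = copyPair (fst X A) (𝟙 _) := by
  rw [← copyPair_fst_snd_id X A, ← copyPair_assoc, ← Category.id_comp (Δ[X] ▷ A),
    ← copyPair_fst_snd_id, copyPair_whiskerRight, ← copyPair_id_id, comp_copyPair,
    Category.comp_id]

theorem copyPair_id_whiskerRight {X Y : C} (h : X ⟶ Y) (A : C) :
    copyPair h (𝟙 X) ▷ A ≫ (α_ Y X A).hom = copyPair (fst X A ≫ h) (𝟙 _) := by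
  have h1 : copyPair h (𝟙 X) = Δ[X] ≫ h ▷ X := by
    rw [← copyPair_id_id, copyPair_whiskerRight, Category.id_comp]
  rw [h1, comp_whiskerRight, Category.assoc, associator_naturality_left, ← Category.assoc,
    copy_whiskerRight_associator, copyPair_whiskerRight]

theorem hasConditionals_copyPair (hC : HasConditionals C) {A X Y : C} (f : A ⟶ X ⊗ Y) :
    ∃ c : X ⊗ A ⟶ Y, f = copyPair (f ≫ fst X Y) (𝟙 A) ≫ copyPair (fst X A) c := by
  obtain ⟨c, hc⟩ := hC A X Y f
  refine ⟨c, hc.trans ?_⟩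
  rw [← Category.assoc (Δ[X] ▷ A), copy_whiskerRight_associator, copyPair_whiskerLeft, Category.id_comp]
  rfl

/-- No determinism of `k` is required: only the factor `R` is copied, and `k` does not act on it. -/
theorem whiskerRight_copyPair_snd {R Y Z Y' : C} (k : Y ⟶ Y') (h : R ⟶ Z) :
    (k ▷ R) ≫ copyPair (snd Y' R ≫ h) (𝟙 _) = copyPair (snd Y R ≫ h) (k ▷ R) := by
  -- The pairing is spelled out as copying `R` and braiding one copy past `Y`, so that `k` can slide
  -- through by naturality of the braiding.
  have hs : ∀ Y : C, copyPair (snd Y R) (𝟙 (Y ⊗ R)) =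
      Y ◁ Δ[R] ≫ (α_ Y R R).inv ≫ (β_ Y R).hom ▷ R ≫ (α_ R Y R).hom := fun Y => by
    rw [← Category.id_comp (Y ◁ Δ[R]), ← copyPair_fst_snd_id, Category.assoc, ← Category.assoc,
      copyPair_whiskerLeft, ← copyPair_id_id, comp_copyPair, ← Category.assoc, Category.comp_id,
      copyPair_assoc_inv, ← Category.assoc, copyPair_whiskerRight, copyPair_braiding,
      copyPair_assoc]
  have h1 : copyPair (snd Y' R ≫ h) (𝟙 _) = copyPair (snd Y' R) (𝟙 _) ≫ (h ▷ _) := by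
    rw [copyPair_whiskerRight]
  have h2 : copyPair (snd Y R ≫ h) (k ▷ R) = copyPair (snd Y R) (𝟙 _) ≫ (h ⊗ₘ (k ▷ R)) := by simp
  rw [h1, h2, hs, hs, MonoidalCategory.tensorHom_def']
  simp only [Category.assoc]
  rw [← whisker_exchange_assoc]
  simp only [whiskerRight_tensor, Category.assoc, Iso.hom_inv_id_assoc]
  rw [← comp_whiskerRight_assoc, BraidedCategory.braiding_naturality_left,
    comp_whiskerRight_assoc]
  simp

/-- The outcome of `k` is consumed once, by `m`; only `R` is reused. Coassociativity therefore
suffices for an arbitrary `k`. -/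
theorem copyPair_comp_copyPair_snd {R Y Z D : C} (k : R ⟶ Y) (m : Y ⊗ R ⟶ Z) (d : R ⟶ D) :
    copyPair k (𝟙 R) ≫ copyPair m (snd Y R ≫ d) = copyPair (copyPair k (𝟙 R) ≫ m) d := by
  have h : copyPair (𝟙 (Y ⊗ R)) (snd Y R) = Y ◁ Δ[R] ≫ (α_ Y R R).inv := by
    rw [← Category.id_comp (Y ◁ Δ[R]), ← copyPair_fst_snd_id, Category.assoc, ← Category.assoc,
      copyPair_whiskerLeft, ← copyPair_id_id, comp_copyPair, Category.comp_id, copyPair_assoc_inv]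
  have h1 : copyPair m (snd Y R ≫ d) = copyPair (𝟙 (Y ⊗ R)) (snd Y R) ≫ (m ⊗ₘ d) := by
    rw [copyPair_tensorHom, Category.id_comp]
  rw [h1, h, Category.assoc, ← Category.assoc, copyPair_whiskerLeft, Category.id_comp,
    ← copyPair_id_id, ← Category.assoc, copyPair_assoc_inv, copyPair_tensorHom, Category.id_comp]

theorem copyPair_comp_copyPair_id {R Y Z : C} (k : R ⟶ Y) (h : R ⟶ Z) :
    copyPair k (𝟙 R) ≫ copyPair (snd Y R ≫ h) (𝟙 _) = copyPair h (copyPair k (𝟙 R)) := by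
  have h1 : copyPair k (𝟙 R) = Δ[R] ≫ (k ▷ R) := by
    rw [← copyPair_id_id, copyPair_whiskerRight, Category.id_comp]
  rw [h1, Category.assoc, whiskerRight_copyPair_snd, comp_copyPair, ← Category.assoc,
    ← copyPair_id_id, copyPair_snd, Category.id_comp]

theorem tensorHom_fst_assoc {X Y X' Y' Z : C} (f : X ⟶ X') (g : Y ⟶ Y') (h : X' ⟶ Z) :
    (f ⊗ₘ g) ≫ fst X' Y' ≫ h = fst X Y ≫ f ≫ h := by
  rw [← Category.assoc, tensorHom_fst, Category.assoc]

theorem tensorHom_eqToHom {X Y X' Y' : C} (h : X = X') (h' : Y = Y') :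
    eqToHom h ⊗ₘ eqToHom h' = eqToHom (congrArg₂ (· ⊗ ·) h h') := by
  subst h h'; simp

theorem eqToHom_copy {X Y : C} (h : X = Y) :
    eqToHom h ≫ Δ[Y] = Δ[X] ≫ eqToHom (congrArg₂ (· ⊗ ·) h h) := by
  subst h; simp

/-- Move the second of three factors to the front. -/
def rotate (X Y Z : C) : X ⊗ (Y ⊗ Z) ⟶ Y ⊗ (X ⊗ Z) :=
  (α_ X Y Z).inv ≫ (β_ X Y).hom ▷ Z ≫ (α_ Y X Z).hom

theorem copyPair_rotate {A X Y Z : C} (f : A ⟶ X) (g : A ⟶ Y) (h : A ⟶ Z) :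
    copyPair f (copyPair g h) ≫ rotate X Y Z = copyPair g (copyPair f h) := by
  rw [rotate, ← Category.assoc, copyPair_assoc_inv, ← Category.assoc, copyPair_whiskerRight,
    copyPair_braiding, copyPair_assoc]

/-! ### Generating one random variable from another -/

/-- Under `p`, the variable `y` is generated from the variable `r` by the morphism `k`. -/
def Gen {A P Y R : C} (p : A ⟶ P) (y : P ⟶ Y) (r : P ⟶ R) (k : R ⟶ Y) : Prop :=
  p ≫ copyPair y r = p ≫ r ≫ copyPair k (𝟙 R)

namespace Gen

variable {A P Y Y₂ R : C} {p : A ⟶ P} {y : P ⟶ Y} {y₂ : P ⟶ Y₂} {r : P ⟶ R} {k : R ⟶ Y}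

theorem post (h : Gen p y r k) {Y' : C} (u : Y ⟶ Y') : Gen p (y ≫ u) r (k ≫ u) := by
  have := congrArg (· ≫ u ▷ R) h
  simpa [Gen] using this

/-- Coarsening: part of `r` may be forgotten as long as `k` reads only what is kept. With `d` a
wiring, this passes from one list of wires to another. -/
theorem restrict {R' : C} {r' : P ⟶ R'} {k' : R' ⟶ Y} (h : Gen p y r k) (d : R ⟶ R') [Det d]
    (hr : r ≫ d = r') (hk : d ≫ k' = k) : Gen p y r' k' := by
  have := congrArg (· ≫ Y ◁ d) h
  subst hr hk
  simpa [Gen, comp_copyPair] using this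

theorem marginal (h : Gen p y r k) : p ≫ y = p ≫ r ≫ k := by
  have := congrArg (· ≫ fst Y R) h
  simpa using this

/-- Composition of two stages: `y` from `r`, followed by `y₂` from `y` and `r`. This is the
contraction rule. -/
theorem chain {k₂ : Y ⊗ R ⟶ Y₂} (h : Gen p y r k) (h₂ : Gen p y₂ (copyPair y r) k₂) :
    Gen p (copyPair y₂ y) r (copyPair k (𝟙 R) ≫ copyPair k₂ (fst Y R)) := by
  unfold Gen at *
  rw [← Category.assoc p (copyPair y r), h] at h₂
  rw [← copyPair_assoc_inv, ← Category.assoc, h₂]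
  have := copyPair_comp_copyPair_snd k (copyPair k₂ (fst Y R)) (𝟙 R)
  rw [Category.comp_id] at this
  rw [← this, ← copyPair_assoc_inv, copyPair_fst_snd_id]
  simp

/-- The weak union rule. It is `K` and not `d ≫ K` that is disintegrated, so that the resulting
conditional still sees `r` only through `d`. -/
theorem cond (hC : HasConditionals C) {Z : C} {d : R ⟶ Z} [Det d] {K : Z ⟶ Y ⊗ Y₂}
    (h : Gen p (copyPair y y₂) r (d ≫ K)) :
    ∃ c : Y ⊗ Z ⟶ Y₂, Gen p y₂ (copyPair y r) ((Y ◁ d) ≫ c) := by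
  obtain ⟨c, hc⟩ := hasConditionals_copyPair hC K
  refine ⟨c, ?_⟩
  have h1 : Gen p y r (d ≫ K ≫ fst Y Y₂) := by
    simpa using h.post (fst Y Y₂)
  -- The joint kernel in two stages: its marginal on `Y`, followed by the conditional `c`.
  have hK : d ≫ K = copyPair (d ≫ K ≫ fst Y Y₂) (𝟙 R) ≫
      copyPair (fst Y R) ((Y ◁ d) ≫ c) := by
    have h2 : copyPair (fst Y R) ((Y ◁ d) ≫ c) = (Y ◁ d) ≫ copyPair (fst Y Z) c := by
      rw [comp_copyPair, ← id_tensorHom, tensorHom_fst, Category.comp_id]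
    rw [h2, ← Category.assoc, copyPair_whiskerLeft, Category.id_comp]
    conv_lhs => rw [hc, ← Category.assoc, comp_copyPair d (K ≫ fst Y Y₂), Category.comp_id]
  -- The pair was generated as `(y, y₂)`; rotating brings `y₂` to the front, as the conclusion
  -- demands.
  have h3 := congrArg (· ≫ (α_ Y Y₂ R).hom ≫ rotate Y Y₂ R) h
  have h4 := copyPair_comp_copyPair_snd (d ≫ K ≫ fst Y Y₂) (copyPair (fst Y R) ((Y ◁ d) ≫ c)) (𝟙 R)
  rw [← hK, Category.comp_id] at h4
  simp only [Category.assoc] at h3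
  rw [← h4] at h3
  simp only [Category.assoc] at h3
  rw [← Category.assoc (copyPair _ r), copyPair_assoc, copyPair_rotate,
    ← Category.assoc (copyPair (copyPair _ _) (snd Y R)), copyPair_assoc, copyPair_rotate,
    copyPair_fst_snd_id] at h3
  rw [Gen, h3, ← Category.assoc p (copyPair y r), h1]
  simp

/-- Together the hypotheses say that `k` and `k₂` are applied independently to copies of `r`. This
is symmetric in the two variables, so their roles may be interchanged. -/
theorem exchange {k₂ : R ⟶ Y₂} (h : Gen p y r k)
    (h₂ : Gen p y₂ (copyPair y r) (snd Y R ≫ k₂)) : Gen p y (copyPair y₂ r) (snd Y₂ R ≫ k) := by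
  have h₃ : Gen p y₂ r k₂ := h₂.restrict (snd Y R) (copyPair_snd _ _) rfl
  unfold Gen at *
  rw [← Category.assoc p (copyPair y r), h, Category.assoc, Category.assoc,
    copyPair_comp_copyPair_id] at h₂
  have h4 := congrArg (· ≫ rotate _ _ _) h₂
  simp only [Category.assoc, copyPair_rotate] at h4
  rw [h4, ← Category.assoc p (copyPair y₂ r), h₃, Category.assoc, Category.assoc,
    copyPair_comp_copyPair_id]

theorem precomp_iff {A₀ : C} (d : A₀ ⟶ A) (p : A ⟶ P) [Det p] :
    Gen (d ≫ p) y r k ↔ Gen d (p ≫ y) (p ≫ r) k := by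
  unfold Gen
  rw [Category.assoc, Category.assoc, comp_copyPair, Category.assoc]

end Gen

end
end Markov

/-! ### Tensor products over lists and their wirings -/

namespace Markov

section

variable {C : Type u} [Category.{v} C] [MonoidalCategory C] [MarkovCategory C]

theorem copyPair_eqToHom {A X Y X' Y' : C} (f : A ⟶ X) (g : A ⟶ Y) (hX : X = X') (hY : Y = Y')
    (h : X ⊗ Y = X' ⊗ Y') :
    copyPair f g ≫ eqToHom h = copyPair (f ≫ eqToHom hX) (g ≫ eqToHom hY) := by
  subst hX hY; simp

section

variable {Ω : Type*}

/-- The tensor product of the objects `V x` for `x` in a list. -/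
def ten (V : Ω → C) : List Ω → C
  | [] => 𝟙_ C
  | x :: l => V x ⊗ ten V l

/-- The projection to the first factor. -/
def head (V : Ω → C) (x : Ω) (l : List Ω) : ten V (x :: l) ⟶ V x := fst (V x) (ten V l)

/-- The projection to all factors but the first. -/
def tail (V : Ω → C) (x : Ω) (l : List Ω) : ten V (x :: l) ⟶ ten V l := snd (V x) (ten V l)

/-- Pairing with an additional first component. -/
def cons {P : C} (V : Ω → C) (x : Ω) (l : List Ω) (f : P ⟶ V x) (g : P ⟶ ten V l) :
    P ⟶ ten V (x :: l) := copyPair f g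

open Classical in
/-- The projection to the factor of (the first occurrence of) an element of the list. -/
def proj (V : Ω → C) : (l : List Ω) → (y : Ω) → y ∈ l → (ten V l ⟶ V y)
  | [], _, h => absurd h List.not_mem_nil
  | x :: l, y, h =>
    if e : y = x then head V x l ≫ eqToHom (by rw [e])
    else tail V x l ≫ proj V l y ((List.mem_cons.1 h).resolve_left e)

/-- The tuple of a family of morphisms indexed by a list. -/
def fan {P : C} (V : Ω → C) : (l : List Ω) → (∀ y, y ∈ l → (P ⟶ V y)) → (P ⟶ ten V l)
  | [], _ => ε[P]
  | x :: l, f => cons V x l (f x List.mem_cons_self) (fan V l fun y h => f y (List.mem_cons_of_mem x h))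

variable {V : Ω → C} {P Q : C}

instance (x : Ω) (l : List Ω) : Det (head V x l) := inferInstanceAs (Det (fst (V x) (ten V l)))

instance (x : Ω) (l : List Ω) : Det (tail V x l) := inferInstanceAs (Det (snd (V x) (ten V l)))

instance (x : Ω) (l : List Ω) (f : P ⟶ V x) (g : P ⟶ ten V l) [Det f] [Det g] :
    Det (cons V x l f g) := inferInstanceAs (Det (copyPair f g))

@[simp]
theorem cons_head (x : Ω) (l : List Ω) (f : P ⟶ V x) (g : P ⟶ ten V l) :
    cons V x l f g ≫ head V x l = f := copyPair_fst f g

@[simp]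
theorem cons_tail (x : Ω) (l : List Ω) (f : P ⟶ V x) (g : P ⟶ ten V l) :
    cons V x l f g ≫ tail V x l = g := copyPair_snd f g

theorem comp_cons (d : Q ⟶ P) [Det d] (x : Ω) (l : List Ω) (f : P ⟶ V x) (g : P ⟶ ten V l) :
    d ≫ cons V x l f g = cons V x l (d ≫ f) (d ≫ g) := comp_copyPair d f g

theorem cons_head_tail (x : Ω) (l : List Ω) : cons V x l (head V x l) (tail V x l) = 𝟙 _ :=
  copyPair_fst_snd_id _ _

instance det_proj (y : Ω) : ∀ (l : List Ω) (h : y ∈ l), Det (proj V l y h)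
  | [], h => absurd h List.not_mem_nil
  | x :: l, h => by
    have := fun h => det_proj y l h
    unfold proj
    split <;> infer_instance

theorem det_fan : ∀ (l : List Ω) (f : ∀ y, y ∈ l → (P ⟶ V y)), (∀ y h, Det (f y h)) →
    Det (fan V l f)
  | [], _, _ => inferInstanceAs (Det ε[P])
  | x :: l, f, hf => by
    have := hf x List.mem_cons_self
    have := det_fan l (fun y h => f y (List.mem_cons_of_mem x h)) fun y h => hf _ _
    unfold fan; infer_instance

theorem fan_proj : ∀ (l : List Ω) (f : ∀ y, y ∈ l → (P ⟶ V y)) (y : Ω) (h : y ∈ l),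
    fan V l f ≫ proj V l y h = f y h
  | [], _, _, h => absurd h List.not_mem_nil
  | x :: l, f, y, h => by
    rw [fan, proj]
    split
    case isTrue e => subst e; rw [← Category.assoc, cons_head, eqToHom_refl, Category.comp_id]
    case isFalse e => rw [← Category.assoc, cons_tail, fan_proj l]

theorem comp_fan (d : Q ⟶ P) [Det d] : ∀ (l : List Ω) (f : ∀ y, y ∈ l → (P ⟶ V y)),
    d ≫ fan V l f = fan V l fun y h => d ≫ f y h
  | [], _ => MarkovCategory.discard_natural d
  | x :: l, f => by rw [fan, comp_cons, comp_fan d l]; rfl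

theorem fan_congr {l : List Ω} {f g : ∀ y, y ∈ l → (P ⟶ V y)} (h : ∀ y hy, f y hy = g y hy) :
    fan V l f = fan V l g := by
  have : f = g := by funext y hy; exact h y hy
  rw [this]

/-- Absence of repetitions matters: `proj` always reads the first occurrence, so a repeated factor
would be overwritten by the earlier one. -/
theorem fan_eq_id : ∀ (l : List Ω), l.Nodup → fan V l (proj V l) = 𝟙 (ten V l)
  | [], _ => (MarkovCategory.eq_discard _ (𝟙 (𝟙_ C))).symm
  | x :: l, h => by
    obtain ⟨hx, hl⟩ := List.nodup_cons.1 h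
    have h1 : proj V (x :: l) x List.mem_cons_self = head V x l := by
      rw [proj, dif_pos rfl, eqToHom_refl, Category.comp_id]
    have h2 : ∀ y (hy : y ∈ l), proj V (x :: l) y (List.mem_cons_of_mem x hy) =
        tail V x l ≫ proj V l y hy := fun y hy => by
      rw [proj, dif_neg]
      rintro rfl
      exact hx hy
    rw [fan, h1, fan_congr h2, ← comp_fan, fan_eq_id l hl, Category.comp_id, cons_head_tail]

/-- The wiring from a list to another one with elements from the first list. -/
def sel (V : Ω → C) (l m : List Ω) (h : m ⊆ l) : ten V l ⟶ ten V m :=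
  fan V m fun y hy => proj V l y (h hy)

instance (l m : List Ω) (h : m ⊆ l) : Det (sel V l m h) := det_fan _ _ fun _ _ => inferInstance

theorem sel_proj {l m : List Ω} (h : m ⊆ l) (y : Ω) (hy : y ∈ m) :
    sel V l m h ≫ proj V m y hy = proj V l y (h hy) := fan_proj _ _ _ _

theorem fan_sel {l m : List Ω} (f : ∀ y, y ∈ l → (P ⟶ V y)) (hf : ∀ y h, Det (f y h)) (h : m ⊆ l) :
    fan V l f ≫ sel V l m h = fan V m fun y hy => f y (h hy) := by
  have := det_fan l f hf
  rw [sel, comp_fan]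
  exact fan_congr fun y hy => fan_proj _ _ _ _

@[simp]
theorem sel_sel {l m n : List Ω} (h : m ⊆ l) (h' : n ⊆ m) :
    sel V l m h ≫ sel V m n h' = sel V l n (List.Subset.trans h' h) :=
  fan_sel _ (fun _ _ => inferInstance) _

@[simp]
theorem sel_sel_assoc {l m n : List Ω} (h : m ⊆ l) (h' : n ⊆ m) (k : ten V n ⟶ P) :
    sel V l m h ≫ sel V m n h' ≫ k = sel V l n (List.Subset.trans h' h) ≫ k := by
  rw [← Category.assoc, sel_sel]

theorem sel_self {l : List Ω} (hl : l.Nodup) (h : l ⊆ l) : sel V l l h = 𝟙 _ := fan_eq_id l hl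

open Classical in
/-- The tensor product over a concatenation of lists, from the two tensor products. -/
def join (V : Ω → C) (l m : List Ω) : ten V l ⊗ ten V m ⟶ ten V (l ++ m) :=
  fan V (l ++ m) fun y hy => if h : y ∈ l then fst _ _ ≫ proj V l y h
    else snd _ _ ≫ proj V m y ((List.mem_append.1 hy).resolve_left h)

instance (l m : List Ω) : Det (join V l m) := det_fan _ _ fun y hy => by
  split <;> infer_instance

/-- An element common to `l` and `m` is read from the left factor both times; nothing is lost
because both tuples are drawn from the same `k`. -/
theorem copyPair_join {k l m : List Ω} (hl : l ⊆ k) (hm : m ⊆ k) :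
    copyPair (sel V k l hl) (sel V k m hm) ≫ join V l m =
      sel V k (l ++ m) (List.append_subset.2 ⟨hl, hm⟩) := by
  rw [join, comp_fan]
  refine fan_congr fun y hy => ?_
  split
  · rw [copyPair_fst_assoc, sel_proj]
  · rw [copyPair_snd_assoc, sel_proj]

theorem join_sel_left {k l m : List Ω} (h : k ⊆ l) (h' : k ⊆ l ++ m) :
    join V l m ≫ sel V (l ++ m) k h' = fst _ _ ≫ sel V l k h := by
  rw [sel, comp_fan, sel, comp_fan]
  refine fan_congr fun y hy => ?_
  rw [join, fan_proj, dif_pos (h hy)]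

/-- Disjointness from `l` is needed since `join` prefers the left factor. -/
theorem join_sel_right {k l m : List Ω} (h : k ⊆ m) (hl : ∀ y ∈ k, y ∉ l) (h' : k ⊆ l ++ m) :
    join V l m ≫ sel V (l ++ m) k h' = snd _ _ ≫ sel V m k h := by
  rw [sel, comp_fan, sel, comp_fan]
  refine fan_congr fun y hy => ?_
  rw [join, fan_proj, dif_neg (hl y hy)]

theorem fan_nil (f g : P ⟶ ten V []) : f = g := by
  exact (MarkovCategory.eq_discard P f).trans (MarkovCategory.eq_discard P g).symm

end

/-! #### Change of the indexing set -/

section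

variable {Ω Ω' : Type*} {V : Ω → C} {V' : Ω' → C} {P : C}

theorem ten_map (g : Ω' → Ω) (hg : ∀ y, V (g y) = V' y) : ∀ m : List Ω', ten V (m.map g) = ten V' m
  | [] => rfl
  | y :: m => congrArg₂ (· ⊗ ·) (hg y) (ten_map g hg m)

theorem fan_map_eqToHom (g : Ω' → Ω) (hg : ∀ y, V (g y) = V' y) : ∀ (m : List Ω')
    (f : ∀ y, y ∈ m.map g → (P ⟶ V y)), fan V (m.map g) f ≫ eqToHom (ten_map g hg m) =
      fan V' m fun y hy => f (g y) (List.mem_map_of_mem hy) ≫ eqToHom (hg y)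
  | [], _ => fan_nil _ _
  | y :: m, f => by
    refine (copyPair_eqToHom _ _ (hg y) (ten_map g hg m) _).trans ?_
    exact congrArg _ (fan_map_eqToHom g hg m _)

/-- The wiring from a list to a list of elements of another set, along a map of sets. -/
def wir (V : Ω → C) (V' : Ω' → C) (g : Ω' → Ω) (hg : ∀ y, V (g y) = V' y) (l : List Ω)
    (m : List Ω') (h : m.map g ⊆ l) : ten V l ⟶ ten V' m :=
  fan V' m fun y hy => proj V l (g y) (h (List.mem_map_of_mem hy)) ≫ eqToHom (hg y)

instance (g : Ω' → Ω) (hg : ∀ y, V (g y) = V' y) (l : List Ω) (m : List Ω') (h : m.map g ⊆ l) :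
    Det (wir V V' g hg l m h) := det_fan _ _ fun _ _ => inferInstance

theorem sel_eqToHom (g : Ω' → Ω) (hg : ∀ y, V (g y) = V' y) {l : List Ω} {m : List Ω'}
    (h : m.map g ⊆ l) : sel V l (m.map g) h ≫ eqToHom (ten_map g hg m) = wir V V' g hg l m h :=
  fan_map_eqToHom g hg m _

theorem wir_sel (g : Ω' → Ω) (hg : ∀ y, V (g y) = V' y) {l : List Ω} {m n : List Ω'}
    (h : m.map g ⊆ l) (h' : n ⊆ m) :
    wir V V' g hg l m h ≫ sel V' m n h' = wir V V' g hg l n (List.Subset.trans (List.map_subset g h') h) :=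
  fan_sel _ (fun _ _ => inferInstance) _

theorem sel_wir (g : Ω' → Ω) (hg : ∀ y, V (g y) = V' y) {l k : List Ω} {m : List Ω'}
    (h : m.map g ⊆ l) (h' : l ⊆ k) :
    sel V k l h' ≫ wir V V' g hg l m h = wir V V' g hg k m (List.Subset.trans h h') := by
  rw [← sel_eqToHom, ← sel_eqToHom, sel_sel_assoc]

theorem wir_proj (g : Ω' → Ω) (hg : ∀ y, V (g y) = V' y) {l : List Ω} {m : List Ω'}
    (h : m.map g ⊆ l) (y : Ω') (hy : y ∈ m) :
    wir V V' g hg l m h ≫ proj V' m y hy =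
      proj V l (g y) (h (List.mem_map_of_mem hy)) ≫ eqToHom (hg y) :=
  fan_proj _ _ _ _

end

/-! #### Concatenation in strict monoidal categories -/

section

variable {Ω : Type*} {V : Ω → C} {P : C}

theorem ten_append (hs : IsStrictMonoidal C) (m : List Ω) :
    ∀ l : List Ω, ten V (l ++ m) = ten V l ⊗ ten V m
  | [] => (hs.unit_tensor _).symm
  | x :: l => (congrArg (V x ⊗ ·) (ten_append hs m l)).trans (hs.tensor_assoc _ _ _).symm

theorem copyPair_unit_eq (hs : IsStrictMonoidal C) {A X : C} (e : A ⟶ 𝟙_ C) (g : A ⟶ X)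
    (h : X = 𝟙_ C ⊗ X) : g ≫ eqToHom h = copyPair e g := by
  have h1 : copyPair e g ≫ snd (𝟙_ C) X = g := copyPair_snd e g
  rw [snd, CopyDiscardCategory.discard_unit, id_whiskerRight, Category.id_comp,
    hs.leftUnitor_eq] at h1
  conv_lhs => rw [← h1]
  simp

theorem copyPair_assoc_eq (hs : IsStrictMonoidal C) {A X Y Z : C} (f : A ⟶ X) (g : A ⟶ Y)
    (h : A ⟶ Z) (e : X ⊗ (Y ⊗ Z) = (X ⊗ Y) ⊗ Z) :
    copyPair f (copyPair g h) ≫ eqToHom e = copyPair (copyPair f g) h := by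
  rw [← copyPair_assoc, hs.associator_eq]
  simp

/-- Here strictness is used: the re-bracketing caused by each new head is an associator, which is an
`eqToHom`. -/
theorem fan_append_eqToHom (hs : IsStrictMonoidal C) (m : List Ω) : ∀ (l : List Ω)
    (f : ∀ y, y ∈ l ++ m → (P ⟶ V y)), fan V (l ++ m) f ≫ eqToHom (ten_append hs m l) =
      copyPair (fan V l fun y hy => f y (List.mem_append_left m hy))
        (fan V m fun y hy => f y (List.mem_append_right l hy))
  | [], _ => copyPair_unit_eq hs _ _ _
  | x :: l, f => by
    refine Eq.trans ?_ (copyPair_assoc_eq hs (f x _) _ _ (hs.tensor_assoc _ _ _).symm)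
    have h := fan_append_eqToHom hs m l fun y hy => f y (List.mem_cons_of_mem x hy)
    refine Eq.trans ?_ (congrArg (fun g => copyPair (f x List.mem_cons_self) g ≫ eqToHom _) h)
    have h1 : copyPair (f x List.mem_cons_self) (fan V (l ++ m) fun y hy =>
        f y (List.mem_cons_of_mem x hy)) ≫ eqToHom (congrArg (V x ⊗ ·) (ten_append hs m l)) =
        copyPair (f x List.mem_cons_self) ((fan V (l ++ m) fun y hy =>
          f y (List.mem_cons_of_mem x hy)) ≫ eqToHom (ten_append hs m l)) := by
      rw [copyPair_eqToHom _ _ rfl (ten_append hs m l), eqToHom_refl, Category.comp_id]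
    refine Eq.trans ?_ (congrArg (· ≫ eqToHom _) h1)
    exact (congrArg (_ ≫ ·) (eqToHom_trans _ _).symm).trans (Category.assoc _ _ _).symm

theorem sel_append_eqToHom (hs : IsStrictMonoidal C) {k l m : List Ω} (h : l ++ m ⊆ k) :
    sel V k (l ++ m) h ≫ eqToHom (ten_append hs m l) =
      copyPair (sel V k l (List.Subset.trans (List.subset_append_left l m) h))
        (sel V k m (List.Subset.trans (List.subset_append_right l m) h)) :=
  fan_append_eqToHom hs m l _

end

/-! #### Comparison with tensor products over finite ordinals -/

section

variable {P : C}

/-- The projection to all factors but the first. -/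
def tailFin {n : ℕ} (V : Fin (n + 1) → C) : tensorFin V ⟶ tensorFin fun i => V i.succ := snd (V 0) _

/-- Pairing with an additional first component. -/
def consFin {n : ℕ} (V : Fin (n + 1) → C) (f : P ⟶ V 0) (g : P ⟶ tensorFin fun i => V i.succ) :
    P ⟶ tensorFin V := copyPair f g

/-- The tuple of a finite family of morphisms. -/
def fanFin : {n : ℕ} → (V : Fin n → C) → (∀ i, P ⟶ V i) → (P ⟶ tensorFin V)
  | 0, _, _ => ε[P]
  | _ + 1, V, f => consFin V (f 0) (fanFin (fun i => V i.succ) fun i => f i.succ)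

theorem projFin_succ {n : ℕ} (V : Fin (n + 1) → C) (i : Fin n) :
    projFin V i.succ = tailFin V ≫ projFin (fun i => V i.succ) i :=
  (Category.assoc _ _ _).symm

theorem selectFin_eq {n : ℕ} (V : Fin n → C) : ∀ {k : ℕ} (s : Fin k → Fin n),
    selectFin V s = fanFin (fun i => V (s i)) fun i => projFin V (s i)
  | 0, _ => rfl
  | _ + 1, s => by rw [selectFin, selectFin_eq V, fanFin]; rfl

theorem fanFin_projFin : ∀ {n : ℕ} (V : Fin n → C) (f : ∀ i, P ⟶ V i) (i : Fin n),
    fanFin V f ≫ projFin V i = f i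
  | n + 1, V, f, i => by
    refine Fin.cases (copyPair_fst _ _) (fun i => ?_) i
    rw [projFin_succ, fanFin, ← Category.assoc]
    exact (congrArg (· ≫ projFin (fun i => V i.succ) i) (copyPair_snd _ _)).trans
      (fanFin_projFin _ _ _)

theorem comp_fanFin {Q : C} (d : Q ⟶ P) [Det d] : ∀ {n : ℕ} (V : Fin n → C) (f : ∀ i, P ⟶ V i),
    d ≫ fanFin V f = fanFin V fun i => d ≫ f i
  | 0, _, _ => MarkovCategory.discard_natural d
  | _ + 1, _, _ => (comp_copyPair d _ _).trans (congrArg _ (comp_fanFin d _ _))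

variable {Ω : Type*} {V : Ω → C}

theorem ten_ofFn : ∀ {n : ℕ} (s : Fin n → Ω),
    ten V (List.ofFn s) = tensorFin fun i => V (s i)
  | 0, s => by rw [List.ofFn_zero]; rfl
  | n + 1, s => by
    rw [List.ofFn_succ]
    exact congrArg (V (s 0) ⊗ ·) (ten_ofFn _)

theorem ten_eq_tensorFin {n : ℕ} {s : Fin n → Ω} {l : List Ω} (h : List.ofFn s = l) :
    ten V l = tensorFin fun i => V (s i) := by
  rw [← h, ten_ofFn]

theorem mem_of_ofFn_eq {n : ℕ} {s : Fin n → Ω} {l : List Ω} (h : List.ofFn s = l) (i : Fin n) :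
    s i ∈ l := h ▸ List.mem_ofFn.2 ⟨i, rfl⟩

theorem fan_eqToHom_fanFin : ∀ {n : ℕ} {s : Fin n → Ω} {l : List Ω} (h : List.ofFn s = l)
    (f : ∀ y, y ∈ l → (P ⟶ V y)), fan V l f ≫ eqToHom (ten_eq_tensorFin h) =
      fanFin (fun i => V (s i)) fun i => f (s i) (mem_of_ofFn_eq h i)
  | 0, s, l, h, f => by
    exact (MarkovCategory.eq_discard _ _).trans (MarkovCategory.eq_discard _ _).symm
  | n + 1, s, l, h, f => by
    obtain rfl : s 0 :: List.ofFn (fun i => s i.succ) = l := by rw [← h, List.ofFn_succ]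
    refine (copyPair_eqToHom _ _ rfl (ten_ofFn fun i => s i.succ) _).trans ?_
    rw [eqToHom_refl, Category.comp_id]
    exact congrArg _ (fan_eqToHom_fanFin rfl _)

theorem eqToHom_projFin {n : ℕ} {s : Fin n → Ω} {l : List Ω} (h : List.ofFn s = l) (hl : l.Nodup)
    (i : Fin n) : eqToHom (ten_eq_tensorFin h) ≫ projFin (fun i => V (s i)) i =
      proj V l (s i) (mem_of_ofFn_eq h i) := by
  rw [← Category.id_comp (eqToHom _), ← fan_eq_id l hl, fan_eqToHom_fanFin h, fanFin_projFin]

/-- The bridge by which marginals on positions become wirings `sel` between lists of wires. -/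
theorem eqToHom_selectFin {n k : ℕ} {s : Fin n → Ω} {l m : List Ω} (h : List.ofFn s = l)
    (hl : l.Nodup) (e : Fin k → Fin n) (hm : List.ofFn (fun i => s (e i)) = m) (hml : m ⊆ l) :
    eqToHom (ten_eq_tensorFin h) ≫ selectFin (fun i => V (s i)) e =
      sel V l m hml ≫ eqToHom (ten_eq_tensorFin hm) := by
  rw [sel, fan_eqToHom_fanFin hm, selectFin_eq, comp_fanFin]
  congr 1
  funext i
  exact eqToHom_projFin h hl (e i)

end

end
end Markov

/-! ### Generating the wires of a string diagram box by box -/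

namespace StringDiagram

open Markov

variable {S : DiHypergraph.{w}} {a b : List S.Wire} (φ : StringDiagram S a b)

theorem tgt_nodup (x : φ.G.Box) : (φ.G.tgt x).Nodup :=
  nodup_of_occ_le fun A => by
    have h := φ.leftMonogamous A
    have h1 := Finset.single_le_sum (f := fun z : φ.G.Box => occ (φ.G.tgt z) A)
      (fun _ _ => Nat.zero_le _) (Finset.mem_univ x)
    exact h1.trans (by omega)

theorem mem_inputs_or_tgt (A : φ.G.Wire) : A ∈ φ.inputs ∨ ∃ x, A ∈ φ.G.tgt x := by
  by_contra! h
  have h1 := φ.leftMonogamous A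
  rw [occ_eq_zero.2 h.1, Finset.sum_eq_zero fun x _ => occ_eq_zero.2 (h.2 x)] at h1
  exact absurd h1 (by norm_num)

/-- The global inputs and the outputs of the boxes in a list. -/
def wiresOf : List φ.G.Box → List φ.G.Wire
  | [] => φ.inputs
  | x :: L => φ.G.tgt x ++ wiresOf L

theorem mem_wiresOf (A : φ.G.Wire) : ∀ L : List φ.G.Box,
    A ∈ φ.wiresOf L ↔ A ∈ φ.inputs ∨ ∃ x ∈ L, A ∈ φ.G.tgt x
  | [] => by simp [wiresOf]
  | x :: L => by
    rw [wiresOf, List.mem_append, mem_wiresOf A L]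
    simp only [List.mem_cons, exists_eq_or_imp]
    tauto

theorem not_mem_tgt_of_mem_wiresOf {L : List φ.G.Box} {A : φ.G.Wire} (hA : A ∈ φ.wiresOf L)
    {x : φ.G.Box} (hx : x ∉ L) : A ∉ φ.G.tgt x := by
  intro h
  obtain h1 | ⟨y, hy, h1⟩ := (φ.mem_wiresOf A L).1 hA
  · exact φ.not_mem_tgt_of_mem_inputs h1 x h
  · exact hx (φ.tgt_unique h h1 ▸ hy)

theorem inputs_subset_wiresOf (L : List φ.G.Box) : φ.inputs ⊆ φ.wiresOf L :=
  fun A hA => (φ.mem_wiresOf A L).2 (.inl hA)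

theorem subset_wiresOf {L : List φ.G.Box} (hL : ∀ x, x ∈ L) (m : List φ.G.Wire) :
    m ⊆ φ.wiresOf L := fun A _ =>
  (φ.mem_wiresOf A L).2 ((φ.mem_inputs_or_tgt A).imp_right fun ⟨x, hx⟩ => ⟨x, hL x, hx⟩)

theorem tgt_subset_wiresOf (x : φ.G.Box) (L : List φ.G.Box) : φ.G.tgt x ⊆ φ.wiresOf (x :: L) :=
  List.subset_append_left _ _

theorem wiresOf_subset_cons (x : φ.G.Box) (L : List φ.G.Box) : φ.wiresOf L ⊆ φ.wiresOf (x :: L) :=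
  List.subset_append_right _ _

/-- The list of boxes is free of repetitions and the inputs of each box are global inputs or outputs
of boxes further down in the list. -/
def Topo : List φ.G.Box → Prop
  | [] => True
  | x :: L => φ.G.src x ⊆ φ.wiresOf L ∧ x ∉ L ∧ Topo L

variable {φ}

theorem Topo.of_cons {x : φ.G.Box} {L : List φ.G.Box} (h : φ.Topo (x :: L)) : φ.Topo L := h.2.2

theorem Topo.not_mem {x : φ.G.Box} {L : List φ.G.Box} (h : φ.Topo (x :: L)) : x ∉ L := h.2.1

theorem Topo.src_subset_cons {x : φ.G.Box} {L : List φ.G.Box} (h : φ.Topo (x :: L)) :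
    φ.G.src x ⊆ φ.wiresOf L := h.1

theorem Topo.nodup_wiresOf : ∀ {L : List φ.G.Box}, φ.Topo L → (φ.wiresOf L).Nodup
  | [], _ => φ.inputs_nodup
  | _ :: _, h => List.nodup_append'.2 ⟨φ.tgt_nodup _, h.2.2.nodup_wiresOf,
      fun _ hA hA' => φ.not_mem_tgt_of_mem_wiresOf hA' h.2.1 hA⟩

theorem Topo.src_subset : ∀ {L : List φ.G.Box}, φ.Topo L → ∀ x ∈ L, φ.G.src x ⊆ φ.wiresOf L
  | y :: L, h, x, hx => by
    refine List.Subset.trans ?_ (List.subset_append_right _ _)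
    obtain rfl | hx := List.mem_cons.1 hx
    · exact h.1
    · exact h.2.2.src_subset x hx

/-- The wires generated by a topologically ordered list are closed under ancestors: a generated wire
that is not an input has a unique producing box, which lies in the list together with the origins of
its inputs. -/
theorem Topo.of_reflTransGen {L : List φ.G.Box} (h : φ.Topo L) {A B : φ.G.Wire}
    (hAB : Relation.ReflTransGen φ.G.Edge A B) (hB : B ∈ φ.wiresOf L) : A ∈ φ.wiresOf L := by
  induction hAB with
  | refl => exact hB
  | tail _ hE ih =>
    obtain ⟨x, h1, h2⟩ := hE
    refine ih ?_
    obtain h3 | ⟨y, hy, h3⟩ := (φ.mem_wiresOf _ L).1 hB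
    · exact absurd h2 (φ.not_mem_tgt_of_mem_inputs h3 x)
    · rw [φ.tgt_unique h2 h3] at h1
      exact h.src_subset y hy h1

theorem Topo.not_mem_dec {L : List φ.G.Box} (h : φ.Topo L) {A : φ.G.Wire} (hA : A ∈ φ.wiresOf L)
    {x : φ.G.Box} (hx : x ∉ L) : A ∉ φ.G.Dec {B | B ∈ φ.G.tgt x} := by
  rintro ⟨B, hB, hBA⟩
  exact φ.not_mem_tgt_of_mem_wiresOf (h.of_reflTransGen hBA hA) hx hB

-- A set of boxes closed under predecessors contains, by acyclicity, a box that feeds no other box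
-- of the set. It goes to the front of the list, and the rest is again closed under predecessors.
-- Proper subsets occur when discarded boxes are left out.
variable (φ) in
theorem exists_topo (N : Finset φ.G.Box)
    (hN : ∀ x ∈ N, ∀ A ∈ φ.G.src x, ∀ y, A ∈ φ.G.tgt y → y ∈ N) :
    ∃ L, φ.Topo L ∧ ∀ x, x ∈ L ↔ x ∈ N := by
  classical
  let R : φ.G.Box → φ.G.Box → Prop := fun x y => ∃ A ∈ φ.G.tgt x, A ∈ φ.G.src y
  have hR : ∀ x y, Relation.TransGen R x y →
      ∃ A ∈ φ.G.tgt x, ∃ B ∈ φ.G.src y, Relation.ReflTransGen φ.G.Edge A B := by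
    intro x y h
    induction h with
    | single h => obtain ⟨A, h1, h2⟩ := h; exact ⟨A, h1, A, h2, .refl⟩
    | tail _ h ih =>
      obtain ⟨A, h1, B, h2, h3⟩ := ih
      obtain ⟨B', h4, h5⟩ := h
      exact ⟨A, h1, B', h5, h3.tail ⟨_, h2, h4⟩⟩
  -- The order is reversed, so that a minimal element is a box without successors in `N`.
  let R' : φ.G.Box → φ.G.Box → Prop := fun x y => Relation.TransGen R y x
  have : Std.Irrefl R' := ⟨fun x h => by
    obtain ⟨A, h1, B, h2, h3⟩ := hR x x h
    exact φ.acyclic A (.tail' h3 ⟨x, h2, h1⟩)⟩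
  have : IsTrans φ.G.Box R' := ⟨fun x y z h h' => h'.trans h⟩
  have hwf : WellFounded R' := Finite.wellFounded_of_trans_of_irrefl R'
  induction hn : N.card generalizing N with
  | zero =>
    rw [Finset.card_eq_zero] at hn
    subst hn
    exact ⟨[], trivial, by simp⟩
  | succ n ih =>
    have hne : N.Nonempty := Finset.card_pos.1 (by omega)
    obtain ⟨x, hx, hmin⟩ := hwf.has_min (N : Set φ.G.Box) hne
    have hmax : ∀ y ∈ N, ∀ A ∈ φ.G.tgt x, A ∉ φ.G.src y := fun y hy A h1 h2 =>
      hmin y hy (.single ⟨A, h1, h2⟩)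
    obtain ⟨L, hL, hmem⟩ := ih (N.erase x) (by
        intro y hy A hA z hz
        rw [Finset.mem_erase] at hy ⊢
        refine ⟨?_, hN y hy.2 A hA z hz⟩
        rintro rfl
        exact hmax y hy.2 A hz hA) (by rw [Finset.card_erase_of_mem hx, hn]; rfl)
    refine ⟨x :: L, ⟨fun A hA => ?_, fun h => by simpa using (hmem x).1 h, hL⟩, fun y => ?_⟩
    · rw [mem_wiresOf]
      refine (φ.mem_inputs_or_tgt A).imp_right fun ⟨y, hy⟩ => ⟨y, (hmem y).2 ?_, hy⟩
      rw [Finset.mem_erase]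
      refine ⟨?_, hN x hx A hA y hy⟩
      rintro rfl
      exact hmax y hx A hy hA
    · rw [List.mem_cons, hmem, Finset.mem_erase]
      by_cases h : y = x
      · subst h
        exact iff_of_true (.inl rfl) hx
      · simp [h]

variable (φ) in
theorem exists_topo_full : ∃ L, φ.Topo L ∧ ∀ x, x ∈ L := by
  obtain ⟨L, h, h'⟩ := φ.exists_topo Finset.univ fun _ _ _ _ _ _ => Finset.mem_univ _
  exact ⟨L, h, fun x => (h' x).2 (Finset.mem_univ x)⟩

section

variable {C : Type u} [Category.{v} C] [MonoidalCategory C] [MarkovCategory C]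

variable (φ) in
/-- The objects of `C` assigned to the wires of a string diagram, when objects are assigned to the
wires of the underlying hypergraph `S`. -/
def val (T : S.Wire → C) (A : φ.G.Wire) : C := T (φ.type.wire A)

variable (φ) in
/-- Morphisms of `C` assigned to the boxes of a string diagram. -/
abbrev Kernels (T : S.Wire → C) : Type v :=
  ∀ x : φ.G.Box, ten (φ.val T) (φ.G.src x) ⟶ ten (φ.val T) (φ.G.tgt x)

variable {T : S.Wire → C} (k : φ.Kernels T)

/-- Combine the outputs of a new box with the wires generated before. -/
def push (T : S.Wire → C) (x : φ.G.Box) (L : List φ.G.Box) :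
    ten (φ.val T) (φ.G.tgt x) ⊗ ten (φ.val T) (φ.wiresOf L) ⟶ ten (φ.val T) (φ.wiresOf (x :: L)) :=
  join (φ.val T) (φ.G.tgt x) (φ.wiresOf L)

instance (x : φ.G.Box) (L : List φ.G.Box) : Det (push T x L) :=
  inferInstanceAs (Det (join (φ.val T) (φ.G.tgt x) (φ.wiresOf L)))

theorem push_sel_tgt (x : φ.G.Box) (L : List φ.G.Box) :
    push T x L ≫ sel _ _ _ (φ.tgt_subset_wiresOf x L) = fst _ _ := by
  refine (join_sel_left (List.Subset.refl _) _).trans ?_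
  rw [sel_self (φ.tgt_nodup x), Category.comp_id]

theorem push_sel {x : φ.G.Box} {L : List φ.G.Box} (h : φ.Topo (x :: L)) {m : List φ.G.Wire}
    (hm : m ⊆ φ.wiresOf L) (hm' : m ⊆ φ.wiresOf (x :: L)) :
    push T x L ≫ sel _ _ m hm' = snd _ _ ≫ sel _ _ m hm :=
  join_sel_right hm (fun _ hA hA' => φ.not_mem_tgt_of_mem_wiresOf (hm hA) h.not_mem hA') hm'

/-- Generate the wires of a string diagram from the global inputs, in a given order of boxes. -/
def run : (L : List φ.G.Box) → φ.Topo L → (ten (φ.val T) φ.inputs ⟶ ten (φ.val T) (φ.wiresOf L))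
  | [], _ => 𝟙 _
  | x :: L, h => run L h.of_cons ≫
      copyPair (sel (φ.val T) (φ.wiresOf L) (φ.G.src x) h.src_subset_cons ≫ k x) (𝟙 _) ≫ push T x L

/-- Every box of `N` generates its outputs from its inputs alone, independently of all wires that do
not descend from its outputs. -/
def GeneratedBy (N : Set φ.G.Box) {P : C} {l : List φ.G.Wire} (p : P ⟶ ten (φ.val T) l) : Prop :=
  ∀ x ∈ N, ∀ (ht : φ.G.tgt x ⊆ l) (m : List φ.G.Wire) (hm : m ⊆ l) (hs : φ.G.src x ⊆ m),
    (∀ A ∈ m, A ∉ φ.G.Dec {B | B ∈ φ.G.tgt x}) →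
      Gen p (sel _ l (φ.G.tgt x) ht) (sel _ l m hm) (sel _ m (φ.G.src x) hs ≫ k x)

/-- Older wires do not notice the newest box: its outputs are discarded, and discarding is natural.
-/
theorem run_cons_sel {x : φ.G.Box} {L : List φ.G.Box} (h : φ.Topo (x :: L)) {m : List φ.G.Wire}
    (hm : m ⊆ φ.wiresOf L) (hm' : m ⊆ φ.wiresOf (x :: L)) :
    run k (x :: L) h ≫ sel _ (φ.wiresOf (x :: L)) m hm' = run k L h.of_cons ≫ sel _ _ m hm := by
  rw [run, Category.assoc, Category.assoc, push_sel h hm, copyPair_snd_assoc, Category.id_comp]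

theorem run_cons_sel_self {x : φ.G.Box} {L : List φ.G.Box} (h : φ.Topo (x :: L)) :
    run k (x :: L) h ≫ sel _ _ _ (φ.wiresOf_subset_cons x L) = run k L h.of_cons := by
  rw [run_cons_sel k h (List.Subset.refl _), sel_self h.of_cons.nodup_wiresOf, Category.comp_id]

theorem run_cons_gen {x : φ.G.Box} {L : List φ.G.Box} (h : φ.Topo (x :: L)) :
    Gen (run k (x :: L) h) (sel _ _ _ (φ.tgt_subset_wiresOf x L))
      (sel _ _ _ (φ.wiresOf_subset_cons x L)) (sel _ _ _ h.src_subset_cons ≫ k x) := by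
  unfold Gen
  rw [← Category.assoc _ (sel _ _ (φ.wiresOf L) _), run_cons_sel_self, run, Category.assoc,
    Category.assoc, comp_copyPair (push T x L), push_sel_tgt, push_sel h (List.Subset.refl _),
    sel_self h.of_cons.nodup_wiresOf, Category.comp_id, copyPair_fst_snd_id, Category.comp_id]

/-- Induction on the order of generation. For the newest box the claim is its definition. For an
older box `x`, the newest box `y` matters only if some of its outputs are among the wires `m`; then
`y` reads wires not descending from `x`, and `Gen.exchange` adds the outputs of `y` to the context
of `x`. -/
theorem run_generatedBy : ∀ (L : List φ.G.Box) (h : φ.Topo L),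
    GeneratedBy k {x | x ∈ L} (run k L h)
  | [], _, _, hx => absurd hx List.not_mem_nil
  | y :: L, h, x, hx => by
    classical
    intro ht m hm hs hd
    have hg := run_cons_gen k h
    obtain rfl | hx := List.mem_cons.1 hx
    · have hmw : m ⊆ φ.wiresOf L := fun A hA => (List.mem_append.1 (hm hA)).resolve_left
        fun h1 => hd A hA ⟨A, h1, .refl⟩
      refine hg.restrict (sel _ _ m hmw) (sel_sel _ _) ?_
      rw [sel_sel_assoc]
    have htx : φ.G.tgt x ⊆ φ.wiresOf L := fun A hA => (φ.mem_wiresOf A L).2 (.inr ⟨x, hx, hA⟩)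
    have hsx := h.of_cons.src_subset x hx
    have ih : ∀ (n : List φ.G.Wire) (hn : n ⊆ φ.wiresOf L) (hsn : φ.G.src x ⊆ n),
        (∀ A ∈ n, A ∉ φ.G.Dec {B | B ∈ φ.G.tgt x}) →
        Gen (run k (y :: L) h) (sel _ _ (φ.G.tgt x) ht)
          (sel _ (φ.wiresOf (y :: L)) n (List.Subset.trans hn (φ.wiresOf_subset_cons y L)))
          (sel _ n (φ.G.src x) hsn ≫ k x) := fun n hn hsn hd => by
      have h1 := run_generatedBy L h.of_cons x hx htx n hn hsn hd
      rw [← run_cons_sel_self k h, Gen.precomp_iff] at h1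
      rwa [sel_sel, sel_sel] at h1
    by_cases hy : ∃ A ∈ m, A ∈ φ.G.tgt y
    · obtain ⟨A, hA, hAy⟩ := hy
      -- The context before `y` was run: `m` with the outputs of `y` replaced by its inputs.
      let n := m.filter (· ∉ φ.G.tgt y) ++ φ.G.src y
      have hn : n ⊆ φ.wiresOf L := by
        refine List.append_subset.2 ⟨fun B hB => ?_, h.src_subset_cons⟩
        rw [List.mem_filter, decide_eq_true_eq] at hB
        exact (List.mem_append.1 (hm hB.1)).resolve_left hB.2
      have hsn : φ.G.src x ⊆ n := fun B hB => List.mem_append_left _ (List.mem_filter.2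
        ⟨hs hB, decide_eq_true (φ.not_mem_tgt_of_mem_wiresOf (hsx hB) h.not_mem)⟩)
      -- If an input of `y` descended from `x`, then so would `A`, an output of `y` that lies in
      -- `m`.
      have hnd : ∀ B ∈ n, B ∉ φ.G.Dec {B | B ∈ φ.G.tgt x} := by
        intro B hB
        obtain hB | hB := List.mem_append.1 hB
        · exact hd B (List.mem_filter.1 hB).1
        · rintro ⟨D, hD, hDB⟩
          exact hd A hA ⟨D, hD, hDB.tail ⟨y, hB, hAy⟩⟩
      have h1 := ih n hn hsn hnd
      have hyn : φ.G.src y ⊆ n := List.subset_append_right _ _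
      have h2 := hg.restrict (k' := snd _ _ ≫ sel _ n _ hyn ≫ k y)
        (copyPair (sel _ _ _ htx) (sel _ _ n hn)) (comp_copyPair _ _ _) (by
          rw [copyPair_snd_assoc, sel_sel_assoc])
      rw [sel_sel, sel_sel] at h2
      have hmn : m ⊆ φ.G.tgt y ++ n := fun B hB => by
        by_cases hBy : B ∈ φ.G.tgt y
        · exact List.mem_append_left _ hBy
        · exact List.mem_append_right _ (List.mem_append_left _
            (List.mem_filter.2 ⟨hB, decide_eq_true hBy⟩))
      -- After the exchange the context consists of all outputs of `y` together with `n`, which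
      -- covers `m`.
      refine (h1.exchange h2).restrict (join _ _ _ ≫ sel _ _ m hmn) ?_ ?_
      · rw [← Category.assoc, copyPair_join, sel_sel]
      · rw [Category.assoc, sel_sel_assoc, ← Category.assoc, join_sel_right hsn, Category.assoc]
        exact fun B hB => φ.not_mem_tgt_of_mem_wiresOf (hsx hB) h.not_mem
    · push Not at hy
      exact ih m (fun A hA => (List.mem_append.1 (hm hA)).resolve_left (hy A hA)) hs hd

theorem run_sel_inputs : ∀ (L : List φ.G.Box) (h : φ.Topo L) (hi : φ.inputs ⊆ φ.wiresOf L),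
    run k L h ≫ sel _ _ φ.inputs hi = 𝟙 _
  | [], _, _ => (Category.id_comp _).trans (sel_self φ.inputs_nodup _)
  | x :: L, h, hi => by
    rw [run_cons_sel k h (φ.inputs_subset_wiresOf L), run_sel_inputs]

end

end StringDiagram

/-! ### Embeddings of string diagrams -/

namespace StringDiagram

open Markov

variable {S : DiHypergraph.{w}} {a b c d : List S.Wire}

/-- An embedding of one string diagram into another, as far as the boxes are concerned, such that
the images of the global inputs do not depend on the image. -/
structure Embedding (χ : StringDiagram S a b) (θ : StringDiagram S c d) where
  wire : χ.G.Wire → θ.G.Wire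
  box : χ.G.Box → θ.G.Box
  src_box : ∀ x, θ.G.src (box x) = (χ.G.src x).map wire
  tgt_box : ∀ x, θ.G.tgt (box x) = (χ.G.tgt x).map wire
  type_wire : ∀ A, θ.type.wire (wire A) = χ.type.wire A
  type_box : ∀ x, θ.type.box (box x) = χ.type.box x
  box_injective : Function.Injective box
  not_mem_dec : ∀ A ∈ χ.inputs, ∀ x, wire A ∉ θ.G.Dec {B | B ∈ θ.G.tgt (box x)}

theorem not_mem_dec_of_mem_inputs (θ : StringDiagram S c d) {A : θ.G.Wire} (hA : A ∈ θ.inputs)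
    (x : θ.G.Box) : A ∉ θ.G.Dec {B | B ∈ θ.G.tgt x} :=
  Topo.not_mem_dec (L := []) trivial hA List.not_mem_nil

variable {χ : StringDiagram S a b} {θ : StringDiagram S c d} (m : Embedding χ θ)

/-- The path is traced backwards. Each wire has a unique origin, so a wire in the image is produced
by an image box with inputs again in the image, unless it is the image of a global input;
`not_mem_dec` rules that out. -/
theorem Embedding.mem_dec {x : χ.G.Box} {A : χ.G.Wire}
    (h : m.wire A ∈ θ.G.Dec {B | B ∈ θ.G.tgt (m.box x)}) : A ∈ χ.G.Dec {B | B ∈ χ.G.tgt x} := by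
  obtain ⟨B, hB, h⟩ := h
  generalize hD : m.wire A = D at h
  induction h generalizing A with
  | refl =>
    obtain hA | ⟨y, hy⟩ := χ.mem_inputs_or_tgt A
    · exact absurd ⟨B, hB, hD ▸ .refl⟩ (m.not_mem_dec A hA x)
    · have h1 : m.wire A ∈ θ.G.tgt (m.box y) := by
        rw [m.tgt_box]; exact List.mem_map_of_mem hy
      rw [← hD] at hB
      exact ⟨A, m.box_injective (θ.tgt_unique h1 hB) ▸ hy, .refl⟩
  | @tail D E hBD hE ih =>
    obtain ⟨z, h1, h2⟩ := hE
    obtain hA | ⟨y, hy⟩ := χ.mem_inputs_or_tgt A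
    · exact absurd ⟨B, hB, hD ▸ hBD.tail ⟨z, h1, h2⟩⟩ (m.not_mem_dec A hA x)
    · have h3 : m.wire A ∈ θ.G.tgt (m.box y) := by
        rw [m.tgt_box]; exact List.mem_map_of_mem hy
      rw [hD] at h3
      rw [θ.tgt_unique h2 h3, m.src_box] at h1
      obtain ⟨A', hA', h4⟩ := List.mem_map.1 h1
      obtain ⟨B', hB', h5⟩ := ih h4
      exact ⟨B', hB', h5.tail ⟨y, hA', hy⟩⟩

section

variable {C : Type u} [Category.{v} C] [MonoidalCategory C] [MarkovCategory C] {T : S.Wire → C}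

theorem val_wire (A : χ.G.Wire) : θ.val T (m.wire A) = χ.val T A := congrArg T (m.type_wire A)

theorem ten_val {n : List S.Wire} {l : List χ.G.Wire} (h : l.map χ.type.wire = n) :
    ten T n = ten (χ.val T) l := by
  rw [← h]; exact ten_map χ.type.wire (fun _ => rfl) l

theorem ten_embedding {n : List θ.G.Wire} {l : List χ.G.Wire} (h : n = l.map m.wire) :
    ten (θ.val T) n = ten (χ.val T) l := by
  rw [h]; exact ten_map m.wire (val_wire m) l

/-- The morphisms assigned to the boxes of a string diagram, when morphisms are assigned to the boxes
of the underlying hypergraph `S`. -/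
def kernels (κ : ∀ s : S.Box, ten T (S.src s) ⟶ ten T (S.tgt s)) (χ : StringDiagram S a b) :
    χ.Kernels T :=
  fun x => eqToHom (ten_val (χ.type.src_box x).symm).symm ≫ κ (χ.type.box x) ≫
    eqToHom (ten_val (χ.type.tgt_box x).symm)

variable (κ : ∀ s : S.Box, ten T (S.src s) ⟶ ten T (S.tgt s))

theorem kernels_box (x : χ.G.Box) : kernels κ θ (m.box x) ≫ eqToHom (ten_embedding m (m.tgt_box x)) =
    eqToHom (ten_embedding m (m.src_box x)) ≫ kernels κ χ x := by
  have h : ∀ s (hs : θ.type.box (m.box x) = s), κ (θ.type.box (m.box x)) =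
      eqToHom (by rw [hs]) ≫ κ s ≫ eqToHom (by rw [hs]) := by rintro s rfl; simp
  rw [kernels, kernels, h _ (m.type_box x)]
  simp

/-- The wiring from wires of `θ` to wires of `χ`. -/
abbrev Embedding.wir (T : S.Wire → C) (l : List θ.G.Wire) (n : List χ.G.Wire)
    (h : n.map m.wire ⊆ l) : ten (θ.val T) l ⟶ ten (χ.val T) n :=
  Markov.wir (θ.val T) (χ.val T) m.wire (val_wire m) l n h

theorem Embedding.sel_eqToHom {l n : List θ.G.Wire} {n' : List χ.G.Wire} (h : n ⊆ l)
    (hn : n = n'.map m.wire) : sel (θ.val T) l n h ≫ eqToHom (ten_embedding m hn) =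
      m.wir T l n' (hn ▸ h) := by
  subst hn
  exact Markov.sel_eqToHom _ _ _

theorem Embedding.copyPair_wir_push {l : List θ.G.Wire} {x : χ.G.Box} {L : List χ.G.Box}
    (h1 : (χ.G.tgt x).map m.wire ⊆ l) (h2 : (χ.wiresOf L).map m.wire ⊆ l)
    (h3 : (χ.wiresOf (x :: L)).map m.wire ⊆ l) :
    copyPair (m.wir T l _ h1) (m.wir T l _ h2) ≫ push T x L = m.wir T l _ h3 := by
  refine (comp_fan _ _ _).trans (fan_congr fun y hy => ?_)
  split
  · rw [copyPair_fst_assoc, wir_proj]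
  · rw [copyPair_snd_assoc, wir_proj]

/-- The last box of `χ` is generated independently of the earlier wires of `χ` and of the spectators
`e`, so its kernel can be split off and induction applies to the rest. The spectators allow two
disjoint parts to be treated one after the other. -/
theorem run_embedding {P : C} {l : List θ.G.Wire} (hl : ∀ n : List θ.G.Wire, n ⊆ l)
    {p : P ⟶ ten (θ.val T) l} (hp : GeneratedBy (kernels κ θ) Set.univ p) {e : List θ.G.Wire}
    (he : ∀ A ∈ e, ∀ x, A ∉ θ.G.Dec {B | B ∈ θ.G.tgt (m.box x)}) :
    ∀ (L : List χ.G.Box) (h : χ.Topo L),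
      p ≫ copyPair (m.wir T l (χ.wiresOf L) (hl _)) (sel (θ.val T) l e (hl _)) =
        p ≫ copyPair (m.wir T l χ.inputs (hl _)) (sel (θ.val T) l e (hl _)) ≫
          (run (kernels κ χ) L h ▷ _)
  | [], _ => congrArg (p ≫ ·)
      ((Category.comp_id _).symm.trans (congrArg (_ ≫ ·) (id_whiskerRight _ _).symm))
  | x :: L, h => by
    have hw := h.src_subset_cons
    have h1 := hp (m.box x) trivial (hl _) ((χ.wiresOf L).map m.wire ++ e) (hl _) (by
      rw [m.src_box]
      exact List.Subset.trans (List.map_subset _ hw) (List.subset_append_left _ _)) (by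
      intro A hA hd
      obtain hA | hA := List.mem_append.1 hA
      · obtain ⟨B, hB, rfl⟩ := List.mem_map.1 hA
        exact h.of_cons.not_mem_dec hB h.not_mem (m.mem_dec hd)
      · exact he A hA x hd)
    have h2 := h1.post (eqToHom (ten_embedding m (m.tgt_box x)))
    have hs : (χ.G.src x).map m.wire ⊆ (χ.wiresOf L).map m.wire ++ e :=
      List.Subset.trans (List.map_subset _ hw) (List.subset_append_left _ _)
    rw [m.sel_eqToHom _ (m.tgt_box x), Category.assoc, kernels_box, ← Category.assoc,
      m.sel_eqToHom _ (m.src_box x)] at h2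
    -- The context is repackaged as a pair: wires of `χ` on one side and spectators on the other.
    have h3 := h2.restrict (k' := fst _ _ ≫ sel _ _ _ hw ≫ kernels κ χ x)
      (copyPair (m.wir T ((χ.wiresOf L).map m.wire ++ e) (χ.wiresOf L) (List.subset_append_left _ _))
        (sel _ _ e (List.subset_append_right _ _))) (comp_copyPair _ _ _) (by
          rw [copyPair_fst_assoc, ← Category.assoc, wir_sel])
    rw [sel_wir, sel_sel] at h3
    have ih := run_embedding hl hp he L h.of_cons
    rw [← m.copyPair_wir_push (hl _) (hl _), ← copyPair_whiskerRight, ← copyPair_assoc_inv,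
      ← Category.assoc p, ← Category.assoc p, h3]
    simp only [Category.assoc]
    rw [← Category.assoc p, ih]
    simp only [run, Category.assoc, comp_whiskerRight]
    rw [← copyPair_id_whiskerRight]
    simp

end

end StringDiagram

/-! ### The strict Markov functor given by morphisms for the boxes -/

namespace StringDiagram

open Markov

variable {S : DiHypergraph.{w}} {a b c d : List S.Wire}

/-- A list of all boxes, in a possible order of generation. -/
def allBoxes (φ : StringDiagram S a b) : List φ.G.Box := φ.exists_topo_full.choose

theorem topo_allBoxes (φ : StringDiagram S a b) : φ.Topo φ.allBoxes :=
  φ.exists_topo_full.choose_spec.1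

theorem mem_allBoxes (φ : StringDiagram S a b) (x : φ.G.Box) : x ∈ φ.allBoxes :=
  φ.exists_topo_full.choose_spec.2 x

/-- A list of all wires. -/
def allWires (φ : StringDiagram S a b) : List φ.G.Wire := φ.wiresOf φ.allBoxes

theorem subset_allWires (φ : StringDiagram S a b) (l : List φ.G.Wire) : l ⊆ φ.allWires :=
  φ.subset_wiresOf φ.mem_allBoxes l

/-! ### Composites, tensor products and normalizations as ambient diagrams -/

/-- The left part of a composite. -/
def compLeft (φ : StringDiagram S a b) (ψ : StringDiagram S b c) : Embedding φ (φ.comp ψ) where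
  wire := Sum.inl
  box := Sum.inl
  src_box _ := rfl
  tgt_box _ := rfl
  type_wire _ := rfl
  type_box _ := rfl
  box_injective := Sum.inl_injective
  not_mem_dec _ hA _ := not_mem_dec_of_mem_inputs _ (List.mem_map_of_mem hA) _

/-- The right part of a composite. -/
def compRight (φ : StringDiagram S a b) (ψ : StringDiagram S b c) : Embedding ψ (φ.comp ψ) where
  wire := glue φ ψ
  box := Sum.inr
  src_box _ := rfl
  tgt_box _ := rfl
  type_wire := glue_type φ ψ
  type_box _ := rfl
  box_injective := Sum.inr_injective
  not_mem_dec A hA x := by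
    rintro ⟨B, hB, h⟩
    obtain ⟨i, hi⟩ := List.get_of_mem hA
    have hA' : A = ψ.inWire (i.cast ψ.length_inputs) := hi.symm
    -- Everything reached from a box of `ψ` is a non-input wire of `ψ`, whereas its glued inputs are
    -- wires of `φ`.
    have h1 : ∀ D, Relation.ReflTransGen (φ.comp ψ).G.Edge B D → ∃ D', D = Sum.inr D' := by
      intro D hD
      induction hD with
      | refl =>
        obtain ⟨B', hB', rfl⟩ := List.mem_map.1 hB
        exact ⟨_, glue_tgt φ ψ hB'⟩
      | tail _ hE ih =>
        obtain ⟨D', rfl⟩ := ih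
        obtain ⟨y | y, h1, h2⟩ := hE
        · obtain ⟨_, _, h3⟩ := List.mem_map.1 h1
          exact absurd h3 Sum.inl_ne_inr
        · obtain ⟨E, hE, rfl⟩ := List.mem_map.1 h2
          exact ⟨_, glue_tgt φ ψ hE⟩
    obtain ⟨D, hD⟩ := h1 _ h
    rw [hA', glue_inputs] at hD
    exact Sum.inl_ne_inr hD

theorem outputs_map_inl (φ : StringDiagram S a b) (ψ : StringDiagram S b c) :
    φ.outputs.map Sum.inl = ψ.inputs.map (glue φ ψ) :=
  List.ext_getElem (by simp [length_inputs, length_outputs]) fun i h1 h2 => by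
    have hi : i < b.length := by simpa [length_outputs] using h1
    simpa [inWire, outWire] using (glue_inputs φ ψ ⟨i, hi⟩).symm

theorem tensor_reach_inl (φ : StringDiagram S a b) (ψ : StringDiagram S c d) {x : φ.G.Box}
    {A : φ.G.Wire ⊕ ψ.G.Wire} (h : A ∈ (φ.tensor ψ).G.Dec {B | B ∈ (φ.tensor ψ).G.tgt (Sum.inl x)}) :
    ∃ B, A = Sum.inl B := by
  obtain ⟨B, hB, h⟩ := h
  induction h with
  | refl =>
    obtain ⟨B', _, rfl⟩ := List.mem_map.1 hB
    exact ⟨_, rfl⟩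
  | tail _ hE ih =>
    obtain ⟨D', rfl⟩ := ih
    obtain ⟨y | y, h1, h2⟩ := hE
    · obtain ⟨E, _, rfl⟩ := List.mem_map.1 h2
      exact ⟨_, rfl⟩
    · obtain ⟨_, _, h3⟩ := List.mem_map.1 h1
      exact absurd h3 Sum.inr_ne_inl

theorem tensor_reach_inr (φ : StringDiagram S a b) (ψ : StringDiagram S c d) {x : ψ.G.Box}
    {A : φ.G.Wire ⊕ ψ.G.Wire} (h : A ∈ (φ.tensor ψ).G.Dec {B | B ∈ (φ.tensor ψ).G.tgt (Sum.inr x)}) :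
    ∃ B, A = Sum.inr B := by
  obtain ⟨B, hB, h⟩ := h
  induction h with
  | refl =>
    obtain ⟨B', _, rfl⟩ := List.mem_map.1 hB
    exact ⟨_, rfl⟩
  | tail _ hE ih =>
    obtain ⟨D', rfl⟩ := ih
    obtain ⟨y | y, h1, h2⟩ := hE
    · obtain ⟨_, _, h3⟩ := List.mem_map.1 h1
      exact absurd h3 Sum.inl_ne_inr
    · obtain ⟨E, _, rfl⟩ := List.mem_map.1 h2
      exact ⟨_, rfl⟩

/-- The left part of a tensor product. -/
def tensorLeft (φ : StringDiagram S a b) (ψ : StringDiagram S c d) :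
    Embedding φ (φ.tensor ψ) where
  wire := Sum.inl
  box := Sum.inl
  src_box _ := rfl
  tgt_box _ := rfl
  type_wire _ := rfl
  type_box _ := rfl
  box_injective := Sum.inl_injective
  not_mem_dec _ hA _ := not_mem_dec_of_mem_inputs _
    (List.mem_append_left _ (List.mem_map_of_mem hA)) _

/-- The right part of a tensor product. -/
def tensorRight (φ : StringDiagram S a b) (ψ : StringDiagram S c d) :
    Embedding ψ (φ.tensor ψ) where
  wire := Sum.inr
  box := Sum.inr
  src_box _ := rfl
  tgt_box _ := rfl
  type_wire _ := rfl
  type_box _ := rfl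
  box_injective := Sum.inr_injective
  not_mem_dec _ hA _ := not_mem_dec_of_mem_inputs _
    (List.mem_append_right _ (List.mem_map_of_mem hA)) _

/-- The normalization of a string diagram is a part of it. -/
def normEmbedding (φ : StringDiagram S a b) : Embedding φ.norm φ where
  wire := Subtype.val
  box := Subtype.val
  src_box x := (List.attachWith_map_subtype_val (φ.remains_src x.2)).symm
  tgt_box x := (List.attachWith_map_subtype_val (φ.remains_tgt x.2)).symm
  type_wire _ := rfl
  type_box _ := rfl
  box_injective := Subtype.val_injective
  not_mem_dec _ hA _ := not_mem_dec_of_mem_inputs _ ((List.mem_attachWith _ _).1 hA) _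

section

variable {C : Type u} [Category.{v} C] [MonoidalCategory C] [MarkovCategory C] {T : S.Wire → C}
variable (κ : ∀ s : S.Box, ten T (S.src s) ⟶ ten T (S.tgt s))

/-- Generate all wires of a string diagram from the global inputs. -/
def joint (φ : StringDiagram S a b) : ten (φ.val T) φ.inputs ⟶ ten (φ.val T) φ.allWires :=
  run (kernels κ φ) φ.allBoxes φ.topo_allBoxes

theorem joint_generatedBy (φ : StringDiagram S a b) :
    GeneratedBy (kernels κ φ) Set.univ (joint κ φ) := fun x _ =>
  run_generatedBy (kernels κ φ) φ.allBoxes φ.topo_allBoxes x (φ.mem_allBoxes x)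

theorem joint_sel_inputs (φ : StringDiagram S a b) :
    joint κ φ ≫ sel (φ.val T) φ.allWires φ.inputs (φ.subset_allWires _) = 𝟙 _ :=
  run_sel_inputs _ _ _ _

theorem Embedding.wir_eq {a₁ b₁ a₂ b₂ a₃ b₃ : List S.Wire} {χ : StringDiagram S a₁ b₁}
    {χ' : StringDiagram S a₂ b₂} {θ : StringDiagram S a₃ b₃} (m : Embedding χ θ)
    (m' : Embedding χ' θ) {l : List θ.G.Wire} {n : List χ.G.Wire} {n' : List χ'.G.Wire}
    (h : n.map m.wire ⊆ l) (h' : n'.map m'.wire ⊆ l) (hn : n.map m.wire = n'.map m'.wire) :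
    m'.wir T l n' h' = m.wir T l n h ≫
      eqToHom ((ten_embedding m rfl).symm.trans (ten_embedding m' hn)) := by
  rw [← m.sel_eqToHom h rfl, ← m'.sel_eqToHom h hn]
  simp

theorem run_embedding_wir {a₁ b₁ a₂ b₂ a₃ b₃ : List S.Wire} {χ : StringDiagram S a₁ b₁}
    {χ' : StringDiagram S a₂ b₂} {θ : StringDiagram S a₃ b₃} (m : Embedding χ θ)
    (m' : Embedding χ' θ) {P : C} {l : List θ.G.Wire} (hl : ∀ n : List θ.G.Wire, n ⊆ l)
    {p : P ⟶ ten (θ.val T) l} (hp : GeneratedBy (kernels κ θ) Set.univ p) {e : List χ'.G.Wire}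
    (he : ∀ A ∈ e, ∀ x, m'.wire A ∉ θ.G.Dec {B | B ∈ θ.G.tgt (m.box x)})
    (L : List χ.G.Box) (h : χ.Topo L) :
    p ≫ copyPair (m.wir T l (χ.wiresOf L) (hl _)) (m'.wir T l e (hl _)) =
      p ≫ copyPair (m.wir T l χ.inputs (hl _)) (m'.wir T l e (hl _)) ≫
        (run (kernels κ χ) L h ▷ _) := by
  have h1 := run_embedding m κ hl hp (e := e.map m'.wire) (by
    intro A hA
    obtain ⟨B, hB, rfl⟩ := List.mem_map.1 hA
    exact he B hB) L h
  have h2 := congrArg (· ≫ _ ◁ eqToHom (ten_embedding m' rfl)) h1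
  simp only [Category.assoc, copyPair_whiskerLeft, m'.sel_eqToHom (hl _) rfl] at h2
  rw [h2, ← whisker_exchange, ← Category.assoc (copyPair _ _), copyPair_whiskerLeft,
    m'.sel_eqToHom (hl _) rfl]

/-- Without spectators: the wires of a part depend on the surrounding generation process only
through the inputs of that part. This is the uniqueness behind functoriality and behind the recovery
of `f` from its kernels. -/
theorem GeneratedBy.wir {χ : StringDiagram S a b} {θ : StringDiagram S c d} {P : C}
    {l : List θ.G.Wire} {p : P ⟶ ten (θ.val T) l} (hp : GeneratedBy (kernels κ θ) Set.univ p)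
    (hl : ∀ n : List θ.G.Wire, n ⊆ l) (m : Embedding χ θ) (n : List χ.G.Wire) :
    p ≫ m.wir T _ n (hl _) =
      p ≫ m.wir T _ χ.inputs (hl _) ≫ joint κ χ ≫ sel _ _ n (χ.subset_allWires _) := by
  have h1 := run_embedding m κ hl hp (e := [])
    (fun _ h => absurd h List.not_mem_nil) χ.allBoxes χ.topo_allBoxes
  have hn : n ⊆ χ.wiresOf χ.allBoxes := χ.subset_wiresOf χ.mem_allBoxes n
  have h2 := congrArg (· ≫ fst (ten (χ.val T) (χ.wiresOf χ.allBoxes)) _ ≫ sel _ _ n hn) h1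
  rw [← tensorHom_id] at h2
  simp only [Category.assoc, copyPair_fst_assoc, tensorHom_fst_assoc] at h2
  rw [wir_sel] at h2
  exact h2

theorem joint_wir {χ : StringDiagram S a b} {θ : StringDiagram S c d} (m : Embedding χ θ)
    (n : List χ.G.Wire) :
    joint κ θ ≫ m.wir T _ n (θ.subset_allWires _) =
      joint κ θ ≫ m.wir T _ χ.inputs (θ.subset_allWires _) ≫ joint κ χ ≫
        sel _ _ n (χ.subset_allWires _) :=
  GeneratedBy.wir κ (joint_generatedBy κ θ) θ.subset_allWires m n

/-! ### Evaluation of string diagrams -/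

/-- The morphism of `C` described by a string diagram. -/
def evalMap (φ : StringDiagram S a b) : ten T a ⟶ ten T b :=
  eqToHom (ten_val φ.inputs_type) ≫ joint κ φ ≫ sel _ _ φ.outputs (φ.subset_allWires _) ≫
    eqToHom (ten_val φ.outputs_type).symm

/-- Boxes of `θ` outside `χ` have no influence on the outputs. This covers isomorphisms and
normalization at once. -/
theorem evalMap_embedding {χ θ : StringDiagram S a b} (m : Embedding χ θ)
    (hi : θ.inputs = χ.inputs.map m.wire) (ho : θ.outputs = χ.outputs.map m.wire) :
    evalMap κ χ = evalMap κ θ := by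
  have h1 := joint_wir κ m χ.outputs
  rw [← m.sel_eqToHom (θ.subset_allWires _) ho, ← m.sel_eqToHom (θ.subset_allWires _) hi,
    Category.assoc, ← Category.assoc, ← Category.assoc (joint κ θ), joint_sel_inputs,
    Category.id_comp, ← Category.assoc (eqToHom _)] at h1
  have h2 := congrArg (fun f => eqToHom (ten_val θ.inputs_type) ≫ f ≫
    eqToHom (ten_val χ.outputs_type).symm) h1
  simp only [Category.assoc, eqToHom_trans, eqToHom_trans_assoc] at h2
  exact h2.symm

/-- Both halves embed into the composite. Its outputs are determined by the inputs of `ψ`, which are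
the outputs of `φ`, and these by the inputs of `φ`. -/
theorem evalMap_comp (φ : StringDiagram S a b) (ψ : StringDiagram S b c) :
    evalMap κ (φ.comp ψ) = evalMap κ φ ≫ evalMap κ ψ := by
  let m := compLeft φ ψ
  let m' := compRight φ ψ
  let θ := φ.comp ψ
  have ho : θ.outputs = ψ.outputs.map m'.wire := rfl
  have hi : θ.inputs = φ.inputs.map m.wire := rfl
  have h1 := joint_wir κ m' ψ.outputs
  have h2 := joint_wir κ m φ.outputs
  rw [m.wir_eq m' (n := φ.outputs) (θ.subset_allWires _) _ (outputs_map_inl φ ψ), Category.assoc,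
    ← Category.assoc (joint κ _), h2, ← m'.sel_eqToHom (θ.subset_allWires _) ho,
    ← m.sel_eqToHom (θ.subset_allWires _) hi, Category.assoc, Category.assoc, Category.assoc,
    Category.assoc, ← Category.assoc (joint κ _), ← Category.assoc (joint κ _) (sel _ _ _ _),
    joint_sel_inputs, Category.id_comp] at h1
  have h2 := congrArg (fun f => eqToHom (ten_val θ.inputs_type) ≫ f ≫
    eqToHom (ten_val ψ.outputs_type).symm) h1
  simp only [Category.assoc, eqToHom_trans, eqToHom_trans_assoc] at h2
  refine h2.trans ?_
  simp only [evalMap, Category.assoc, eqToHom_trans_assoc]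

theorem evalMap_norm (φ : StringDiagram S a b) : evalMap κ φ.norm = evalMap κ φ :=
  evalMap_embedding κ φ.normEmbedding
    (List.attachWith_map_subtype_val φ.remains_inputs).symm
    (List.attachWith_map_subtype_val φ.remains_outputs).symm

/-- The value of a diagram that is the disjoint union of two parts. -/
theorem evalMap_union (hs : IsStrictMonoidal C) {φ : StringDiagram S a b}
    {ψ : StringDiagram S c d} {θ : StringDiagram S (a ++ c) (b ++ d)} (m : Embedding φ θ)
    (m' : Embedding ψ θ) (hi : θ.inputs = φ.inputs.map m.wire ++ ψ.inputs.map m'.wire)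
    (ho : θ.outputs = φ.outputs.map m.wire ++ ψ.outputs.map m'.wire)
    (h : ∀ A x, m'.wire A ∉ θ.G.Dec {B | B ∈ θ.G.tgt (m.box x)})
    (h' : ∀ A x, m.wire A ∉ θ.G.Dec {B | B ∈ θ.G.tgt (m'.box x)}) :
    evalMap κ θ = eqToHom (ten_append hs c a) ≫ (evalMap κ φ ⊗ₘ evalMap κ ψ) ≫
      eqToHom (ten_append hs d b).symm := by
  have hg := joint_generatedBy κ θ
  have key : ∀ (k : List θ.G.Wire) (n : List φ.G.Wire) (n' : List ψ.G.Wire)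
      (h : k = n.map m.wire ++ n'.map m'.wire), ∃ h',
      sel (θ.val T) θ.allWires k (θ.subset_allWires _) =
        copyPair (m.wir T _ n (θ.subset_allWires _)) (m'.wir T _ n' (θ.subset_allWires _)) ≫
          eqToHom h' := by
    rintro _ n n' rfl
    refine ⟨((ten_append hs _ _).trans
      (congrArg₂ (· ⊗ ·) (ten_embedding m rfl) (ten_embedding m' rfl))).symm, ?_⟩
    rw [← m.sel_eqToHom (θ.subset_allWires _) rfl, ← m'.sel_eqToHom (θ.subset_allWires _) rfl,
      ← copyPair_eqToHom _ _ _ _ (congrArg₂ (· ⊗ ·) (ten_embedding m rfl) (ten_embedding m' rfl)),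
      ← sel_append_eqToHom hs (θ.subset_allWires _)]
    simp
  obtain ⟨e, hi⟩ := key _ _ _ hi
  obtain ⟨e', ho⟩ := key _ _ _ ho
  -- The kernels of the left part are split off with all wires of the right part as spectators;
  -- those of the right part are split off with only the inputs of the left part as spectators.
  have h1 := run_embedding_wir κ m m' θ.subset_allWires hg (e := ψ.wiresOf ψ.allBoxes)
    (fun A _ => h A) φ.allBoxes φ.topo_allBoxes
  have h2 := run_embedding_wir κ m' m θ.subset_allWires hg (e := φ.inputs)
    (fun A _ => h' A) ψ.allBoxes ψ.topo_allBoxes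
  have h3 := congrArg (· ≫ (β_ _ _).hom) h2
  simp only [Category.assoc, copyPair_braiding, BraidedCategory.braiding_naturality_left] at h3
  rw [← Category.assoc (copyPair _ _), copyPair_braiding] at h3
  rw [← Category.assoc (joint κ θ) _ (_ ▷ _), h3, Category.assoc, Category.assoc] at h1
  have hφ : φ.outputs ⊆ φ.wiresOf φ.allBoxes := φ.subset_wiresOf φ.mem_allBoxes _
  have hψ : ψ.outputs ⊆ ψ.wiresOf ψ.allBoxes := ψ.subset_wiresOf ψ.mem_allBoxes _
  have h4 := congrArg (· ≫ (sel _ _ _ hφ ⊗ₘ sel _ _ _ hψ)) h1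
  rw [← id_tensorHom, ← tensorHom_id] at h4
  simp only [Category.assoc, copyPair_tensorHom, wir_sel, tensorHom_comp_tensorHom,
    Category.id_comp] at h4
  have h5 : copyPair (m.wir T _ φ.inputs (θ.subset_allWires _))
      (m'.wir T _ ψ.inputs (θ.subset_allWires _)) = sel _ _ θ.inputs (θ.subset_allWires _) ≫
        eqToHom e.symm := by
    rw [hi]; simp
  rw [← copyPair_tensorHom (m.wir T _ φ.inputs (θ.subset_allWires _)), h5, Category.assoc,
    ← Category.assoc (joint κ θ), joint_sel_inputs, Category.id_comp] at h4
  rw [evalMap, ho, Category.assoc, ← Category.assoc (joint κ θ), h4]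
  simp only [evalMap, ← tensorHom_comp_tensorHom, tensorHom_eqToHom, Category.assoc, eqToHom_trans,
    eqToHom_trans_assoc]
  rfl

theorem evalMap_tensor (hs : IsStrictMonoidal C) (φ : StringDiagram S a b)
    (ψ : StringDiagram S c d) :
    evalMap κ (φ.tensor ψ) = eqToHom (ten_append hs c a) ≫ (evalMap κ φ ⊗ₘ evalMap κ ψ) ≫
      eqToHom (ten_append hs d b).symm :=
  evalMap_union κ hs (tensorLeft φ ψ) (tensorRight φ ψ) rfl rfl
    (fun _ _ h => by
      obtain ⟨B, hB⟩ := tensor_reach_inl φ ψ h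
      exact Sum.inr_ne_inl hB)
    (fun _ _ h => by
      obtain ⟨B, hB⟩ := tensor_reach_inr φ ψ h
      exact Sum.inl_ne_inr hB)

theorem evalMap_of_subset {φ : StringDiagram S a b} 
    (ho : φ.outputs ⊆ φ.inputs) :
    evalMap κ φ = eqToHom (ten_val φ.inputs_type) ≫ sel _ _ φ.outputs ho ≫
      eqToHom (ten_val φ.outputs_type).symm := by
  rw [evalMap, ← sel_sel (φ.subset_allWires _) ho, Category.assoc, ← Category.assoc (joint κ φ),
    joint_sel_inputs, Category.id_comp]

theorem evalMap_ident (a : List S.Wire) : evalMap κ (ident a) = 𝟙 (ten T a) := by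
  rw [evalMap_of_subset κ (List.Subset.refl _)]
  refine (congrArg (fun f => eqToHom _ ≫ f ≫ eqToHom _) (sel_self (ident a).inputs_nodup _)).trans ?_
  rw [Category.id_comp]
  exact (eqToHom_trans _ _).trans (eqToHom_refl _ _)

theorem evalMap_del (a : List S.Wire) : evalMap κ (del a) = ε[ten T a] :=
  MarkovCategory.eq_discard _ _

/-- The value of a diagram without boxes, if the inputs and outputs are concatenations. -/
theorem evalMap_append (hs : IsStrictMonoidal C) {χ : StringDiagram S a (b ++ c)}
    {i j : List χ.G.Wire} (hi : i.map χ.type.wire = b) (hj : j.map χ.type.wire = c)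
    (ho : χ.outputs = i ++ j) (hsub : i ++ j ⊆ χ.inputs) : ∃ h h',
    evalMap κ χ = copyPair
      (eqToHom (ten_val χ.inputs_type) ≫ sel (χ.val T) χ.inputs i h ≫ eqToHom (ten_val hi).symm)
      (eqToHom (ten_val χ.inputs_type) ≫ sel (χ.val T) χ.inputs j h' ≫ eqToHom (ten_val hj).symm) ≫
        eqToHom (ten_append hs c b).symm := by
  refine ⟨(List.append_subset.1 hsub).1, (List.append_subset.1 hsub).2, ?_⟩
  rw [evalMap_of_subset κ (ho ▸ hsub), ← comp_copyPair, Category.assoc,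
    ← copyPair_eqToHom _ _ _ _ (congrArg₂ (· ⊗ ·) (ten_val hi) (ten_val hj)).symm,
    ← sel_append_eqToHom hs hsub]
  have h : ∀ (o : List χ.G.Wire) (ho : o = i ++ j) (h : o.map χ.type.wire = b ++ c),
      sel (χ.val T) χ.inputs o (ho ▸ hsub) ≫ eqToHom (ten_val h).symm =
        sel (χ.val T) χ.inputs (i ++ j) hsub ≫ eqToHom (ten_val (ho ▸ h)).symm := by
    rintro _ rfl _; rfl
  rw [h _ ho χ.outputs_type]
  simp

theorem evalMap_copy (hs : IsStrictMonoidal C) (a : List S.Wire) :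
    evalMap κ (copy a) = Δ[ten T a] ≫ eqToHom (ten_append hs a a).symm := by
  obtain ⟨h, h', h1⟩ := evalMap_append κ hs (χ := copy a) (copy a).inputs_type (copy a).inputs_type
    rfl (List.append_subset.2 ⟨List.Subset.refl _, List.Subset.refl _⟩)
  rw [h1, sel_self (copy a).inputs_nodup]
  simp [copyPair_id_id]

theorem evalMap_swap (hs : IsStrictMonoidal C) (a b : List S.Wire) :
    evalMap κ (swap a b) = eqToHom (ten_append hs b a) ≫ (β_ (ten T a) (ten T b)).hom ≫
      eqToHom (ten_append hs a b).symm := by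
  have hi : ((List.finRange a.length).map Sum.inl).map (Sum.elim a.get b.get) = a := by
    rw [List.map_map, Sum.elim_comp_inl, map_get_finRange]
  have hj : ((List.finRange b.length).map Sum.inr).map (Sum.elim a.get b.get) = b := by
    rw [List.map_map, Sum.elim_comp_inr, map_get_finRange]
  have key : ∀ (χ : StringDiagram S (a ++ b) (b ++ a)) (i j : List χ.G.Wire),
      i.map χ.type.wire = a → j.map χ.type.wire = b → χ.inputs = i ++ j → χ.outputs = j ++ i →
      evalMap κ χ = eqToHom (ten_append hs b a) ≫ (β_ (ten T a) (ten T b)).hom ≫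
        eqToHom (ten_append hs a b).symm := by
    intro χ i j hi hj h1 h2
    obtain ⟨h3, h4, h5⟩ := evalMap_append κ hs hj hi h2 (fun x hx => by
      rw [h1, List.mem_append]; exact (List.mem_append.1 hx).symm)
    have h6 : ∀ k (hk : k = i ++ j) (h : i ++ j ⊆ k), k.Nodup → sel (χ.val T) k (i ++ j) h =
        eqToHom (congrArg (ten (χ.val T)) hk) := by
      rintro _ rfl h hn; exact sel_self hn h
    have h7 := sel_append_eqToHom (V := χ.val T) hs (h1 ▸ List.Subset.refl _ : i ++ j ⊆ χ.inputs)
    rw [h6 _ h1 _ χ.inputs_nodup, eqToHom_trans] at h7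
    have h8 := congrArg (fun f => eqToHom (ten_val χ.inputs_type) ≫ f ≫
      eqToHom (congrArg₂ (· ⊗ ·) (ten_val hi) (ten_val hj)).symm) h7
    rw [copyPair_eqToHom _ _ (ten_val hi).symm (ten_val hj).symm, comp_copyPair] at h8
    simp only [eqToHom_trans] at h8
    rw [h5, ← copyPair_braiding, ← h8, Category.assoc]
  exact key (swap a b) _ _ hi hj rfl rfl

theorem evalMap_iso {φ ψ : StringDiagram S a b} (h : φ.Iso ψ) : evalMap κ φ = evalMap κ ψ := by
  obtain ⟨e, e', h1, h2, h3, h4, h5, h6⟩ := h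
  exact evalMap_embedding κ
    { wire := e
      box := e'
      src_box := h1
      tgt_box := h2
      type_wire := h3
      type_box := h4
      box_injective := e'.injective
      not_mem_dec := fun A hA x => not_mem_dec_of_mem_inputs _ (by
        rw [h5]; exact List.mem_map_of_mem hA) _ } h5 h6

/-- The strict Markov functor determined by objects for the wires and morphisms for the boxes. -/
def evalFunctor (hs : IsStrictMonoidal C) : FreeMarkovFunctor S C where
  obj := ten T
  map φ := evalMap κ φ.1
  map_iso _ _ h := evalMap_iso κ h
  map_ident := evalMap_ident κ
  map_comp φ ψ := (evalMap_norm κ _).trans (evalMap_comp κ φ.1 ψ.1)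
  obj_nil := rfl
  obj_append a c := ten_append hs c a
  map_tensor φ ψ := evalMap_tensor κ hs φ.1 ψ.1
  map_swap := evalMap_swap κ hs
  map_copy := evalMap_copy κ hs
  map_del a := (evalMap_del κ a).trans (Category.comp_id _).symm

end

end StringDiagram

/-! ### String diagrams are generated by their boxes -/

namespace StringDiagram

variable {S : DiHypergraph.{w}} {a b c d : List S.Wire}

theorem map_elim_inl {α β γ : Type*} (f : α → γ) (g : β → γ) (l : List α) :
    (l.map Sum.inl).map (Sum.elim f g) = l.map f := by
  rw [List.map_map, Sum.elim_comp_inl]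

theorem map_elim_inr {α β γ : Type*} (f : α → γ) (g : β → γ) (l : List β) :
    (l.map Sum.inr).map (Sum.elim f g) = l.map g := by
  rw [List.map_map, Sum.elim_comp_inr]

/-- A morphism of string diagrams that is bijective on boxes and preserves the global inputs and
outputs. -/
structure Cover (φ χ : StringDiagram S a b) where
  wire : φ.G.Wire → χ.G.Wire
  box : φ.G.Box → χ.G.Box
  src_box : ∀ x, χ.G.src (box x) = (φ.G.src x).map wire
  tgt_box : ∀ x, χ.G.tgt (box x) = (φ.G.tgt x).map wire
  type_wire : ∀ A, χ.type.wire (wire A) = φ.type.wire A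
  type_box : ∀ x, χ.type.box (box x) = φ.type.box x
  box_bijective : Function.Bijective box
  inputs_eq : χ.inputs = φ.inputs.map wire
  outputs_eq : χ.outputs = φ.outputs.map wire

namespace Cover

variable {φ χ : StringDiagram S a b} (m : Cover φ χ)
include m

theorem mem_tgt {A : φ.G.Wire} {x : φ.G.Box} (h : A ∈ φ.G.tgt x) :
    m.wire A ∈ χ.G.tgt (m.box x) := by
  rw [m.tgt_box]; exact List.mem_map_of_mem h

theorem mem_inputs {A : φ.G.Wire} (h : A ∈ φ.inputs) : m.wire A ∈ χ.inputs := by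
  rw [m.inputs_eq]; exact List.mem_map_of_mem h

/-- By left monogamy a wire is the same as a place among the global inputs or among the outputs of a
box, and these places correspond on both sides. -/
theorem wire_bijective : Function.Bijective m.wire := by
  constructor
  · intro A B h
    obtain hA | ⟨x, hA⟩ := φ.mem_inputs_or_tgt A <;> obtain hB | ⟨y, hB⟩ := φ.mem_inputs_or_tgt B
    · exact List.inj_on_of_nodup_map (m.inputs_eq ▸ χ.inputs_nodup) hA hB h
    · exact absurd (h ▸ m.mem_tgt hB) (χ.not_mem_tgt_of_mem_inputs (m.mem_inputs hA) _)
    · exact absurd (h ▸ m.mem_tgt hA) (χ.not_mem_tgt_of_mem_inputs (m.mem_inputs hB) _)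
    · have hxy : x = y :=
        m.box_bijective.1 (χ.tgt_unique (m.mem_tgt hA) (h ▸ m.mem_tgt hB))
      subst hxy
      exact List.inj_on_of_nodup_map (m.tgt_box x ▸ χ.tgt_nodup _) hA hB h
  · intro A
    obtain hA | ⟨x, hA⟩ := χ.mem_inputs_or_tgt A
    · rw [m.inputs_eq] at hA
      obtain ⟨B, _, h⟩ := List.mem_map.1 hA
      exact ⟨B, h⟩
    · obtain ⟨y, rfl⟩ := m.box_bijective.2 x
      rw [m.tgt_box] at hA
      obtain ⟨B, _, h⟩ := List.mem_map.1 hA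
      exact ⟨B, h⟩

theorem iso : φ.Iso χ :=
  ⟨.ofBijective _ m.wire_bijective, .ofBijective _ m.box_bijective, m.src_box, m.tgt_box,
    m.type_wire, m.type_box, m.inputs_eq, m.outputs_eq⟩

/-- Induction on being discarded: once no successor is discarded, the box itself would be eliminable
in `χ`. -/
theorem not_discarded (h : χ.Normalized) (x : φ.G.Box) : ¬ φ.Discarded x := by
  intro hx
  induction hx with
  | intro x h1 h2 ih =>
    refine h (m.box x) fun A hA => ?_
    rw [m.tgt_box] at hA
    obtain ⟨B, hB, rfl⟩ := List.mem_map.1 hA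
    refine ⟨fun h3 => ?_, fun y h3 => ?_⟩
    · rw [m.outputs_eq, List.mem_map_of_injective m.wire_bijective.1] at h3
      exact h1 B hB h3
    · obtain ⟨z, rfl⟩ := m.box_bijective.2 y
      rw [m.src_box, List.mem_map_of_injective m.wire_bijective.1] at h3
      exact ih B hB z h3

/-- The restriction to the normalization. -/
def restrictNorm (h : χ.Normalized) : Cover φ.norm χ where
  wire A := m.wire A.1
  box x := m.box x.1
  src_box x := by
    rw [m.src_box]
    conv_lhs => rw [← List.attachWith_map_subtype_val (φ.remains_src x.2)]
    exact List.map_map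
  tgt_box x := by
    rw [m.tgt_box]
    conv_lhs => rw [← List.attachWith_map_subtype_val (φ.remains_tgt x.2)]
    exact List.map_map
  type_wire A := m.type_wire A.1
  type_box x := m.type_box x.1
  box_bijective := ⟨fun _ _ h => Subtype.ext (m.box_bijective.1 h), fun x => by
    obtain ⟨y, rfl⟩ := m.box_bijective.2 x
    exact ⟨⟨y, m.not_discarded h y⟩, rfl⟩⟩
  inputs_eq := by
    rw [m.inputs_eq]
    conv_lhs => rw [← List.attachWith_map_subtype_val φ.remains_inputs]
    exact List.map_map
  outputs_eq := by
    rw [m.outputs_eq]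
    conv_lhs => rw [← List.attachWith_map_subtype_val φ.remains_outputs]
    exact List.map_map

end Cover

/-! ### Decomposition of diagrams into parts -/

/-- A morphism of the hypergraphs underlying two string diagrams. -/
structure Part (φ : StringDiagram S a b) (χ : StringDiagram S c d) where
  wire : φ.G.Wire → χ.G.Wire
  box : φ.G.Box → χ.G.Box
  src_box : ∀ x, χ.G.src (box x) = (φ.G.src x).map wire
  tgt_box : ∀ x, χ.G.tgt (box x) = (φ.G.tgt x).map wire
  type_wire : ∀ A, χ.type.wire (wire A) = φ.type.wire A
  type_box : ∀ x, χ.type.box (box x) = φ.type.box x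

/-- Parts that do not have any boxes. -/
def Part.ofIsEmpty {φ : StringDiagram S a b} {χ : StringDiagram S c d} (h : φ.G.Box → False)
    (f : φ.G.Wire → χ.G.Wire) (hf : ∀ A, χ.type.wire (f A) = φ.type.wire A) : Part φ χ where
  wire := f
  box x := (h x).elim
  src_box x := (h x).elim
  tgt_box x := (h x).elim
  type_wire := hf
  type_box x := (h x).elim

/-- The part of a tensor product of parts. -/
def Part.tensor {a' b' : List S.Wire} {φ : StringDiagram S a b} {ψ : StringDiagram S a' b'}
    {χ : StringDiagram S c d} (m : Part φ χ) (m' : Part ψ χ) : Part (φ.tensor ψ) χ where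
  wire := Sum.elim m.wire m'.wire
  box := Sum.elim m.box m'.box
  src_box := by
    rintro (x | x)
    · exact (m.src_box x).trans (map_elim_inl m.wire _ (φ.G.src x)).symm
    · exact (m'.src_box x).trans (map_elim_inr _ m'.wire (ψ.G.src x)).symm
  tgt_box := by
    rintro (x | x)
    · exact (m.tgt_box x).trans (map_elim_inl m.wire _ (φ.G.tgt x)).symm
    · exact (m'.tgt_box x).trans (map_elim_inr _ m'.wire (ψ.G.tgt x)).symm
  type_wire := by
    rintro (x | x)
    · exact m.type_wire x
    · exact m'.type_wire x
  type_box := by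
    rintro (x | x)
    · exact m.type_box x
    · exact m'.type_box x

/-- A string diagram that is covered by two parts is their composite. -/
def compCover {φ : StringDiagram S a b} {ψ : StringDiagram S b c} {χ : StringDiagram S a c}
    (m : Part φ χ) (m' : Part ψ χ) (hi : χ.inputs = φ.inputs.map m.wire)
    (ho : χ.outputs = ψ.outputs.map m'.wire) (hg : ψ.inputs.map m'.wire = φ.outputs.map m.wire)
    (hb : Function.Bijective (Sum.elim m.box m'.box)) : Cover (φ.comp ψ) χ := by
  -- The two maps agree on the glued wires by `hg`, hence descend to the composite.
  have hglue : ∀ A, Sum.elim m.wire (fun B : {A // A ∉ ψ.inputs} => m'.wire B.1) (glue φ ψ A) =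
      m'.wire A := by
    intro A
    by_cases hA : A ∈ ψ.inputs
    · obtain ⟨i, rfl⟩ := List.get_of_mem hA
      have h1 := glue_inputs φ ψ (i.cast ψ.length_inputs)
      refine (congrArg _ h1).trans ?_
      have h2 : i.1 < (ψ.inputs.map m'.wire).length := by simp
      have h3 := List.getElem_of_eq hg h2
      rw [List.getElem_map, List.getElem_map] at h3
      exact h3.symm
    · rw [glue_not_mem φ ψ hA]
      rfl
  have hmap : ∀ l : List ψ.G.Wire, l.map m'.wire = (l.map (glue φ ψ)).map
      (Sum.elim m.wire fun B : {A // A ∉ ψ.inputs} => m'.wire B.1) := fun l => by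
    rw [List.map_map]
    exact List.map_congr_left fun A _ => (hglue A).symm
  exact
  { wire := Sum.elim m.wire fun B => m'.wire B.1
    box := Sum.elim m.box m'.box
    src_box := by
      rintro (x | x)
      · exact (m.src_box x).trans (map_elim_inl m.wire _ (φ.G.src x)).symm
      · exact (m'.src_box x).trans (hmap _)
    tgt_box := by
      rintro (x | x)
      · exact (m.tgt_box x).trans (map_elim_inl m.wire _ (φ.G.tgt x)).symm
      · exact (m'.tgt_box x).trans (hmap _)
    type_wire := by
      rintro (x | x)
      · exact m.type_wire x
      · exact m'.type_wire x.1
    type_box := by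
      rintro (x | x)
      · exact m.type_box x
      · exact m'.type_box x
    box_bijective := hb
    inputs_eq := hi.trans (map_elim_inl m.wire _ φ.inputs).symm
    outputs_eq := ho.trans (hmap _) }

/-- The diagram with a single box. -/
def gen (s : S.Box) : StringDiagram S (S.src s) (S.tgt s) where
  G :=
    { Wire := Fin (S.src s).length ⊕ Fin (S.tgt s).length
      Box := Unit
      src := fun _ => (List.finRange _).map Sum.inl
      tgt := fun _ => (List.finRange _).map Sum.inr }
  finWire := inferInstanceAs (Finite (Fin (S.src s).length ⊕ Fin (S.tgt s).length))
  fintypeBox := inferInstanceAs (Fintype Unit)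
  type :=
    { wire := Sum.elim (S.src s).get (S.tgt s).get
      box := fun _ => s
      src_box := fun _ => by rw [List.map_map, Sum.elim_comp_inl, map_get_finRange]
      tgt_box := fun _ => by rw [List.map_map, Sum.elim_comp_inr, map_get_finRange] }
  inputs := (List.finRange _).map Sum.inl
  outputs := (List.finRange _).map Sum.inr
  inputs_type := by rw [List.map_map, Sum.elim_comp_inl, map_get_finRange]
  outputs_type := by rw [List.map_map, Sum.elim_comp_inr, map_get_finRange]
  acyclic := by
    intro A hA
    obtain ⟨B, ⟨_, h1, h2⟩, _⟩ := Relation.TransGen.head'_iff.1 hA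
    obtain ⟨_, ⟨_, h3, h4⟩⟩ := Relation.TransGen.tail'_iff.1 hA
    obtain ⟨i, _, rfl⟩ := List.mem_map.1 h1
    obtain ⟨j, _, h⟩ := List.mem_map.1 h4.2
    exact Sum.inr_ne_inl h
  leftMonogamous := by
    refine fun A => (congrArg₂ (· + ·) rfl (Fintype.sum_unique _)).trans ?_
    obtain A | A := A
    · rw [occ_map Sum.inl_injective, occ_map_of_ne _ (fun _ => Sum.inr_ne_inl),
        occ_eq_one (List.nodup_finRange _) (List.mem_finRange A)]
    · rw [occ_map Sum.inr_injective, occ_map_of_ne _ (fun _ => Sum.inl_ne_inr),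
        occ_eq_one (List.nodup_finRange _) (List.mem_finRange A)]

theorem gen_normalized {s : S.Box} (hs : S.tgt s ≠ []) : (gen s).Normalized := by
  intro x hx
  have hi : Sum.inr ⟨0, List.length_pos_iff.2 hs⟩ ∈ (gen s).outputs :=
    List.mem_map_of_mem (List.mem_finRange _)
  exact (hx _ hi).1 hi

/-- Exchange the global outputs. -/
def withOutputs (χ : StringDiagram S a b) (o : List χ.G.Wire) (h : o.map χ.type.wire = c) :
    StringDiagram S a c :=
  { χ with outputs := o, outputs_type := h }

theorem get_map_cast {α β : Type*} (t : α → β) (l : List α) (i : Fin (l.map t).length) :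
    t (l.get (i.cast (List.length_map _))) = (l.map t).get i := by simp

theorem map_get_cast {α β γ : Type*} (t : α → β) (f : α → γ) (l : List α) :
    (List.finRange (l.map t).length).map (fun i => f (l.get (i.cast (List.length_map _)))) =
      l.map f :=
  List.ext_getElem (by simp) fun i h1 h2 => by simp

section Remove

variable (χ : StringDiagram S a b) (x : χ.G.Box) (hx : ∀ A ∈ χ.G.tgt x, ∀ y, A ∉ χ.G.src y)

/-- Remove a box none of whose outputs is an input of a box, and its outputs. -/
def removeBox (o : List {A : χ.G.Wire // A ∉ χ.G.tgt x})
    (ho : o.map (fun A => χ.type.wire A.1) = c) : StringDiagram S a c where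
  G :=
    { Wire := {A : χ.G.Wire // A ∉ χ.G.tgt x}
      Box := {y : χ.G.Box // y ≠ x}
      src y := (χ.G.src y.1).attachWith _ fun A hA hA' => hx A hA' _ hA
      tgt y := (χ.G.tgt y.1).attachWith _ fun _ hA hA' => y.2 (χ.tgt_unique hA hA') }
  finWire := inferInstanceAs (Finite {A : χ.G.Wire // A ∉ χ.G.tgt x})
  fintypeBox := by classical exact inferInstanceAs (Fintype {y : χ.G.Box // y ≠ x})
  type :=
    { wire := fun A => χ.type.wire A.1
      box := fun y => χ.type.box y.1
      src_box := fun y => by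
        rw [χ.type.src_box]
        conv_lhs => rw [← List.attachWith_map_subtype_val (p := fun A => A ∉ χ.G.tgt x)
          (l := χ.G.src y.1) fun A hA hA' => hx A hA' _ hA]
        exact List.map_map
      tgt_box := fun y => by
        rw [χ.type.tgt_box]
        conv_lhs => rw [← List.attachWith_map_subtype_val (p := fun A => A ∉ χ.G.tgt x)
          (l := χ.G.tgt y.1) fun _ hA hA' => y.2 (χ.tgt_unique hA hA')]
        exact List.map_map }
  inputs := χ.inputs.attachWith _ fun _ hA => χ.not_mem_tgt_of_mem_inputs hA x
  outputs := o
  inputs_type := by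
    conv_rhs => rw [← χ.inputs_type, ← List.attachWith_map_subtype_val
      (p := fun A => A ∉ χ.G.tgt x) (l := χ.inputs)
      fun _ hA => χ.not_mem_tgt_of_mem_inputs hA x]
    rw [List.map_map]; rfl
  outputs_type := ho
  acyclic := by
    intro A hA
    refine χ.acyclic A.1 (hA.lift (p := χ.G.Edge) Subtype.val ?_)
    rintro B B' ⟨y, h1, h2⟩
    exact ⟨y.1, (List.mem_attachWith _ _).1 h1, (List.mem_attachWith _ _).1 h2⟩
  leftMonogamous := by
    classical
    intro A
    rw [← χ.leftMonogamous A.1]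
    refine congrArg₂ (· + ·) (occ_attachWith _ _ _ A) ?_
    refine (Finset.sum_congr rfl fun y _ => occ_attachWith _ _ _ A).trans
      (sum_subtype_eq (P := fun y => y ≠ x) (fun y => occ (χ.G.tgt y) A.1)
        fun y hy => occ_eq_zero.2 fun hA => A.2 (not_not.1 hy ▸ hA))

/-- The rest of a diagram as a part of it. -/
def removeBoxPart (o : List {A : χ.G.Wire // A ∉ χ.G.tgt x})
    (ho : o.map (fun A => χ.type.wire A.1) = c) (o' : List χ.G.Wire)
    (ho' : o'.map χ.type.wire = d) : Part (χ.removeBox x hx o ho) (χ.withOutputs o' ho') where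
  wire := Subtype.val
  box := Subtype.val
  src_box _ := (List.attachWith_map_subtype_val _).symm
  tgt_box _ := (List.attachWith_map_subtype_val _).symm
  type_wire _ := rfl
  type_box _ := rfl

end Remove

/-- A box of a string diagram as a part of it. -/
def genPart (χ : StringDiagram S a b) (x : χ.G.Box) : Part (gen (χ.type.box x)) χ where
  wire := Sum.elim (fun i => (χ.G.src x).get (i.cast (by rw [χ.type.src_box, List.length_map])))
    (fun i => (χ.G.tgt x).get (i.cast (by rw [χ.type.tgt_box, List.length_map])))
  box _ := x
  src_box := by
    intro _
    refine Eq.trans ?_ (map_elim_inl _ _ _).symm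
    refine List.ext_getElem (by simp [χ.type.src_box]) fun i h1 h2 => by simp
  tgt_box := by
    intro _
    refine Eq.trans ?_ (map_elim_inr _ _ _).symm
    refine List.ext_getElem (by simp [χ.type.tgt_box]) fun i h1 h2 => by simp
  type_wire := by
    rintro (i | i)
    · simp [gen, χ.type.src_box]
    · simp [gen, χ.type.tgt_box]
  type_box _ := rfl

theorem map_inWire (χ : StringDiagram S a b) :
    (List.finRange a.length).map χ.inWire = χ.inputs :=
  List.ext_getElem (by simp [length_inputs]) fun i h1 h2 => by simp [inWire]

theorem Normalized.tgt_ne_nil {χ : StringDiagram S a b} (h : χ.Normalized) (x : χ.G.Box) :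
    χ.G.tgt x ≠ [] := fun h' => h x fun A hA => by
  rw [h'] at hA; exact absurd hA List.not_mem_nil

/-! ### Induction over normalized diagrams -/

/-- An induction principle for the normalized string diagrams. -/
theorem gen_induction {P : ∀ {a b : List S.Wire}, FreeMarkovHom S a b → Prop}
    (iso : ∀ {a b : List S.Wire} (φ ψ : FreeMarkovHom S a b), φ.1.Iso ψ.1 → P φ → P ψ)
    (ident : ∀ a, P (FreeMarkovHom.ident (S := S) a))
    (comp : ∀ {a b c : List S.Wire} (φ : FreeMarkovHom S a b) (ψ : FreeMarkovHom S b c),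
      P φ → P ψ → P (φ.comp ψ))
    (tensor : ∀ {a b c d : List S.Wire} (φ : FreeMarkovHom S a b) (ψ : FreeMarkovHom S c d),
      P φ → P ψ → P (φ.tensor ψ))
    (copy : ∀ a, P (FreeMarkovHom.copy (S := S) a))
    (del : ∀ a, P (FreeMarkovHom.del (S := S) a))
    (gen : ∀ (s : S.Box) (hs : S.tgt s ≠ []), P ⟨gen s, gen_normalized hs⟩)
    (φ : FreeMarkovHom S a b) : P φ := by
  have cover : ∀ {a b : List S.Wire} {φ ψ : StringDiagram S a b} (hφ : φ.Normalized)
      (hψ : ψ.Normalized), Cover φ ψ → P ⟨φ, hφ⟩ → P ⟨ψ, hψ⟩ :=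
    fun hφ hψ m h => iso ⟨_, hφ⟩ ⟨_, hψ⟩ m.iso h
  have compCover : ∀ {a b c : List S.Wire} {φ : StringDiagram S a b} {ψ : StringDiagram S b c}
      {χ : StringDiagram S a c} (hφ : φ.Normalized) (hψ : ψ.Normalized) (hχ : χ.Normalized)
      (m : Part φ χ) (m' : Part ψ χ) (_ : χ.inputs = φ.inputs.map m.wire)
      (_ : χ.outputs = ψ.outputs.map m'.wire) (_ : ψ.inputs.map m'.wire = φ.outputs.map m.wire)
      (_ : Function.Bijective (Sum.elim m.box m'.box)), P ⟨φ, hφ⟩ → P ⟨ψ, hψ⟩ → P ⟨χ, hχ⟩ :=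
    fun hφ hψ hχ m m' h1 h2 h3 h4 h h' => cover (norm_normalized _) hχ
      ((StringDiagram.compCover m m' h1 h2 h3 h4).restrictNorm hχ) (comp ⟨_, hφ⟩ ⟨_, hψ⟩ h h')
  have bij : ∀ {α β γ : Type} (hα : α → False) (hβ : β → False) (hγ : γ → False)
      (f : α → γ) (g : β → γ), Function.Bijective (Sum.elim f g) := fun hα hβ hγ f g =>
    ⟨fun x => by obtain x | x := x; exacts [(hα x).elim, (hβ x).elim], fun x => (hγ x).elim⟩
  -- The inputs are split around the selected wire: discard, keep, discard.
  have single : ∀ {V : Type} [Finite V] (t : V → S.Wire) (l r : List V) (A : V)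
      (h : ∀ x, occ (l ++ A :: r) x = 1) {a : List S.Wire} (ha : (l ++ A :: r).map t = a),
      P ⟨discrete t (l ++ A :: r) [A] h ha rfl, fun x => Empty.elim x⟩ := by
    intro V _ t l r A h a ha
    obtain rfl : l.map t ++ ([t A] ++ r.map t) = a := by simpa using ha
    have hP := tensor (FreeMarkovHom.del (l.map t)) _ (del _)
      (tensor (FreeMarkovHom.ident [t A]) (FreeMarkovHom.del (r.map t)) (ident _) (del _))
    refine cover _ _ ?_ hP
    let χ := discrete t (l ++ A :: r) [A] h ha rfl
    let m₁ : Part (StringDiagram.del (l.map t)) χ :=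
      Part.ofIsEmpty Empty.elim (fun i : Fin _ => l.get (i.cast (List.length_map _)))
        (get_map_cast t l)
    let m₂ : Part (StringDiagram.ident [t A]) χ :=
      Part.ofIsEmpty Empty.elim (fun i : Fin _ => [A].get i) (get_map_cast t [A])
    let m₃ : Part (StringDiagram.del (r.map t)) χ :=
      Part.ofIsEmpty Empty.elim (fun i : Fin _ => r.get (i.cast (List.length_map _)))
        (get_map_cast t r)
    have hl : ∀ l : List V, l = (List.finRange (l.map t).length).map
        (fun i => l.get (i.cast (List.length_map _))) := fun l =>
      (List.map_id l).symm.trans (map_get_cast t id l).symm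
    exact
    { m₁.tensor (m₂.tensor m₃) with
      box_bijective := bij Empty.elim (Sum.elim Empty.elim Empty.elim) Empty.elim m₁.box _
      inputs_eq := by
        refine Eq.trans ?_ (List.map_append).symm
        refine congrArg₂ (· ++ ·) ((hl l).trans (map_elim_inl _ _ _).symm)
          (Eq.trans ?_ (map_elim_inr _ _ _).symm)
        refine Eq.trans ?_ (List.map_append).symm
        exact congrArg₂ (· ++ ·) ((hl [A]).trans (map_elim_inl _ _ _).symm)
          ((hl r).trans (map_elim_inr _ _ _).symm)
      outputs_eq := rfl }
  -- All inputs are copied; the head of the output list is read from one copy and the remaining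
  -- outputs from the other. Permutations arise in this way as well, so no clause for swaps is
  -- required.
  have boxless : ∀ {V : Type} [Finite V] (t : V → S.Wire) (i o : List V)
      (h : ∀ x, occ i x = 1) {a b : List S.Wire} (ha : i.map t = a) (hb : o.map t = b),
      P ⟨discrete t i o h ha hb, fun x => Empty.elim x⟩ := by
    intro V _ t i o h a b ha
    induction o generalizing b with
    | nil =>
      rintro rfl
      let χ := discrete t i [] h ha rfl
      refine cover _ _ ?_ (del a)
      exact
      { Part.ofIsEmpty (φ := StringDiagram.del a) (χ := χ) Empty.elim χ.inWire χ.type_inWire with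
        box_bijective := ⟨fun x => Empty.elim x, fun x => Empty.elim x⟩
        inputs_eq := χ.map_inWire.symm
        outputs_eq := rfl }
    | cons A o ih =>
      rintro rfl
      let χ := discrete t i (A :: o) h ha rfl
      obtain ⟨l, r, hlr⟩ := List.append_of_mem (occ_pos.1 ((h A).symm ▸ Nat.one_pos))
      have h1 : P ⟨discrete t i [A] h ha rfl, fun x => Empty.elim x⟩ := by
        subst hlr
        exact single t l r A h ha
      let m₀ : Part (StringDiagram.copy a) χ := Part.ofIsEmpty Empty.elim χ.inWire χ.type_inWire
      let m₁ : Part (discrete t i [A] h ha rfl) χ := Part.ofIsEmpty Empty.elim id fun _ => rfl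
      let m₂ : Part (discrete t i o h ha rfl) χ := Part.ofIsEmpty Empty.elim id fun _ => rfl
      refine compCover (fun x => Empty.elim x) (tensor_normalized (fun x => Empty.elim x)
        fun x => Empty.elim x) (fun x => Empty.elim x) m₀ (m₁.tensor m₂)
        χ.map_inWire.symm ?_ ?_ (bij Empty.elim (Sum.elim Empty.elim Empty.elim) Empty.elim _ _)
        (copy a) (tensor ⟨_, _⟩ ⟨_, _⟩ h1 (ih rfl))
      · exact (congrArg (A :: ·) ((map_elim_inr _ _ _).trans (List.map_id _)).symm)
      · refine List.map_append.trans (Eq.trans ?_ List.map_append.symm)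
        exact congrArg₂ (· ++ ·) ((map_elim_inl _ _ _).trans ((List.map_id _).trans
          χ.map_inWire.symm)) ((map_elim_inr _ _ _).trans ((List.map_id _).trans
          χ.map_inWire.symm))
  -- Induction on the number of boxes: the last box `x` is split off, and `χ` becomes the rest,
  -- followed by `x` beside identities, followed by a boxless diagram that selects the outputs.
  have main : ∀ (n : ℕ) {a b : List S.Wire} (χ : StringDiagram S a b) (h : χ.Normalized),
      Nat.card χ.G.Box = n → P ⟨χ, h⟩ := by
    intro n
    induction n using Nat.strong_induction_on with
    | _ n ih =>
    intro a b χ h hn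
    obtain ⟨L, hL, hmem⟩ := χ.exists_topo_full
    obtain - | ⟨x, L⟩ := L
    · have he : χ.G.Box → False := fun x => absurd (hmem x) List.not_mem_nil
      have hi : ∀ A, occ χ.inputs A = 1 := fun A => occ_eq_one χ.inputs_nodup
        ((χ.mem_inputs_or_tgt A).resolve_right fun ⟨x, _⟩ => he x)
      exact cover _ _
        { Part.ofIsEmpty (φ := discrete χ.type.wire χ.inputs χ.outputs hi χ.inputs_type
            χ.outputs_type) (χ := χ) Empty.elim id fun _ => rfl with
          box_bijective := ⟨fun x => Empty.elim x, fun x => (he x).elim⟩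
          inputs_eq := (List.map_id _).symm
          outputs_eq := (List.map_id _).symm }
        (boxless χ.type.wire χ.inputs χ.outputs hi χ.inputs_type χ.outputs_type)
    have hx : ∀ A ∈ χ.G.tgt x, ∀ y, A ∉ χ.G.src y := by
      intro A hA y hy
      obtain rfl | hyL := List.mem_cons.1 (hmem y)
      · exact χ.not_mem_tgt_of_mem_wiresOf (hL.src_subset_cons hy) hL.not_mem hA
      · exact χ.not_mem_tgt_of_mem_wiresOf (hL.of_cons.src_subset y hyL hy) hL.not_mem hA
    let _ : Fintype {A : χ.G.Wire // A ∉ χ.G.tgt x} := Fintype.ofFinite _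
    let w : List {A : χ.G.Wire // A ∉ χ.G.tgt x} := Finset.univ.toList
    have hw : ∀ A, A ∈ w := fun A => Finset.mem_toList.2 (Finset.mem_univ A)
    -- The outputs of the rest: the inputs of `x`, to be fed into it, and one more copy of every
    -- remaining wire.
    let o : List {A : χ.G.Wire // A ∉ χ.G.tgt x} :=
      (χ.G.src x).attachWith _ (fun A hA hA' => hx A hA' _ hA) ++ w
    let t := w.map fun A => χ.type.wire A.1
    have ho : o.map (fun A => χ.type.wire A.1) = S.src (χ.type.box x) ++ t := by
      rw [List.map_append, χ.type.src_box]
      conv_rhs => rw [← List.attachWith_map_subtype_val (p := fun A => A ∉ χ.G.tgt x)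
        (l := χ.G.src x) fun A hA hA' => hx A hA' _ hA]
      rw [List.map_map]; rfl
    let o' : List χ.G.Wire := χ.G.tgt x ++ w.map Subtype.val
    have ho' : o'.map χ.type.wire = S.tgt (χ.type.box x) ++ t := by
      rw [List.map_append, χ.type.tgt_box, List.map_map]; rfl
    have hmem' : ∀ A, A ∈ o' := fun A => by
      by_cases hA : A ∈ χ.G.tgt x
      · exact List.mem_append_left _ hA
      · exact List.mem_append_right _ (List.mem_map.2 ⟨⟨A, hA⟩, hw _, rfl⟩)
    have hnodup : o'.Nodup := List.nodup_append'.2 ⟨χ.tgt_nodup x,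
      (Finset.nodup_toList _).map Subtype.val_injective, fun A hA hA' => by
        obtain ⟨B, _, rfl⟩ := List.mem_map.1 hA'
        exact B.2 hA⟩
    -- With every wire an output, only a box without outputs could be eliminable, and `χ` has none.
    have h1 : (χ.removeBox x hx o ho).Normalized := by
      intro y hy
      obtain ⟨A, hA⟩ := List.exists_mem_of_ne_nil _ (h.tgt_ne_nil y.1)
      exact (hy ⟨A, fun hA' => y.2 (χ.tgt_unique hA hA')⟩ ((List.mem_attachWith _ _).2 hA)).1
        (List.mem_append_right _ (hw _))
    have h2 : (χ.withOutputs o' ho').Normalized := by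
      intro y hy
      obtain ⟨A, hA⟩ := List.exists_mem_of_ne_nil _ (h.tgt_ne_nil y)
      exact (hy A hA).1 (hmem' A)
    have hs : S.tgt (χ.type.box x) ≠ [] := by
      rw [χ.type.tgt_box]
      exact fun h' => h.tgt_ne_nil x (List.map_eq_nil_iff.1 h')
    have hP1 : P ⟨_, h1⟩ := ih _ (hn ▸ Finite.card_subtype_lt (x := x) (fun h => h rfl)) _ _ rfl
    have hP2 : P ⟨_, h2⟩ := by
      have hget : ∀ i : Fin t.length, χ.type.wire (w.get (i.cast (List.length_map _))).1 = t.get i :=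
        get_map_cast _ w
      let m : Part (StringDiagram.ident t) (χ.withOutputs o' ho') :=
        Part.ofIsEmpty Empty.elim (fun i : Fin _ => (w.get (i.cast (List.length_map _))).1) hget
      let m' := genPart (χ.withOutputs o' ho') x
      have hm : (StringDiagram.ident t).inputs.map m.wire = w.map Subtype.val :=
        map_get_cast _ Subtype.val w
      have hm' : (StringDiagram.gen (χ.type.box x)).inputs.map m'.wire = χ.G.src x :=
        (m'.src_box ()).symm
      have hm'' : (StringDiagram.gen (χ.type.box x)).outputs.map m'.wire = χ.G.tgt x :=
        (m'.tgt_box ()).symm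
      refine compCover h1 (tensor_normalized (gen_normalized hs) fun x => Empty.elim x) h2
        (χ.removeBoxPart x hx o ho o' ho') (m'.tensor m)
        (List.attachWith_map_subtype_val _).symm ?_ ?_ ?_ hP1
        (tensor ⟨_, _⟩ (FreeMarkovHom.ident t) (gen _ hs) (ident t))
      · refine Eq.trans ?_ List.map_append.symm
        exact congrArg₂ (· ++ ·) (hm''.symm.trans (map_elim_inl _ _ _).symm)
          (hm.symm.trans (map_elim_inr _ _ _).symm)
      · refine List.map_append.trans (Eq.trans ?_ List.map_append.symm)
        exact congrArg₂ (· ++ ·) ((map_elim_inl _ _ _).trans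
          (hm'.trans (List.attachWith_map_subtype_val _).symm)) ((map_elim_inr _ _ _).trans hm)
      · refine ⟨?_, fun y => ?_⟩
        · rintro (⟨y, hy⟩ | y | y) (⟨z, hz⟩ | z | z) h
          · exact congrArg Sum.inl (Subtype.ext h)
          · exact absurd h hy
          · exact Empty.elim z
          · exact absurd h.symm hz
          · rfl
          · exact Empty.elim z
          all_goals exact Empty.elim y
        · by_cases hy : y = x
          · exact ⟨.inr (.inl ()), hy.symm⟩
          · exact ⟨.inl ⟨y, hy⟩, rfl⟩
    -- Each wire occurs once in `o'`, so `o'` can serve as the input list of the final boxless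
    -- diagram.
    have hi : ∀ A, occ o' A = 1 := fun A => occ_eq_one hnodup (hmem' A)
    exact compCover h2 _ h
      { wire := id
        box := id
        src_box := fun _ => (List.map_id _).symm
        tgt_box := fun _ => (List.map_id _).symm
        type_wire := fun _ => rfl
        type_box := fun _ => rfl }
      (Part.ofIsEmpty Empty.elim id fun _ => rfl) (List.map_id _).symm (List.map_id _).symm rfl
      ⟨by rintro (x | x) (y | y) h; exacts [congrArg _ h, Empty.elim y, Empty.elim x, Empty.elim x],
        fun x => ⟨.inl x, rfl⟩⟩ hP2
      (boxless χ.type.wire o' χ.outputs hi ho' χ.outputs_type)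
  exact main _ φ.1 φ.2 rfl

end StringDiagram

/-! ### Strict Markov functors are determined by their values on boxes -/

namespace StringDiagram

open Markov

variable {S : DiHypergraph.{w}} {a b c d : List S.Wire}
variable {C : Type u} [Category.{v} C] [MonoidalCategory C] [MarkovCategory C]

theorem evalMap_gen {T : S.Wire → C} (κ : ∀ s : S.Box, ten T (S.src s) ⟶ ten T (S.tgt s))
    (s : S.Box) : evalMap κ (gen s) = κ s := by
  have h := (joint_generatedBy κ (gen s) () trivial (subset_allWires _ _) _
    (subset_allWires _ (gen s).inputs) (List.Subset.refl _)
    (fun A hA => not_mem_dec_of_mem_inputs _ hA _)).marginal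
  rw [← Category.assoc, joint_sel_inputs, Category.id_comp] at h
  have h1 : sel ((gen s).val T) (gen s).inputs ((gen s).G.src ()) (List.Subset.refl _) = 𝟙 _ :=
    sel_self (gen s).inputs_nodup _
  have h2 : evalMap κ (gen s) = eqToHom (ten_val (gen s).inputs_type) ≫
      (joint κ (gen s) ≫ sel _ _ (gen s).outputs (subset_allWires _ _)) ≫
        eqToHom (ten_val (gen s).outputs_type).symm := by
    rw [evalMap, Category.assoc]
  have h3 : joint κ (gen s) ≫ sel _ _ (gen s).outputs (subset_allWires _ _) =
      eqToHom (ten_val (gen s).inputs_type).symm ≫ κ s ≫ eqToHom (ten_val (gen s).outputs_type) :=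
    h.trans ((congrArg (· ≫ _) h1).trans (Category.id_comp _))
  refine (h2.trans (congrArg (fun f => eqToHom (ten_val (gen s).inputs_type) ≫ f ≫
    eqToHom (ten_val (gen s).outputs_type).symm) h3)).trans ?_
  simp

theorem obj_eq_ten (F : FreeMarkovFunctor S C) : ∀ a : List S.Wire,
    F.obj a = ten (fun x => F.obj [x]) a
  | [] => F.obj_nil
  | x :: l => (F.obj_append [x] l).trans (congrArg (F.obj [x] ⊗ ·) (obj_eq_ten F l))

/-- Both sides respect isomorphism, composition, tensor products, copying and discarding, and agree
on single boxes by the choice of `κ`; `gen_induction` does the rest. -/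
theorem exists_map_eq_evalMap (hs : IsStrictMonoidal C) (F : FreeMarkovFunctor S C) :
    ∃ κ : ∀ s : S.Box, ten (fun x => F.obj [x]) (S.src s) ⟶ ten (fun x => F.obj [x]) (S.tgt s),
      ∀ {a b : List S.Wire} (φ : FreeMarkovHom S a b), F.map φ =
        eqToHom (obj_eq_ten F a) ≫ evalMap κ φ.1 ≫ eqToHom (obj_eq_ten F b).symm := by
  classical
  let T := fun x => F.obj [x]
  -- A type of boxes without outputs occurs in no normalized diagram, so `F` has no value on it. The
  -- target is then the unit, and discarding is the only morphism.
  let κ : ∀ s : S.Box, ten T (S.src s) ⟶ ten T (S.tgt s) := fun s =>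
    if h : S.tgt s ≠ [] then
      eqToHom (obj_eq_ten F _).symm ≫ F.map ⟨gen s, gen_normalized h⟩ ≫ eqToHom (obj_eq_ten F _)
    else ε[_] ≫ eqToHom (by rw [not_not.1 h]; rfl)
  refine ⟨κ, fun {a b} φ => gen_induction (P := fun {a b} φ => F.map φ =
    eqToHom (obj_eq_ten F a) ≫ evalMap κ φ.1 ≫ eqToHom (obj_eq_ten F b).symm)
    ?_ ?_ ?_ ?_ ?_ ?_ ?_ φ⟩
  · intro a b φ ψ h hφ
    rw [← F.map_iso _ _ h, hφ, evalMap_iso κ h]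
  · intro a
    have h : evalMap κ (FreeMarkovHom.ident a).1 = 𝟙 _ := evalMap_ident κ a
    rw [F.map_ident, h]
    exact ((congrArg (eqToHom _ ≫ ·) (Category.id_comp _)).trans
      ((eqToHom_trans _ _).trans (eqToHom_refl _ _))).symm
  · intro a b c φ ψ hφ hψ
    have h : evalMap κ (φ.comp ψ).1 = _ := (evalMap_norm κ _).trans (evalMap_comp κ φ.1 ψ.1)
    rw [F.map_comp, hφ, hψ, h]
    simp
  · intro a b c d φ ψ hφ hψ
    have h : evalMap κ (φ.tensor ψ).1 = _ := evalMap_tensor κ hs φ.1 ψ.1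
    rw [F.map_tensor, hφ, hψ, h]
    simp only [← tensorHom_comp_tensorHom, tensorHom_eqToHom, Category.assoc, eqToHom_trans,
      eqToHom_trans_assoc]
  · intro a
    have h : evalMap κ (FreeMarkovHom.copy a).1 = _ := evalMap_copy κ hs a
    have h1 := eqToHom_copy (obj_eq_ten F a)
    rw [F.map_copy, h, ← Category.assoc, ← Category.assoc, h1]
    simp
  · intro a
    rw [← cancel_mono (eqToHom F.obj_nil)]
    exact (MarkovCategory.eq_discard _ _).trans (MarkovCategory.eq_discard _ _).symm
  · intro s h
    have h1 : evalMap κ (gen s) = κ s := evalMap_gen κ s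
    have h2 : κ s = _ := dif_pos h
    rw [h1, h2]
    simp

end StringDiagram

/-! ### Conditional independence -/

namespace Markov

section

variable {C : Type u} [Category.{v} C] [MonoidalCategory C] [MarkovCategory C]

theorem Gen.of_eq {A P Y R : C} {p : A ⟶ P} {y : P ⟶ Y} {r : P ⟶ R} {k : R ⟶ Y} [Det r]
    (h : y = r ≫ k) : Gen p y r k := by
  rw [Gen, comp_copyPair r, ← h, Category.comp_id]

/-- The auxiliary morphism `g` is forced: dropping the `X`-component on both sides identifies it
with the marginal of `f` on `Z` and `Y`. -/
theorem condIndep_iff_gen {A : C} {n : ℕ} (V : Fin n → C) (f : A ⟶ tensorFin V)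
    (X Y Z : Finset (Fin n)) : CondIndep V f X Y Z ↔
      ∃ h, Gen f (marg V X) (copyPair (marg V Z) (marg V Y)) (fst _ _ ≫ h) := by
  refine ⟨fun ⟨g, h, H⟩ => ⟨h, ?_⟩, fun ⟨h, H⟩ => ⟨f ≫ copyPair (marg V Z) (marg V Y), h, ?_⟩⟩
  · rw [copyPair_id_whiskerRight] at H
    have h1 := congrArg (· ≫ snd _ _) H
    simp only [Category.assoc, copyPair_snd, Category.comp_id] at h1
    rw [Gen, ← Category.assoc f, h1, H]
  · rw [copyPair_id_whiskerRight, Category.assoc]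
    exact H

variable {Ω : Type} {V : Ω → C} {P : C} {l : List Ω} {p : P ⟶ ten V l}

/-- Under `p`, the variables in `X` are generated from those in `Z`, independently of those
in `R`. -/
def Indep (p : P ⟶ ten V l) (X R Z : List Ω) : Prop :=
  ∃ (hX : X ⊆ l) (hR : R ⊆ l) (hZ : Z ⊆ R) (h : ten V Z ⟶ ten V X),
    Gen p (sel V l X hX) (sel V l R hR) (sel V R Z hZ ≫ h)

/-- The conditioning list may grow inside the context at no cost, since the kernel can ignore the
additional wires. -/
theorem Indep.mono {X R Z X' R' Z' : List Ω} (H : Indep p X R Z) (hX : X' ⊆ X) (hR : R' ⊆ R)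
    (hZ : Z ⊆ Z') (hZR : Z' ⊆ R') : Indep p X' R' Z' := by
  obtain ⟨h1, h2, h3, h, H⟩ := H
  refine ⟨List.Subset.trans hX h1, List.Subset.trans hR h2, hZR, sel V Z' Z hZ ≫ h ≫ sel V X X' hX, ?_⟩
  have H1 := H.post (sel V X X' hX)
  rw [sel_sel] at H1
  refine H1.restrict (sel V R R' hR) (sel_sel _ _) ?_
  rw [sel_sel_assoc, sel_sel_assoc, Category.assoc]

theorem Indep.of_nil {R : List Ω} (hR : R ⊆ l) : Indep p [] R [] :=
  ⟨List.nil_subset _, hR, List.nil_subset _, 𝟙 _, .of_eq (fan_nil _ _)⟩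

/-- A new box with outputs `t` that reads only the context `R` joins the context, by `Gen.exchange`.
-/
theorem Indep.add_right {X R Z m t s : List Ω} (H : Indep p X R Z) (hm : m ⊆ l) (ht : t ⊆ l)
    (hs : s ⊆ m) {k : ten V s ⟶ ten V t} (hk : Gen p (sel V l t ht) (sel V l m hm) (sel V m s hs ≫ k))
    (hX : X ⊆ m) (hR : R ⊆ m) (hsR : s ⊆ R) (hZ : ∀ y ∈ Z, y ∉ t) : Indep p X (t ++ R) Z := by
  obtain ⟨h1, h2, h3, h, H⟩ := H
  have H1 := hk.restrict (k' := snd _ _ ≫ sel V R s hsR ≫ k)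
    (copyPair (sel V m X hX) (sel V m R hR)) (comp_copyPair _ _ _) (by
      rw [copyPair_snd_assoc, sel_sel_assoc])
  rw [sel_sel, sel_sel] at H1
  have hZ' : Z ⊆ t ++ R := List.Subset.trans h3 (List.subset_append_right _ _)
  refine ⟨h1, List.append_subset.2 ⟨ht, h2⟩, hZ', h, ?_⟩
  refine (H.exchange H1).restrict (join V t R) (copyPair_join _ _) ?_
  rw [← Category.assoc, join_sel_right h3 hZ, Category.assoc]

/-- A new box that reads only `X` and `Z` extends the generated side: `t` and `X` together are
generated from `Z` by `Gen.chain`. The outputs in `Z'` are then moved into the condition by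
`Gen.cond`; this is where conditionals are needed. -/
theorem Indep.add_left (hC : HasConditionals C) {X R Z m t s X' Z' : List Ω} (H : Indep p X R Z)
    (hm : m ⊆ l) (ht : t ⊆ l) (hs : s ⊆ m) {k : ten V s ⟶ ten V t}
    (hk : Gen p (sel V l t ht) (sel V l m hm) (sel V m s hs ≫ k)) (hX : X ⊆ m) (hR : R ⊆ m)
    (hsX : s ⊆ X ++ Z) (hX' : X' ⊆ t ++ X) (hZ' : Z' ⊆ t) (hn : Z'.Nodup) (hZ : ∀ y ∈ Z, y ∉ Z') :
    Indep p X' (Z' ++ R) (Z' ++ Z) := by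
  obtain ⟨h1, h2, h3, h, H⟩ := H
  have H1 := hk.restrict (k' := (ten V X ◁ sel V R Z h3) ≫ join V X Z ≫ sel V _ s hsX ≫ k)
    (copyPair (sel V m X hX) (sel V m R hR)) (comp_copyPair _ _ _) (by
      rw [← Category.assoc, copyPair_whiskerLeft, sel_sel, ← Category.assoc, copyPair_join,
        sel_sel_assoc])
  rw [sel_sel, sel_sel] at H1
  -- The combined kernel for `t` and `X` reads `R` only through `Z`, the form required by
  -- `Gen.cond`.
  have hK : copyPair (sel V R Z h3 ≫ h) (𝟙 _) ≫ copyPair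
      ((ten V X ◁ sel V R Z h3) ≫ join V X Z ≫ sel V _ s hsX ≫ k) (fst _ _) =
        sel V R Z h3 ≫ copyPair h (𝟙 _) ≫ copyPair (join V X Z ≫ sel V _ s hsX ≫ k) (fst _ _) := by
    have h4 : copyPair ((ten V X ◁ sel V R Z h3) ≫ join V X Z ≫ sel V _ s hsX ≫ k) (fst _ _) =
        (ten V X ◁ sel V R Z h3) ≫ copyPair (join V X Z ≫ sel V _ s hsX ≫ k) (fst _ _) := by
      rw [comp_copyPair, ← id_tensorHom, tensorHom_fst, Category.comp_id]
    rw [h4, ← Category.assoc, copyPair_whiskerLeft, Category.id_comp, ← Category.assoc (sel V R Z h3),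
      comp_copyPair (sel V R Z h3) h, Category.comp_id]
  have H2 := H.chain H1
  rw [hK] at H2
  have hZX : Z' ⊆ t ++ X := List.Subset.trans hZ' (List.subset_append_left _ _)
  -- The generated variables are sorted into those to be conditioned on and those to remain on the
  -- left.
  have H3 := H2.post (join V t X ≫ copyPair (sel V _ Z' hZX) (sel V _ X' hX'))
  rw [← Category.assoc (copyPair (sel V l t ht) _), copyPair_join, comp_copyPair, sel_sel, sel_sel,
    Category.assoc] at H3
  obtain ⟨c, hc⟩ := H3.cond hC
  have h4 : Z' ⊆ Z' ++ R := List.subset_append_left _ _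
  have h5 : Z ⊆ Z' ++ R := List.Subset.trans h3 (List.subset_append_right _ _)
  have h6 : Z' ++ Z ⊆ Z' ++ R := List.append_subset.2 ⟨h4, h5⟩
  refine ⟨List.Subset.trans hX' (List.append_subset.2 ⟨ht, h1⟩),
    List.append_subset.2 ⟨List.Subset.trans hZ' ht, h2⟩, h6,
    copyPair (sel V _ Z' (List.subset_append_left _ _)) (sel V _ Z (List.subset_append_right _ _)) ≫ c,
    hc.restrict (join V Z' R) (copyPair_join _ _) ?_⟩
  have h7 : sel V (Z' ++ R) (Z' ++ Z) h6 ≫ copyPair (sel V _ Z' (List.subset_append_left _ _))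
      (sel V _ Z (List.subset_append_right _ _)) ≫ c = copyPair (sel V _ Z' h4) (sel V _ Z h5) ≫ c := by
    rw [← Category.assoc, comp_copyPair, sel_sel, sel_sel]
  rw [h7, ← Category.assoc, comp_copyPair, join_sel_left (List.Subset.refl _), sel_self hn,
    join_sel_right h3 hZ, Category.comp_id, ← copyPair_whiskerLeft, copyPair_fst_snd_id,
    Category.id_comp]

/-! ### Positions of tensor factors and lists of wires -/

/-- The elements of a family with indices in a finite set. -/
def members {n : ℕ} (s : Fin n → Ω) (X : Finset (Fin n)) : List Ω :=
  List.ofFn fun i => s (X.orderEmbOfFin rfl i)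

theorem mem_members {n : ℕ} (s : Fin n → Ω) (X : Finset (Fin n)) (y : Ω) :
    y ∈ members s X ↔ ∃ j ∈ X, s j = y := by
  rw [members, List.mem_ofFn]
  constructor
  · rintro ⟨i, rfl⟩
    exact ⟨_, X.orderEmbOfFin_mem rfl i, rfl⟩
  · rintro ⟨j, hj, rfl⟩
    have h := X.range_orderEmbOfFin rfl
    have hj' : j ∈ (X : Set (Fin n)) := hj
    rw [← h] at hj'
    obtain ⟨i, rfl⟩ := hj'
    exact ⟨i, rfl⟩

theorem nodup_members {n : ℕ} {s : Fin n → Ω} (hs : Function.Injective s) (X : Finset (Fin n)) :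
    (members s X).Nodup :=
  List.nodup_ofFn.2 (hs.comp (X.orderEmbOfFin rfl).injective)

/-- This turns the independences of the theorem into `Indep`, with context `Z ++ Y`; all objects are
matched by `eqToHom`. -/
theorem condIndep_iff_indep {n : ℕ} {s : Fin n → Ω} (hs : Function.Injective s)
    (hl : List.ofFn s = l) (p : P ⟶ ten V l) (X Y Z : Finset (Fin n)) :
    CondIndep (fun j => V (s j)) (p ≫ eqToHom (ten_eq_tensorFin hl)) X Y Z ↔
      Indep p (members s X) (members s Z ++ members s Y) (members s Z) := by
  have hn : l.Nodup := hl ▸ List.nodup_ofFn.2 hs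
  have hsub : ∀ X, members s X ⊆ l := fun X y hy => by
    obtain ⟨j, _, rfl⟩ := (mem_members s X y).1 hy
    exact mem_of_ofFn_eq hl j
  have e : ∀ X, ten V (members s X) = subTensor (fun j => V (s j)) X := fun X => ten_eq_tensorFin rfl
  have hm : ∀ X, eqToHom (ten_eq_tensorFin hl) ≫ marg (fun j => V (s j)) X =
      sel V l (members s X) (hsub X) ≫ eqToHom (e X) := fun X =>
    eqToHom_selectFin hl hn _ rfl (hsub X)
  rw [condIndep_iff_gen]
  have hX := hsub X
  have hZY : members s Z ++ members s Y ⊆ l := List.append_subset.2 ⟨hsub Z, hsub Y⟩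
  constructor
  · rintro ⟨h, H⟩
    rw [Gen.precomp_iff, comp_copyPair, hm, hm, hm] at H
    refine ⟨hX, hZY, List.subset_append_left _ _, eqToHom (e Z) ≫ h ≫ eqToHom (e X).symm, ?_⟩
    have H1 := H.post (eqToHom (e X).symm)
    rw [Category.assoc, eqToHom_trans, eqToHom_refl, Category.comp_id] at H1
    refine H1.restrict ((eqToHom (e Z).symm ⊗ₘ eqToHom (e Y).symm) ≫ join V _ _) ?_ ?_
    · rw [← Category.assoc, copyPair_tensorHom, Category.assoc, Category.assoc, eqToHom_trans,
        eqToHom_trans, eqToHom_refl, eqToHom_refl, Category.comp_id, Category.comp_id,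
        copyPair_join]
    · rw [Category.assoc, ← Category.assoc (join V _ _), join_sel_left (List.Subset.refl _),
        sel_self (nodup_members hs Z), Category.comp_id, tensorHom_fst_assoc]
      simp
  · rintro ⟨h1, h2, h3, h, H⟩
    refine ⟨eqToHom (e Z).symm ≫ h ≫ eqToHom (e X), ?_⟩
    rw [Gen.precomp_iff, comp_copyPair, hm, hm, hm]
    refine (H.post (eqToHom (e X))).restrict (copyPair (sel V _ _ h3 ≫ eqToHom (e Z))
      (sel V _ _ (List.subset_append_right _ _) ≫ eqToHom (e Y))) ?_ ?_
    · rw [comp_copyPair, sel_sel_assoc, sel_sel_assoc]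
    · rw [copyPair_fst_assoc]
      simp

end

end Markov

/-! ### Causal models and the Markov properties -/

namespace DiHypergraph

theorem mem_cut_src (G : DiHypergraph.{w}) (Z : Set G.Wire) (x : G.Box) (A : {A : G.Wire // A ∉ Z}) :
    A ∈ (G.cut Z).src x ↔ A.1 ∈ G.src x := by
  classical
  refine List.mem_filterMap.trans ⟨?_, fun h => ⟨A.1, h, dif_neg A.2⟩⟩
  rintro ⟨B, hB, h⟩
  split at h
  · exact absurd h (by simp)
  · exact Option.some.inj h ▸ hB

theorem mem_cut_tgt (G : DiHypergraph.{w}) (Z : Set G.Wire) (x : G.Box) (A : {A : G.Wire // A ∉ Z}) :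
    A ∈ (G.cut Z).tgt x ↔ A.1 ∈ G.tgt x := by
  classical
  refine List.mem_filterMap.trans ⟨?_, fun h => ⟨A.1, h, dif_neg A.2⟩⟩
  rintro ⟨B, hB, h⟩
  split at h
  · exact absurd h (by simp)
  · exact Option.some.inj h ▸ hB

end DiHypergraph

namespace StringDiagram

open Markov

variable {S : DiHypergraph.{w}} {a b : List S.Wire} (φ : StringDiagram S a b)

theorem ofFn_outWire : List.ofFn φ.outWire = φ.outputs :=
  List.ext_getElem (by simp [length_outputs]) fun i h1 h2 => by simp [outWire]

theorem ofFn_inWire : List.ofFn φ.inWire = φ.inputs :=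
  List.ext_getElem (by simp [length_inputs]) fun i h1 h2 => by simp [inWire]

theorem mem_members_positions {X : Set φ.G.Wire} (hX : X ⊆ Set.range φ.outWire) (A : φ.G.Wire) :
    A ∈ members φ.outWire (φ.positions X) ↔ A ∈ X := by
  classical
  rw [mem_members]
  constructor
  · rintro ⟨j, hj, rfl⟩
    exact (Finset.mem_filter.1 hj).2
  · intro hA
    obtain ⟨j, rfl⟩ := hX hA
    exact ⟨j, Finset.mem_filter.2 ⟨Finset.mem_univ j, hA⟩, rfl⟩

theorem not_mem_dec_of_mem_src {x : φ.G.Box} {A : φ.G.Wire} (hA : A ∈ φ.G.src x) :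
    A ∉ φ.G.Dec {B | B ∈ φ.G.tgt x} :=
  fun ⟨B, hB, h⟩ => φ.acyclic B (.tail' h ⟨x, hA, hB⟩)

variable {φ}

theorem IsPureBloom.subset_outputs (hφ : φ.IsPureBloom) (l : List φ.G.Wire) : l ⊆ φ.outputs := by
  intro A _
  obtain ⟨j, rfl⟩ := hφ.2.2 A
  rw [← φ.ofFn_outWire]
  exact List.mem_ofFn.2 ⟨j, rfl⟩

theorem IsPureBloom.subset_range (hφ : φ.IsPureBloom) (X : Set φ.G.Wire) :
    X ⊆ Set.range φ.outWire := fun A _ => hφ.2.2 A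

theorem IsPureBloom.nodup_outputs (hφ : φ.IsPureBloom) : φ.outputs.Nodup :=
  φ.ofFn_outWire ▸ List.nodup_ofFn.2 hφ.2.1

/-- The outputs of such a box `y` are strict descendants of `x`, hence none of them is kept in `X`,
and all boxes reading them are of the same kind. -/
theorem discarded_of_mem_dec (φ : StringDiagram S a b) {x : φ.G.Box} {X : Set φ.G.Wire}
    (hX : ∀ A ∈ X, A ∈ φ.G.Dec {B | B ∈ φ.G.tgt x} → A ∈ φ.G.tgt x) (A : φ.G.Wire)
    (hA : A ∈ φ.G.Dec {B | B ∈ φ.G.tgt x}) (y : φ.G.Box) (hy : A ∈ φ.G.src y) :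
    (φ.discardOutside X).Discarded y := by
  classical
  have : IsTrans φ.G.Wire fun B A => Relation.TransGen φ.G.Edge A B :=
    ⟨fun _ _ _ h h' => h'.trans h⟩
  have : Std.Irrefl fun B A => Relation.TransGen φ.G.Edge A B := ⟨φ.acyclic⟩
  -- Well-founded induction along reversed edges: the claim for `A` uses the wires further
  -- downstream.
  induction A using (Finite.wellFounded_of_trans_of_irrefl
    fun B A => Relation.TransGen φ.G.Edge A B).induction generalizing y with
  | _ A ih =>
    have hB : ∀ B ∈ φ.G.tgt y, B ∈ φ.G.Dec {B | B ∈ φ.G.tgt x} := fun B hB =>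
      let ⟨D, hD, h⟩ := hA
      ⟨D, hD, h.tail ⟨y, hy, hB⟩⟩
    refine Discarded.intro (φ := φ.discardOutside X) y (fun B hBy hB' => ?_) fun B hBy z hz =>
      ih B (.single ⟨y, hy, hBy⟩) (hB B hBy) z hz
    have hBX : B ∈ X := of_decide_eq_true (List.mem_filter.1 hB').2
    obtain rfl := φ.tgt_unique hBy (hX B hBX (hB B hBy))
    exact φ.not_mem_dec_of_mem_src hy hA

/-- The global property is applied to the outputs of `x`, the other non-descendants and the inputs
of `x`. A global input never descends from a box, so it lies in one of the last two sets. -/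
theorem GlobalMarkov.localMarkov {C : Type u} [Category.{v} C] [MonoidalCategory C]
    [MarkovCategory C] (hφ : φ.IsPureBloom) {A : C} {V : Fin b.length → C} {f : A ⟶ tensorFin V}
    (h : φ.GlobalMarkov V f) : φ.LocalMarkov V f := by
  intro x
  refine h _ _ _ (hφ.subset_range _) (hφ.subset_range _) (hφ.subset_range _) ?_ ?_ ?_ ?_ ?_
  · refine Set.disjoint_left.2 fun A hA hA' => hA'.1 ⟨A, hA, .refl⟩
  · exact Set.disjoint_left.2 fun A hA hA' => φ.not_mem_dec_of_mem_src hA' ⟨A, hA, .refl⟩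
  · exact Set.disjoint_left.2 fun A hA hA' => hA.2 hA'
  · rintro _ ⟨i, rfl⟩
    by_cases hi : φ.inWire i ∈ φ.G.src x
    · exact .inr hi
    · exact .inl ⟨φ.not_mem_dec_of_mem_inputs (List.get_mem _ _) x, hi⟩
  · intro A B hA hB h
    -- An undirected path starting in the outputs of `x` never leaves them: boxes that read such an
    -- output are discarded, and the inputs of `x` are cut.
    suffices B.1.1 ∈ φ.G.tgt x from hB.1 ⟨_, this, .refl⟩
    clear hB
    induction h with
    | refl => exact hA
    | @tail B D _ h ih =>
      obtain ⟨⟨y, hy⟩, h, h'⟩ := h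
      have hB : B.1.1 ∈ φ.G.src y ∨ B.1.1 ∈ φ.G.tgt y :=
        h.imp (fun h => (List.mem_attachWith _ _).1 ((DiHypergraph.mem_cut_src _ _ _ _).1 h))
          fun h => (List.mem_attachWith _ _).1 ((DiHypergraph.mem_cut_tgt _ _ _ _).1 h)
      have hD : D.1.1 ∈ φ.G.src y ∨ D.1.1 ∈ φ.G.tgt y :=
        h'.imp (fun h => (List.mem_attachWith _ _).1 ((DiHypergraph.mem_cut_src _ _ _ _).1 h))
          fun h => (List.mem_attachWith _ _).1 ((DiHypergraph.mem_cut_tgt _ _ _ _).1 h)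
      have hy' : B.1.1 ∉ φ.G.src y := fun hs =>
        hy (φ.discarded_of_mem_dec (by
          rintro A ((hA | hA) | hA) hA'
          · exact hA
          · exact absurd hA' hA.1
          · exact absurd hA' (φ.not_mem_dec_of_mem_src hA)) _ ⟨_, ih, .refl⟩ y hs)
      have hyx : y = x := φ.tgt_unique (hB.resolve_left hy') ih
      rw [hyx] at hD
      exact hD.resolve_left D.2

section

variable {C : Type u} [Category.{v} C] [MonoidalCategory C] [MarkovCategory C] {T : S.Wire → C}

-- Here `U` is a union of connected components after cutting `Z`: a box with a wire in `U` has all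
-- its wires in `U ∪ Z`. Adding one box at a time, the wires in `U` remain independent of all others
-- given those in `Z`.
open Classical in
theorem GeneratedBy.indep (hC : HasConditionals C) {k : φ.Kernels T} {P : C}
    {l : List φ.G.Wire} {p : P ⟶ ten (φ.val T) l} (hp : GeneratedBy k Set.univ p)
    {U Z : Set φ.G.Wire} (hUZ : Disjoint U Z) (hin : ∀ A ∈ φ.inputs, A ∉ U) :
    ∀ {L : List φ.G.Box} (_ : φ.Topo L) (_ : φ.wiresOf L ⊆ l)
      (_ : ∀ x ∈ L, (∃ A ∈ φ.G.src x ++ φ.G.tgt x, A ∈ U) →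
        ∀ A ∈ φ.G.src x ++ φ.G.tgt x, A ∈ U ∨ A ∈ Z),
      Indep p ((φ.wiresOf L).filter (· ∈ U)) ((φ.wiresOf L).filter (· ∉ U))
        ((φ.wiresOf L).filter (· ∈ Z))
  | [], _, hl, _ => by
    -- No input lies in `U`, so nothing has to be generated yet, and the empty condition may be
    -- enlarged.
    have h1 : φ.inputs.filter (· ∈ U) = [] := List.filter_eq_nil_iff.2 (by simpa using hin)
    have h2 : (φ.inputs.filter (· ∉ U)) ⊆ l := fun A hA => hl (List.mem_filter.1 hA).1
    have h3 := (Indep.of_nil (p := p) h2).mono (List.Subset.refl _) (List.Subset.refl _)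
      (List.nil_subset (φ.inputs.filter (· ∈ Z))) (fun A hA => by
        simp only [List.mem_filter, decide_eq_true_eq] at hA ⊢
        exact ⟨hA.1, fun h => Set.disjoint_left.1 hUZ h hA.2⟩)
    rw [← h1] at h3
    exact h3
  | x :: L, hL, hl, hU => by
    have hm : φ.wiresOf L ⊆ l := List.Subset.trans (φ.wiresOf_subset_cons x L) hl
    have ht : φ.G.tgt x ⊆ l := List.Subset.trans (φ.tgt_subset_wiresOf x L) hl
    have ih := hp.indep hC hUZ hin hL.of_cons hm fun y hy => hU y (List.mem_cons_of_mem _ hy)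
    have hs := hL.src_subset_cons
    have hk := hp x trivial ht _ hm hs fun A hA => hL.of_cons.not_mem_dec hA hL.not_mem
    have hnt : ∀ A ∈ φ.wiresOf L, A ∉ φ.G.tgt x := fun A hA =>
      φ.not_mem_tgt_of_mem_wiresOf hA hL.not_mem
    have hcons : ∀ A, A ∈ φ.wiresOf (x :: L) ↔ A ∈ φ.G.tgt x ∨ A ∈ φ.wiresOf L :=
      fun A => List.mem_append
    have hd : ∀ A ∈ Z, A ∉ U := fun A h h' => Set.disjoint_left.1 hUZ h' h
    have hf : ∀ q : φ.G.Wire → Bool, (φ.wiresOf L).filter q ⊆ φ.wiresOf L :=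
      fun q A hA => (List.mem_filter.1 hA).1
    specialize hU x List.mem_cons_self
    simp only [List.mem_append] at hU
    by_cases hx : ∃ A, (A ∈ φ.G.src x ∨ A ∈ φ.G.tgt x) ∧ A ∈ U
    · specialize hU hx
      -- The box touches `U`: its outputs in `U` extend the generated side, and its outputs in `Z`
      -- become conditions.
      refine (ih.add_left hC (X' := (φ.wiresOf (x :: L)).filter (· ∈ U))
        (Z' := (φ.G.tgt x).filter (· ∈ Z)) hm ht hs hk (hf _) (hf _) ?_ ?_
        (fun A hA => (List.mem_filter.1 hA).1) ((φ.tgt_nodup x).filter _) ?_).mono (List.Subset.refl _) ?_ ?_ ?_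
      all_goals
        intro A hA
        simp only [List.mem_append, List.mem_filter, decide_eq_true_eq, hcons] at hA ⊢
        grind
    -- The box avoids `U`: all its outputs join the context, and those in `Z` are adjoined to the
    -- condition by `Indep.mono`.
    · refine (ih.add_right hm ht hs hk (hf _) (hf _) ?_ ?_).mono ?_ ?_ ?_ ?_
      all_goals
        intro A hA
        simp only [List.mem_append, List.mem_filter, decide_eq_true_eq, hcons] at hA ⊢
        grind

/-- `GeneratedBy.indep` is applied to the set of wires connected to `X`, using only the boxes that
survive normalization. By d-separation this set misses `Y`, and as the inputs lie in `Y ∪ Z`, it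
contains none of them. -/
theorem GeneratedBy.globalMarkov (hC : HasConditionals C) (hφ : φ.IsPureBloom) {k : φ.Kernels T}
    {P : C} {p : P ⟶ ten (φ.val T) φ.outputs} (hp : GeneratedBy k Set.univ p) :
    φ.GlobalMarkov (fun j => φ.val T (φ.outWire j))
      (p ≫ eqToHom (ten_eq_tensorFin φ.ofFn_outWire)) := by
  classical
  intro X Y Z hX hY hZ hXY hXZ hYZ hin hsep
  rw [condIndep_iff_indep hφ.2.1 φ.ofFn_outWire]
  let χ := φ.discardOutside (X ∪ Y ∪ Z)
  let G : DiHypergraph := χ.norm.G.cut {A | A.1 ∈ Z}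
  obtain ⟨U, hU⟩ : ∃ U : Set φ.G.Wire, ∀ A, A ∈ U ↔ ∃ (h : χ.Remains A) (h' : A ∉ Z)
    (B : G.Wire), B.1.1 ∈ X ∧ G.UndirectedPath B ⟨⟨A, h⟩, h'⟩ := ⟨_, fun A => Iff.rfl⟩
  have hrem : ∀ A ∈ X ∪ Y ∪ Z, χ.Remains A := fun A hA => χ.remains_outputs A
    (List.mem_filter.2 ⟨hφ.subset_outputs [A] List.mem_cons_self, by simpa using hA⟩)
  have hUZ : Disjoint U Z := Set.disjoint_left.2 fun A hA =>
    let ⟨_, h, _⟩ := (hU A).1 hA; h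
  have hUY : ∀ A ∈ Y, A ∉ U := fun A hA h =>
    let ⟨h1, h2, B, hB, h⟩ := (hU A).1 h; hsep B ⟨⟨A, h1⟩, h2⟩ hB hA h
  -- Whatever feeds a surviving box survives, so these boxes can be ordered on their own.
  obtain ⟨L, hL, hLN⟩ := φ.exists_topo (Finset.univ.filter fun x => ¬ χ.Discarded x) (by
    simp only [Finset.mem_filter, Finset.mem_univ, true_and]
    rintro x hx A hA y hy ⟨_, _, h⟩
    exact hx (h A hy x hA))
  simp only [Finset.mem_filter, Finset.mem_univ, true_and] at hLN
  have hmem : ∀ A, χ.Remains A → A ∈ φ.wiresOf L := fun A hA => (φ.mem_wiresOf A L).2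
    ((φ.mem_inputs_or_tgt A).imp_right fun ⟨x, hx⟩ => ⟨x, (hLN x).2 (hA x hx), hx⟩)
  have key := hp.indep hC (U := U) (Z := Z) hUZ (fun A hA hU => by
    obtain ⟨i, rfl⟩ : A ∈ Set.range φ.inWire := by
      rw [← φ.ofFn_inWire] at hA
      exact List.mem_ofFn.1 hA
    obtain h | h := hin ⟨i, rfl⟩
    · exact hUY _ h hU
    · exact Set.disjoint_left.1 hUZ hU h) hL (hφ.subset_outputs _) (by
    rintro x hx ⟨A, hA, hAU⟩ D hD
    obtain ⟨hA1, hA2, B, hB, hBA⟩ := (hU A).1 hAU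
    have hx' := (hLN x).1 hx
    by_cases hDZ : D ∈ Z
    · exact .inr hDZ
    refine .inl <| (hU D).2 ⟨?_, hDZ, B, hB, hBA.tail ⟨⟨x, hx'⟩, ?_, ?_⟩⟩
    · exact (List.mem_append.1 hD).elim (χ.remains_src hx' D) (χ.remains_tgt hx' D)
    · refine (List.mem_append.1 hA).imp (fun h => ?_) fun h => ?_
      · exact (DiHypergraph.mem_cut_src _ _ _ _).2 ((List.mem_attachWith _ _).2 h)
      · exact (DiHypergraph.mem_cut_tgt _ _ _ _).2 ((List.mem_attachWith _ _).2 h)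
    · refine (List.mem_append.1 hD).imp (fun h => ?_) fun h => ?_
      · exact (DiHypergraph.mem_cut_src _ _ _ _).2 ((List.mem_attachWith _ _).2 h)
      · exact (DiHypergraph.mem_cut_tgt _ _ _ _).2 ((List.mem_attachWith _ _).2 h))
  refine key.mono ?_ ?_ ?_ (List.subset_append_left _ _)
  · intro A hA
    rw [mem_members_positions φ hX] at hA
    have h := hrem A (.inl (.inl hA))
    have h' : A ∉ Z := Set.disjoint_left.1 hXZ hA
    exact List.mem_filter.2 ⟨hmem A h, decide_eq_true <|
      (hU A).2 ⟨h, h', ⟨⟨A, h⟩, h'⟩, hA, .refl⟩⟩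
  · intro A hA
    rw [List.mem_append, mem_members_positions φ hZ, mem_members_positions φ hY] at hA
    obtain hA | hA := hA
    · exact List.mem_filter.2 ⟨hmem A (hrem A (.inr hA)),
        decide_eq_true fun h => Set.disjoint_left.1 hUZ h hA⟩
    · exact List.mem_filter.2 ⟨hmem A (hrem A (.inl (.inr hA))), decide_eq_true (hUY A hA)⟩
  · intro A hA
    rw [mem_members_positions φ hZ]
    exact of_decide_eq_true (List.mem_filter.1 hA).2

/-- The inputs of a box and its remaining non-descendants make up all non-descendants, so the local
Markov property yields the kernel in the largest admissible context; smaller contexts follow by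
`Gen.restrict`. -/
theorem LocalMarkov.exists_generatedBy (hφ : φ.IsPureBloom) {P : C}
    {p : P ⟶ ten (φ.val T) φ.outputs}
    (h : φ.LocalMarkov (fun j => φ.val T (φ.outWire j))
      (p ≫ eqToHom (ten_eq_tensorFin φ.ofFn_outWire))) :
    ∃ k : φ.Kernels T, GeneratedBy k Set.univ p := by
  classical
  have h1 : ∀ x, Indep p (φ.G.tgt x)
      (φ.outputs.filter (· ∉ φ.G.Dec {B | B ∈ φ.G.tgt x})) (φ.G.src x) := by
    intro x
    refine ((condIndep_iff_indep hφ.2.1 φ.ofFn_outWire p _ _ _).1 (h x)).mono ?_ ?_ ?_ ?_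
    · intro A hA
      rwa [mem_members_positions φ (hφ.subset_range _)]
    · intro A hA
      rw [List.mem_append, mem_members_positions φ (hφ.subset_range _),
        mem_members_positions φ (hφ.subset_range _)]
      rw [List.mem_filter, decide_eq_true_eq] at hA
      by_cases hs : A ∈ φ.G.src x
      · exact .inl hs
      · exact .inr ⟨hA.2, hs⟩
    · intro A hA
      rwa [mem_members_positions φ (hφ.subset_range _)] at hA
    · intro A hA
      rw [List.mem_filter, decide_eq_true_eq]
      exact ⟨hφ.subset_outputs _ hA, φ.not_mem_dec_of_mem_src hA⟩
  choose h2 h3 h4 k hk using h1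
  refine ⟨k, fun x _ ht m hm hs hd => ?_⟩
  have hm' : m ⊆ φ.outputs.filter (· ∉ φ.G.Dec {B | B ∈ φ.G.tgt x}) := fun A hA =>
    List.mem_filter.2 ⟨hm hA, decide_eq_true (hd A hA)⟩
  refine (hk x).restrict (sel _ _ m hm') (sel_sel _ _) ?_
  rw [sel_sel_assoc]

/-- Any admissible choice of positions `s` gives the wiring to the list of inputs, and bijectivity
of `outWire` ensures that one exists. -/
theorem passesInputs_iff (hφ : φ.IsPureBloom)
    (p : tensorFin (fun i => φ.val T (φ.inWire i)) ⟶ ten (φ.val T) φ.outputs) :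
    φ.PassesInputs (fun i => φ.val T (φ.inWire i)) (fun j => φ.val T (φ.outWire j))
      (p ≫ eqToHom (ten_eq_tensorFin φ.ofFn_outWire)) ↔
    p ≫ sel _ _ φ.inputs (hφ.subset_outputs _) = eqToHom (ten_eq_tensorFin φ.ofFn_inWire).symm := by
  have key : ∀ (s : Fin a.length → Fin b.length) (hs : ∀ i, φ.outWire (s i) = φ.inWire i),
      ∃ (h : ten (φ.val T) φ.inputs = tensorFin fun i => φ.val T (φ.outWire (s i))),
      (p ≫ eqToHom (ten_eq_tensorFin φ.ofFn_outWire)) ≫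
        selectFin (fun j => φ.val T (φ.outWire j)) s =
          p ≫ sel _ _ φ.inputs (hφ.subset_outputs _) ≫ eqToHom h := fun s hs => by
    have h1 : List.ofFn (fun i => φ.outWire (s i)) = φ.inputs := by
      rw [funext hs, ofFn_inWire]
    refine ⟨ten_eq_tensorFin h1, ?_⟩
    rw [Category.assoc, eqToHom_selectFin φ.ofFn_outWire hφ.nodup_outputs s h1]
  constructor
  · intro h
    choose s hs using fun i => hφ.2.2 (φ.inWire i)
    obtain ⟨_, h1⟩ := h s hs
    obtain ⟨e, h2⟩ := key s hs
    rw [h2] at h1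
    simpa using congrArg (· ≫ eqToHom e.symm) h1
  · intro h s hs
    obtain ⟨e, h2⟩ := key s hs
    refine ⟨funext fun i => congrArg (φ.val T) (hs i).symm, ?_⟩
    rw [h2, ← Category.assoc, h, eqToHom_trans]

end

end StringDiagram

/-! ### Compatibility -/

namespace StringDiagram

open Markov

variable {S : DiHypergraph.{w}} {a b : List S.Wire} {φ : StringDiagram S a b}

/-- A string diagram as a part of itself. -/
def idEmbedding (φ : StringDiagram S a b) : Embedding φ φ where
  wire := id
  box := id
  src_box _ := (List.map_id _).symm
  tgt_box _ := (List.map_id _).symm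
  type_wire _ := rfl
  type_box _ := rfl
  box_injective := Function.injective_id
  not_mem_dec _ hA := not_mem_dec_of_mem_inputs _ hA

variable {C : Type u} [Category.{v} C] [MonoidalCategory C] [MarkovCategory C] {T : S.Wire → C}

theorem idEmbedding_wir {l n : List φ.G.Wire} (h : n ⊆ l) (h' : n.map φ.idEmbedding.wire ⊆ l) :
    φ.idEmbedding.wir T l n h' = sel (φ.val T) l n h :=
  ((φ.idEmbedding.sel_eqToHom h (List.map_id n).symm).symm.trans (by rw [eqToHom_refl])).trans
    (Category.comp_id _)

theorem GeneratedBy.comp_sel {k : φ.Kernels T} {N : Set φ.G.Box} {P Q : C} {l m : List φ.G.Wire}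
    {p : P ⟶ ten (φ.val T) l} (hp : GeneratedBy k N p) (d : Q ⟶ P) (hm : m ⊆ l) :
    GeneratedBy k N (d ≫ p ≫ sel _ l m hm) := by
  intro x hx ht n hn hs hd
  have h : Gen p (sel _ l m hm ≫ sel _ m (φ.G.tgt x) ht) (sel _ l m hm ≫ sel _ m n hn)
      (sel _ n (φ.G.src x) hs ≫ k x) := by
    rw [sel_sel, sel_sel]
    exact hp x hx _ n _ hs hd
  rw [← Category.assoc, Gen.precomp_iff]
  exact (Category.assoc _ _ _).trans ((congrArg (d ≫ ·) h).trans (Category.assoc _ _ _).symm)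

theorem evalMap_eq (κ : ∀ s : S.Box, ten T (S.src s) ⟶ ten T (S.tgt s)) (φ : StringDiagram S a b) :
    evalMap κ φ = eqToHom (ten_val φ.inputs_type) ≫
      (joint κ φ ≫ sel _ _ φ.outputs (φ.subset_allWires _)) ≫
        eqToHom (ten_val φ.outputs_type).symm :=
  congrArg (eqToHom _ ≫ ·) (Category.assoc _ _ _).symm

theorem eqToHom_conj {X X' X'' Y Y' Y'' : C} (h : X'' = X') (h' : X' = X) (f : X ⟶ Y)
    (e' : Y = Y') (e : Y' = Y'') : eqToHom h ≫ (eqToHom h' ≫ f ≫ eqToHom e') ≫ eqToHom e =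
      eqToHom (h.trans h') ≫ f ≫ eqToHom (e'.trans e) := by
  simp

/-- The functor is an evaluation, so up to `eqToHom` the morphism is `joint` restricted to the
outputs: it is `GeneratedBy`, and its marginal on the inputs is the identity. -/
theorem Compatible.passesInputs_and_globalMarkov (hs : IsStrictMonoidal C) (hC : HasConditionals C)
    (hφ : φ.IsPureBloom) {W : Fin a.length → C} {V : Fin b.length → C}
    {f : tensorFin W ⟶ tensorFin V} (h : φ.Compatible hφ.1 W V f) :
    φ.PassesInputs W V f ∧ φ.GlobalMarkov V f := by
  obtain ⟨F, hW, hV, rfl⟩ := h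
  obtain ⟨κ, hκ⟩ := exists_map_eq_evalMap hs F
  obtain rfl : W = fun i => φ.val (fun x => F.obj [x]) (φ.inWire i) :=
    funext fun i => (hW i).trans (congrArg (fun x => F.obj [x]) (φ.type_inWire i).symm)
  obtain rfl : V = fun j => φ.val (fun x => F.obj [x]) (φ.outWire j) :=
    funext fun j => (hV j).trans (congrArg (fun x => F.obj [x]) (φ.type_outWire j).symm)
  let d := eqToHom (ten_eq_tensorFin (V := φ.val fun x => F.obj [x]) φ.ofFn_inWire).symm
  have h1 : eqToHom (tensorFin_eq F hW) ≫ F.map ⟨φ, hφ.1⟩ ≫ eqToHom (tensorFin_eq F hV).symm =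
      (d ≫ joint κ φ ≫ sel _ _ φ.outputs (φ.subset_allWires _)) ≫
        eqToHom (ten_eq_tensorFin φ.ofFn_outWire) := by
    have h : F.map ⟨φ, hφ.1⟩ = eqToHom ((obj_eq_ten F a).trans (ten_val φ.inputs_type)) ≫
        (joint κ φ ≫ sel _ _ φ.outputs (φ.subset_allWires _)) ≫
          eqToHom ((obj_eq_ten F b).trans (ten_val φ.outputs_type)).symm := by
      have := hκ ⟨φ, hφ.1⟩
      rw [evalMap_eq, eqToHom_conj] at this
      exact this
    exact ((congrArg (eqToHom _ ≫ · ≫ eqToHom _) h).trans (eqToHom_conj _ _ _ _ _)).trans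
      (Category.assoc _ _ _).symm
  rw [h1]
  refine ⟨(passesInputs_iff hφ _).2 ?_,
    GeneratedBy.globalMarkov hC hφ ((joint_generatedBy κ φ).comp_sel d _)⟩
  rw [Category.assoc, Category.assoc, sel_sel, joint_sel_inputs, Category.comp_id]

/-- Uniqueness with the diagram as a part of itself: `p` equals its marginal on the inputs, an
identity by `hi`, followed by the evaluation of `φ`. -/
theorem GeneratedBy.compatible (hs : IsStrictMonoidal C) (hφ : φ.IsPureBloom)
    (κ : ∀ s : S.Box, ten T (S.src s) ⟶ ten T (S.tgt s))
    {p : tensorFin (fun i => φ.val T (φ.inWire i)) ⟶ ten (φ.val T) φ.outputs}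
    (hp : GeneratedBy (kernels κ φ) Set.univ p)
    (hi : p ≫ sel _ _ φ.inputs (hφ.subset_outputs _) =
      eqToHom (ten_eq_tensorFin φ.ofFn_inWire).symm) :
    φ.Compatible hφ.1 (fun i => φ.val T (φ.inWire i)) (fun j => φ.val T (φ.outWire j))
      (p ≫ eqToHom (ten_eq_tensorFin φ.ofFn_outWire)) := by
  have h1 := hp.wir κ hφ.subset_outputs φ.idEmbedding φ.outputs
  rw [idEmbedding_wir (hφ.subset_outputs _), idEmbedding_wir (hφ.subset_outputs _),
    sel_self hφ.nodup_outputs, Category.comp_id, ← Category.assoc, hi] at h1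
  refine ⟨evalFunctor κ hs,
    fun i => (congrArg T (φ.type_inWire i)).trans (hs.tensor_unit _).symm,
    fun j => (congrArg T (φ.type_outWire j)).trans (hs.tensor_unit _).symm, ?_⟩
  rw [h1]
  exact (Category.assoc _ _ _).trans (((congrArg (eqToHom _ ≫ · ≫ eqToHom _)
    (evalMap_eq κ φ)).trans (eqToHom_conj _ _ _ _ _)).symm)

/-- If the boxes have pairwise distinct types, then any choice of morphisms for them is induced by
morphisms for their types. -/
theorem exists_kernels_eq (hd : Function.Injective φ.type.box)
    (hT : ∀ x : S.Box, x ∉ Set.range φ.type.box → Nonempty (ten T (S.src x) ⟶ ten T (S.tgt x)))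
    (k : φ.Kernels T) :
    ∃ κ : ∀ s : S.Box, ten T (S.src s) ⟶ ten T (S.tgt s), kernels κ φ = k := by
  have h : ∀ s, ∃ κ : ten T (S.src s) ⟶ ten T (S.tgt s), ∀ x (hx : φ.type.box x = s),
      κ = eqToHom (hx ▸ ten_val (φ.type.src_box x).symm) ≫ k x ≫
        eqToHom (hx ▸ (ten_val (φ.type.tgt_box x).symm).symm) := by
    intro s
    by_cases hs : s ∈ Set.range φ.type.box
    · obtain ⟨x, rfl⟩ := hs
      refine ⟨eqToHom (ten_val (φ.type.src_box x).symm) ≫ k x ≫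
        eqToHom (ten_val (φ.type.tgt_box x).symm).symm, fun y hy => ?_⟩
      -- Two boxes of the same type coincide, so the prescription for `κ` is consistent.
      obtain rfl := hd hy
      rfl
    · exact (hT s hs).elim fun κ => ⟨κ, fun x hx => absurd ⟨x, hx⟩ hs⟩
  choose κ hκ using h
  refine ⟨κ, funext fun x => ?_⟩
  rw [kernels, hκ _ x rfl]
  simp

end StringDiagram

/-! ### The equivalence -/

theorem mainTheorem1 {C : Type u} [Category.{v} C] [MonoidalCategory C] [MarkovCategory C]
    (hstrict : IsStrictMonoidal C) (hcond : HasConditionals C)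
    {S : DiHypergraph.{w}} {a b : List S.Wire} (φ : StringDiagram S a b) (hφ : φ.IsPureBloom)
    (hdistinct : Function.Injective φ.type.box)
    (T : S.Wire → C) (W : Fin a.length → C) (V : Fin b.length → C)
    (hW : ∀ i, W i = T (φ.type.wire (φ.inWire i)))
    (hV : ∀ j, V j = T (φ.type.wire (φ.outWire j)))
    (hT : ∀ x : S.Box, x ∉ Set.range φ.type.box →
      Nonempty (tensorFin (fun i => T ((S.src x).get i)) ⟶
        tensorFin (fun j => T ((S.tgt x).get j))))
    (f : tensorFin W ⟶ tensorFin V) :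
    [φ.Compatible hφ.1 W V f,
      φ.PassesInputs W V f ∧ φ.GlobalMarkov V f,
      φ.PassesInputs W V f ∧ φ.LocalMarkov V f].TFAE ∧
    (φ.GlobalMarkov V f → φ.LocalMarkov V f) := by
  refine ⟨?_, fun h => h.localMarkov hφ⟩
  tfae_have 1 → 2 := fun h => h.passesInputs_and_globalMarkov hstrict hcond hφ
  tfae_have 2 → 3 := fun h => ⟨h.1, h.2.localMarkov hφ⟩
  tfae_have 3 → 1 := by
    obtain rfl : W = fun i => φ.val T (φ.inWire i) := funext hW
    obtain rfl : V = fun j => φ.val T (φ.outWire j) := funext hV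
    -- The codomain is rewritten as a tensor product over the list of output wires, where the
    -- calculus of `sel` applies.
    obtain ⟨p, rfl⟩ : ∃ p, f = p ≫ eqToHom (Markov.ten_eq_tensorFin φ.ofFn_outWire) :=
      ⟨f ≫ eqToHom (Markov.ten_eq_tensorFin φ.ofFn_outWire).symm, by simp⟩
    rintro ⟨h1, h2⟩
    obtain ⟨k, hk⟩ := h2.exists_generatedBy hφ
    obtain ⟨κ, rfl⟩ := StringDiagram.exists_kernels_eq hdistinct (fun x hx => (hT x hx).map fun g =>
      eqToHom (Markov.ten_eq_tensorFin (List.ofFn_get _)) ≫ g ≫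
        eqToHom (Markov.ten_eq_tensorFin (List.ofFn_get _)).symm) k
    exact hk.compatible hstrict hφ κ ((StringDiagram.passesInputs_iff hφ p).1 h1)
  tfae_finish
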